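/- Fix $q\in\mathbb C$ with $0<|q|<1$. For $|p|<1$ put $(x;q)=\prod_{k\ge0}(1-xq^k)$, $\theta(x;p)=(x;p)(p/x;p)$, $\theta(x;q;p)_m=\prod_{k=0}^{m-1}\theta(xq^k;p)$, $\Gamma(x)=\Gamma(x;p,q)=\prod_{i,j\ge0}\frac{1-p^{i+1}q^{j+1}/x}{1-p^iq^jx}$. Write $p=e^s$ and $p^x=e^{xs}$ ($x\in\mathbb R$); $p\to0$ means $\operatorname{Re}s\to-\infty$. A contour is a finite sum of closed $C^1$ curves; it *contains* (*excludes*) a point $w$ if it does not pass through $w$ and has winding number $1$ ($0$) about $w$. *Function spaces.* For $u\ne0$, $m\ge 0$ a meromorphic function $f$ on $\mathbb C^*$ belongs to $A(u;p,q)$ with pole bound $m$ if $f(1/z)=f(z)=f(pz)$ and $\theta(pqz/u;q;p)_m\,\theta(pq/(uz);q;p)_m\,f(z)$ is holomorphic on $\mathbb C^*$. Let $\zeta\in\mathbb R$. We write $f\in\tilde A(tp^{\alpha})$ with pole bound $m$ for a family $f(\cdot)=f(\cdot\,;s)$ such that $f\in A(tp^{\alpha};p,q)$ with pole bound $m$ for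 all small $p$, and such that $f(p^\zeta z)$ is the sum of a nonzero series $\sum_{\tau}a_\tau(z)p^{\tau}$, with $a_\tau\in\mathbb C(z)$ and real exponents of which only finitely many lie below any bound, in the following sense: for some nonzero polynomial $P$ the $a_\tau$ have no poles outside the zero set of $P$, and for each compact set $K$ disjoint from this zero set the series (multiplied by $p^{-\mathrm{val}(f)}$) converges uniformly for $z\in K$ and $0<|p|\le\varepsilon$, for some $\varepsilon>0$. Here $\mathrm{val}(f)$ is the least exponent with nonzero coefficient and $\mathrm{lc}(f)\in\mathbb C(z)$ is that coefficient (both are those of $f(p^{\zeta}z)$). *Bilinear form.* For $T_0\cdots T_5=pq$, and $f\in A(T_4;p,q)$, $g\in A(T_5;p,q)$ with pole bounds $m_f,m_g$, let $$\langle f,g\rangle_{T}=\frac{(q;q)(p;p)}{2\prod_{0\le r<s\le5}\Gamma(T_rT_s)}\int_C f(z)g(z)\frac{\prod_{r=0}^5\Gamma(T_rz)\Gamma(T_r/z)}{\Gamma(z^2)\Gamma(z^{-2})}\frac{dz}{2\pi iz},$$ where $C$ contains $0$ and all $p^iq^j\tilde T_r$ and excludes all $(p^iq^j\tilde T_r)^{-1}$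 ($i,j\ge0$), with $\tilde T_r=T_r$ for $r\le3$, $\tilde T_4=q^{-m_f}T_4$, $\tilde T_5=q^{-m_g}T_5$. Such $C$ exists if $p$ is *nondegenerate*, i.e. $p^iq^j\tilde T_r\tilde T_{r'}\ne1$ for all $r,r'$ (possibly equal) and $i,j\ge0$. **Proposition.** Let $t_0,\dots,t_5\in\mathbb C$ satisfy $\prod_rt_r=q$ and $t_rt_{r'}\notin q^{\mathbb Z}$ for all $r,r'$ (possibly equal). Let $a,b,c\in\{0,\dots,5\}$ be distinct, $T=\{a,b,c\}$, and let $\alpha\in\mathbb R^6$ and $-\frac12\le\zeta<0$ satisfy $\sum_r\alpha_r=1$, $\alpha_a+\alpha_b+\alpha_c=\zeta$, $\zeta\le\alpha_r\le-\zeta$ for $r\in T$ and $-\zeta\le\alpha_r\le1+\zeta$ for $r\notin T$. Let $f\in\tilde A(t_4p^{\alpha_4})$ and $g\in\tilde A(t_5p^{\alpha_5})$ with pole bounds $m_f,m_g$, and let $\tilde t_r=t_r$ for $r\le 3$, $\tilde t_4=q^{-m_f}t_4$, $\tilde t_5=q^{-m_g}t_5$. For the parameters $T_r=t_rp^{\alpha_r}$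 all but countably many $s$ (with $p=e^s$) are nondegenerate, for these (with $|p|<1$) the contour in the bilinear form exists, and, as $p\to0$ through nondegenerate values, $$\lim_{p\to0}p^{-\mathrm{val}(f)-\mathrm{val}(g)}\langle f,g\rangle_{t_rp^{\alpha_r}}=\frac{(q;q)\prod_{r,s\in T,\ \alpha_r+\alpha_s=-1}(t_rt_s;q)\prod_{r\in T,\,s\notin T,\ \alpha_r+\alpha_s=0}(t_rt_s;q)}{\prod_{r,s\in T,\ \alpha_r+\alpha_s=0}(q/t_rt_s;q)\prod_{\alpha_r+\alpha_s=1}(q/t_rt_s;q)}$$ $$\times\int_{C'}\mathrm{lc}(f)(z)\,\mathrm{lc}(g)(z)\,\frac{\prod_{r\in T,\,\alpha_r=-\zeta}(q/(t_rz);q)\prod_{r\notin T,\,\alpha_r=1+\zeta}(qz/t_r;q)}{\prod_{r\in T,\,\alpha_r=\zeta}(t_r/z;q)\prod_{r\notin T,\,\alpha_r=-\zeta}(t_rz;q)}\left(\frac{(z^2;q)\prod_{r\in T,\,\alpha_r=1/2}(qz/t_r;q)}{(qz^2;q)\prod_{r\in T,\,\alpha_r=-1/2}(t_rz;q)}\right)^{1_{\zeta=-1/2}}\theta\!\left(\frac{qz}{t_at_bt_c};q\right)\frac{dz}{2\pi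 iz},$$ where products over two indices run over unordered pairs of distinct indices, and $C'$ is any contour that contains $0$, contains all $\tilde t_rq^k$ ($k\ge0$) whenever $(t_r/z;q)$ occurs in the denominator of the weight, and excludes all $q^{-k}/\tilde t_r$ ($k\ge0$) whenever $(t_rz;q)$ occurs in the denominator. Such a $C'$ exists. -/

import Mathlib

open Filter Topology

noncomputable section

namespace EllipticLimit

/-! ### `q`-symbols, theta function, elliptic gamma function -/

/-- `(x; q) = ∏_{k ≥ 0} (1 - x q^k)`. -/
def qPoch (x q : ℂ) : ℂ := ∏' k : ℕ, (1 - x * q ^ k)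

/-- `(x; p, q) = ∏_{i, j ≥ 0} (1 - x p^i q^j)`. -/
def qPoch₂ (x p q : ℂ) : ℂ := ∏' k : ℕ × ℕ, (1 - x * p ^ k.1 * q ^ k.2)

/-- `θ(x; p) = (x; p) (p/x; p)`. -/
def theta (x p : ℂ) : ℂ := qPoch x p * qPoch (p / x) p

/-- `θ(x; q; p)_n = ∏_{0 ≤ k < n} θ(x q^k; p)`. -/
def thetaPoch (x q p : ℂ) (n : ℕ) : ℂ := ∏ k ∈ Finset.range n, theta (x * q ^ k) p

/-- The elliptic gamma function
`Γ(x; p, q) = ∏_{i, j ≥ 0} (1 - p^{i+1} q^{j+1} / x) / (1 - p^i q^j x)`. -/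
def ellGamma (x p q : ℂ) : ℂ := qPoch₂ (p * q / x) p q / qPoch₂ x p q

/-! ### Cycles in the plane -/

/-- A cycle: a finite formal sum of closed `C¹` curves, parametrized by `[0, 1]`. (Multiplicities
are obtained by repeating or reversing curves, corners by letting the derivative vanish.) -/
structure ContourCycle where
  num : ℕ
  loop : Fin num → ℝ → ℂ
  contDiff : ∀ i, ContDiff ℝ 1 (loop i)
  closed : ∀ i, loop i 0 = loop i 1

/-- `∫_C F(z) dz`. -/
def ContourCycle.integral (C : ContourCycle) (F : ℂ → ℂ) : ℂ :=
  ∑ i, ∫ x in (0 : ℝ)..1, F (C.loop i x) * deriv (C.loop i) x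

/-- The set of points on the curves of `C`. -/
def ContourCycle.trace (C : ContourCycle) : Set ℂ := ⋃ i, C.loop i '' Set.Icc 0 1

/-- The winding number of `C` about a point `w` off its trace. -/
def ContourCycle.winding (C : ContourCycle) (w : ℂ) : ℂ :=
  (2 * Real.pi * Complex.I)⁻¹ * C.integral fun z => (z - w)⁻¹

/-- `C` contains `w`: it goes around `w` exactly once, counterclockwise. -/
def ContourCycle.Contains (C : ContourCycle) (w : ℂ) : Prop := w ∉ C.trace ∧ C.winding w = 1

/-- `C` excludes `w`: its winding number about `w` is zero. -/
def ContourCycle.Excludes (C : ContourCycle) (w : ℂ) : Prop := w ∉ C.trace ∧ C.winding w = 0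

/-! ### The spaces of functions -/

/-- The factor `θ(p q z / u; q; p)_m θ(p q / (u z); q; p)_m`
`= Γ(u z, u / z; p, q) / Γ(u q^{-m} z, u q^{-m} / z; p, q)`. -/
def poleFactor (q p u : ℂ) (m : ℕ) (z : ℂ) : ℂ :=
  thetaPoch (p * q * z / u) q p m * thetaPoch (p * q * z⁻¹ / u) q p m

/-- `f` belongs to `A(u; p, q)`, with `m` as a bound for the order of its poles: `f` is a
meromorphic function on `ℂ*` which is symmetric and `p`-abelian, and `poleFactor * f` is holomorphic
on `ℂ*`. As `f` is a meromorphic function, its values at the zeros of `poleFactor` (where it may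
have poles) do not matter. -/
def InA (q p u : ℂ) (m : ℕ) (f : ℂ → ℂ) : Prop :=
  (∃ h : ℂ → ℂ, DifferentiableOn ℂ h {0}ᶜ ∧
    ∀ z, z ≠ 0 → poleFactor q p u m z ≠ 0 → poleFactor q p u m z * f z = h z) ∧
  (∀ z, z ≠ 0 → poleFactor q p u m z ≠ 0 → f z⁻¹ = f z) ∧
  (∀ z, z ≠ 0 → poleFactor q p u m z ≠ 0 → f (p * z) = f z)

/-- `p^x`, where the branch is fixed by `p = e^s`. -/
def ppow (s : ℂ) (x : ℝ) : ℂ := Complex.exp (x * s)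

/-- The limit `p = e^s → 0`, that is `Re s → -∞`, uniformly in the choice of the branch. -/
def pToZero : Filter ℂ := comap Complex.re atBot

/-- A formal series `∑_t a_t(z) p^t` is a Hahn series with real exponents and with coefficients in
`ℂ(z)`. This is the partial sum of `p^{-val} ∑_t a_t(z) p^t` over the exponents `t ≤ N`. -/
def partialEval (S : HahnSeries ℝ (RatFunc ℂ)) (N : ℝ) (s z : ℂ) : ℂ :=
  ∑ᶠ t ∈ S.support ∩ Set.Iic N, (S.coeff t).eval (RingHom.id ℂ) z * ppow s (t - S.order)

/-- The nonzero formal series `S` has a discrete set of exponents (finitely many below every bound),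
and outside the zero set of some nonzero polynomial its coefficients have no poles and, for every
compact set `K`, the series `p^{-val(S)} S` converges to `p^{-val(S)} F`, uniformly for `z ∈ K` and
`0 < |p| ≤ ε`, for some `ε > 0`. Here `F s z` is the value at `z` for `p = e^s`. The valuation of
the series is `S.order`, its leading coefficient is `S.leadingCoeff`. -/
def Represents (S : HahnSeries ℝ (RatFunc ℂ)) (F : ℂ → ℂ → ℂ) : Prop :=
  S ≠ 0 ∧ (∀ N : ℝ, (S.support ∩ Set.Iic N).Finite) ∧
  ∃ P : Polynomial ℂ, P ≠ 0 ∧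
    (∀ (t : ℝ) (z : ℂ), P.eval z ≠ 0 → (S.coeff t).denom.eval z ≠ 0) ∧
    ∀ K : Set ℂ, IsCompact K → (∀ z ∈ K, P.eval z ≠ 0) →
      ∃ ε : ℝ, 0 < ε ∧
        TendstoUniformlyOn (fun (N : ℝ) (x : ℂ × ℂ) => partialEval S N x.1 x.2)
          (fun x => ppow x.1 (-S.order) * F x.1 x.2) atTop
          {x | ‖Complex.exp x.1‖ ≤ ε ∧ x.2 ∈ K}

/-- `f` belongs to `Ã(t p^α)`, as a family of functions of `z` depending on `p = e^s`, with pole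
bound `m`, and `S` is the series in `p` of `f(p^ζ z)`. -/
def InATilde (q t : ℂ) (α ζ : ℝ) (m : ℕ) (f : ℂ → ℂ → ℂ) (S : HahnSeries ℝ (RatFunc ℂ)) : Prop :=
  (∀ᶠ s in pToZero, InA q (Complex.exp s) (t * ppow s α) m (f s)) ∧
  Represents S fun s z => f s (ppow s ζ * z)

/-! ### The elliptic bilinear form -/

/-- The parameters `t̃_r`: `t̃_r = t_r` for `r ≤ 3`, `t̃_4 = t_4 q^{-m_f}`, `t̃_5 = t_5 q^{-m_g}`. -/
def tTilde (q : ℂ) (mf mg : ℕ) (t : Fin 6 → ℂ) (r : Fin 6) : ℂ :=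
  t r / q ^ ((![0, 0, 0, 0, mf, mg] : Fin 6 → ℕ) r)

/-- The condition on the contour of the elliptic bilinear form, in terms of the parameters `t̃_r`:
it contains the points `p^i q^j t̃_r` (and their limit point `0`) and excludes the reciprocals. -/
def IsEllipticContour (q p : ℂ) (tt : Fin 6 → ℂ) (C : ContourCycle) : Prop :=
  C.Contains 0 ∧ ∀ (r : Fin 6) (i j : ℕ),
    C.Contains (p ^ i * q ^ j * tt r) ∧ C.Excludes (p ^ i * q ^ j * tt r)⁻¹

/-- No point `p^i q^j t̃_r` that the contour has to contain is one that it has to exclude. -/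
def Nondegenerate (q p : ℂ) (tt : Fin 6 → ℂ) : Prop :=
  ∀ (r r' : Fin 6) (i j : ℕ), p ^ i * q ^ j * (tt r * tt r') ≠ 1

/-- The bilinear form `⟨f, g⟩_{t_0, …, t_5; q; p}`, computed with the contour `C`. -/
def ellForm (q p : ℂ) (t : Fin 6 → ℂ) (C : ContourCycle) (f g : ℂ → ℂ) : ℂ :=
  qPoch q q * qPoch p p /
      (2 * ∏ x : Fin 6 × Fin 6 with x.1 < x.2, ellGamma (t x.1 * t x.2) p q) *
    C.integral fun z =>
      f z * g z * ((∏ r, ellGamma (t r * z) p q * ellGamma (t r / z) p q) /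
        (ellGamma (z ^ 2) p q * ellGamma (z⁻¹ ^ 2) p q)) * (2 * Real.pi * Complex.I * z)⁻¹

/-! ### The symmetry-broken limit -/

/-- The constant in front of the limiting integral; `T` is the set `{a, b, c}`. Products over two
indices are over unordered pairs of distinct indices. -/
def limitConst (q : ℂ) (t : Fin 6 → ℂ) (α : Fin 6 → ℝ) (T : Finset (Fin 6)) : ℂ :=
  qPoch q q *
    (∏ x : Fin 6 × Fin 6 with x.1 < x.2 ∧ x.1 ∈ T ∧ x.2 ∈ T ∧ α x.1 + α x.2 = -1,
      qPoch (t x.1 * t x.2) q) *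
    (∏ x : Fin 6 × Fin 6 with x.1 ∈ T ∧ x.2 ∉ T ∧ α x.1 + α x.2 = 0,
      qPoch (t x.1 * t x.2) q) /
  ((∏ x : Fin 6 × Fin 6 with x.1 < x.2 ∧ x.1 ∈ T ∧ x.2 ∈ T ∧ α x.1 + α x.2 = 0,
      qPoch (q / (t x.1 * t x.2)) q) *
    (∏ x : Fin 6 × Fin 6 with x.1 < x.2 ∧ α x.1 + α x.2 = 1,
      qPoch (q / (t x.1 * t x.2)) q))

/-- The weight of the limiting integral. -/
def limitWeight (q : ℂ) (t : Fin 6 → ℂ) (α : Fin 6 → ℝ) (T : Finset (Fin 6)) (ζ : ℝ) (z : ℂ) : ℂ :=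
  ((∏ r with r ∈ T ∧ α r = -ζ, qPoch (q / (t r * z)) q) *
      (∏ r with r ∉ T ∧ α r = 1 + ζ, qPoch (q * z / t r) q)) /
    ((∏ r with r ∈ T ∧ α r = ζ, qPoch (t r / z) q) *
      (∏ r with r ∉ T ∧ α r = -ζ, qPoch (t r * z) q)) *
  (if ζ = -1 / 2 then
      (qPoch (z ^ 2) q * ∏ r with r ∈ T ∧ α r = 1 / 2, qPoch (q * z / t r) q) /
        (qPoch (q * z ^ 2) q * ∏ r with r ∈ T ∧ α r = -1 / 2, qPoch (t r * z) q)
    else 1) *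
  theta (q * z / ∏ r ∈ T, t r) q

/-- The condition on the contour of the limiting integral, in terms of the parameters `t̃_r`: it goes
around `0` once, it contains the points `t̃_r q^k` when `(t_r / z; q)` is in the denominator of the
weight, and it excludes the points `q^{-k} / t̃_r` when `(t_r z; q)` is in the denominator. -/
def IsLimitContour (q : ℂ) (tt : Fin 6 → ℂ) (α : Fin 6 → ℝ) (T : Finset (Fin 6)) (ζ : ℝ)
    (C : ContourCycle) : Prop :=
  C.Contains 0 ∧
  (∀ r ∈ T, α r = ζ → ∀ k : ℕ, C.Contains (tt r * q ^ k)) ∧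
  (∀ r ∉ T, α r = -ζ → ∀ k : ℕ, C.Excludes (tt r * q ^ k)⁻¹) ∧
  (ζ = -1 / 2 → ∀ r ∈ T, α r = -1 / 2 → ∀ k : ℕ, C.Excludes (tt r * q ^ k)⁻¹)

/-- The limiting bilinear form applied to two rational functions of `z`. -/
def limitForm (q : ℂ) (t : Fin 6 → ℂ) (α : Fin 6 → ℝ) (T : Finset (Fin 6)) (ζ : ℝ)
    (C : ContourCycle) (F G : RatFunc ℂ) : ℂ :=
  limitConst q t α T * C.integral fun z =>
    F.eval (RingHom.id ℂ) z * G.eval (RingHom.id ℂ) z * limitWeight q t α T ζ z *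
      (2 * Real.pi * Complex.I * z)⁻¹

end EllipticLimit

end

noncomputable section

namespace EllipticLimit

/-! ### Integration over cycles -/

namespace ContourCycle

open MeasureTheory Set

/-! The substitution `z = p^ζ w` cannot be made directly in the elliptic integral. For `r ∈ T` the
exponent `α_r + ζ` of `p` in `Γ(T_r z)` can be negative, and the contour may have to contain large
points `T_r` while excluding their small reciprocals. The remedy is to break the symmetry `z ↦ 1/z`
before taking the limit.

The addition formula `theta_addition` expresses `θ(z²; q)`, times the product of `θ(T_r T_s; q)`
over the pairs in `T`, through two theta products that `z ↦ 1/z` exchanges up to a monomial.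
Together with the reflection formula for `1/Γ(z^{±2})`, it turns the integrand, times these theta
constants, into `W(z) + z⁻² W(1/z)` (`exists_broken_integrand`). In `W` each `Γ(T_r z)` with `r ∈ T`
has become `Γ(p T_r z)`. The reciprocals `(q^j T̃_r)⁻¹` with `r ∈ T` thereby drop out of the list of
possible poles, and Cauchy's theorem in its homology form replaces the integral by twice the
integral of `W` over any cycle that separates the remaining poles (`IsEllipticContour.integral_eq`).
The fixed limit contour scaled by `p^ζ` is such a cycle for all small `p`
(`IsLimitContour.eventually_scale`).

The inequalities on `α` and `ζ` say that at `z = p^ζ w` every gamma factor of `W` has the form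
`Γ(p^γ x)` with `0 ≤ γ ≤ 1`. There it converges, and a nontrivial factor survives only for `γ = 0`
or `γ = 1` (`tendsto_ellGamma_ppow`). The remaining theta function depends on `T_a T_b T_c / z`, in
which `p` cancels because `α_a + α_b + α_c = ζ`. The same theta constants move the exponents of the
normalizing factors `Γ(T_r T_s)` into `[0, 1]` (`pairExponent_mem_Icc`, `prod_ellGamma_mul_theta`).

The pointwise limit is available only off a countable set, which the limit contour may meet. As `W`
is holomorphic near the scaled contour, the maximum principle on small circles that avoid the bad
set supplies a bound, and dominated convergence applies (`ContourCycle.tendsto_integral`). -/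

lemma loop_mem_trace (C : ContourCycle) (i : Fin C.num) {x : ℝ} (hx : x ∈ Icc (0 : ℝ) 1) :
    C.loop i x ∈ C.trace :=
  mem_iUnion.2 ⟨i, x, hx, rfl⟩

lemma isCompact_trace (C : ContourCycle) : IsCompact C.trace :=
  isCompact_iUnion fun i => isCompact_Icc.image (C.contDiff i).continuous

lemma continuous_deriv_loop (C : ContourCycle) (i : Fin C.num) : Continuous (deriv (C.loop i)) :=
  (C.contDiff i).continuous_deriv le_rfl

lemma hasDerivAt_loop (C : ContourCycle) (i : Fin C.num) (x : ℝ) :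
    HasDerivAt (C.loop i) (deriv (C.loop i) x) x :=
  ((C.contDiff i).differentiable one_ne_zero x).hasDerivAt

lemma continuousOn_integrand {C : ContourCycle} {F : ℂ → ℂ} (hF : ContinuousOn F C.trace)
    (i : Fin C.num) :
    ContinuousOn (fun x => F (C.loop i x) * deriv (C.loop i) x) (Icc 0 1) :=
  (hF.comp (C.contDiff i).continuous.continuousOn fun _ hx => C.loop_mem_trace i hx).mul
    (C.continuous_deriv_loop i).continuousOn

lemma intervalIntegrable_integrand {C : ContourCycle} {F : ℂ → ℂ} (hF : ContinuousOn F C.trace)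
    (i : Fin C.num) :
    IntervalIntegrable (fun x => F (C.loop i x) * deriv (C.loop i) x) volume 0 1 :=
  (by simpa using continuousOn_integrand hF i : ContinuousOn _ (uIcc (0 : ℝ) 1)).intervalIntegrable

lemma integral_add {C : ContourCycle} {F G : ℂ → ℂ} (hF : ContinuousOn F C.trace)
    (hG : ContinuousOn G C.trace) :
    C.integral (fun z => F z + G z) = C.integral F + C.integral G := by
  simp only [integral, ← Finset.sum_add_distrib]
  refine Finset.sum_congr rfl fun i _ => ?_
  rw [← intervalIntegral.integral_add (intervalIntegrable_integrand hF i)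
    (intervalIntegrable_integrand hG i)]
  exact intervalIntegral.integral_congr fun x _ => by ring

lemma integral_const_mul (C : ContourCycle) (F : ℂ → ℂ) (c : ℂ) :
    C.integral (fun z => c * F z) = c * C.integral F := by
  simp only [integral, Finset.mul_sum, ← intervalIntegral.integral_const_mul]
  exact Finset.sum_congr rfl fun i _ => intervalIntegral.integral_congr fun x _ => by ring

lemma integral_congr {C : ContourCycle} {F G : ℂ → ℂ} (h : EqOn F G C.trace) :
    C.integral F = C.integral G :=
  Finset.sum_congr rfl fun i _ => intervalIntegral.integral_congr fun x hx => by
    simp only [h (C.loop_mem_trace i (by simpa using hx))]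

lemma integral_eq_zero_of_hasDerivAt {C : ContourCycle} {F Φ : ℂ → ℂ}
    (hF : ContinuousOn F C.trace) (h : ∀ z ∈ C.trace, HasDerivAt Φ (F z) z) :
    C.integral F = 0 := by
  refine Finset.sum_eq_zero fun i _ => ?_
  have := intervalIntegral.integral_eq_sub_of_hasDerivAt (a := 0) (b := 1)
    (f := fun x => Φ (C.loop i x)) (f' := fun x => F (C.loop i x) * deriv (C.loop i) x)
    (fun x hx => by
      have h1 := h _ (C.loop_mem_trace i (by simpa using hx))
      have h2 := C.hasDerivAt_loop i x
      exact HasDerivAt.comp x h1 h2)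
    (intervalIntegrable_integrand hF i)
  rw [this, C.closed i, sub_self]

/-- A differentiable curve spends no time, with nonzero velocity, in a countable set. -/
lemma ae_deriv_eq_zero_of_countable {γ γ' : ℝ → ℂ} (h : ∀ x, HasDerivAt γ (γ' x) x)
    {B : Set ℂ} (hB : B.Countable) : ∀ᵐ x : ℝ, γ x ∈ B → γ' x = 0 := by
  -- A nonzero velocity makes `x` an isolated point of the fibre over `w`, and isolated points of a
  -- subset of the line are countable in number.
  have key : ∀ w : ℂ, {x | γ x = w ∧ γ' x ≠ 0}.Countable := by
    intro w
    refine Set.Countable.mono ?_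
      (countable_setOfPred_isolated_right_within (s := {x | γ x = w}))
    rintro x ⟨hx, hx'⟩
    refine ⟨hx, ?_⟩
    have h1 := (h x).eventually_ne (c := w) hx'
    rw [← empty_mem_iff_bot]
    have h2 : {y | γ y ≠ w} ∈ 𝓝[{x | γ x = w} ∩ Ioi x] x :=
      nhdsWithin_mono x (fun y hy => ne_of_gt hy.2) h1
    filter_upwards [h2, self_mem_nhdsWithin] with y hy hy'
    exact hy hy'.1
  have : {x | ¬ (γ x ∈ B → γ' x = 0)} ⊆ ⋃ w ∈ B, {x | γ x = w ∧ γ' x ≠ 0} := by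
    intro x hx
    simp only [mem_ofPred_eq, Classical.not_imp] at hx
    exact mem_iUnion₂.2 ⟨γ x, hx.1, rfl, hx.2⟩
  exact measure_mono_null this ((hB.biUnion fun w _ => key w).measure_zero _)

/-- Changing the integrand on a countable set does not affect the integral over a cycle. -/
lemma integral_congr_of_countable {C : ContourCycle} {F G : ℂ → ℂ} {B : Set ℂ} (hB : B.Countable)
    (h : ∀ z ∈ C.trace, z ∉ B → F z = G z) : C.integral F = C.integral G := by
  refine Finset.sum_congr rfl fun i _ => intervalIntegral.integral_congr_ae ?_
  filter_upwards [ae_deriv_eq_zero_of_countable (C.hasDerivAt_loop i) hB] with x hx hxI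
  by_cases hxB : C.loop i x ∈ B
  · simp [hx hxB]
  · rw [h _ (C.loop_mem_trace i ?_) hxB]
    rw [uIoc_of_le zero_le_one] at hxI
    exact Ioc_subset_Icc_self hxI

/-- Integrals over cycles of functions that depend holomorphically on a parameter. -/
lemma hasDerivAt_integral_param {C : ContourCycle} {V : Set ℂ} (hV : IsOpen V) {G : ℂ → ℂ → ℂ}
    (hc : ∀ z ∈ V, ContinuousOn (fun w => G w z) C.trace)
    (hd : ∀ w ∈ C.trace, DifferentiableOn ℂ (G w) V)
    (hb : ∀ z₀ ∈ V, ∃ M, ∀ᶠ z in 𝓝 z₀, ∀ w ∈ C.trace, ‖G w z‖ ≤ M) {z₀ : ℂ} (hz₀ : z₀ ∈ V) :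
    HasDerivAt (fun z => C.integral fun w => G w z) (C.integral fun w => deriv (G w) z₀) z₀ := by
  obtain ⟨M, hM⟩ := hb z₀ hz₀
  obtain ⟨ρ, hρ, hball⟩ := Metric.eventually_nhds_iff_ball.1 (hM.and (hV.mem_nhds hz₀))
  have hsub : ∀ z ∈ Metric.ball z₀ (ρ / 2), Metric.closedBall z (ρ / 4) ⊆ Metric.ball z₀ ρ := by
    intro z hz y hy
    rw [Metric.mem_ball] at hz ⊢
    rw [Metric.mem_closedBall] at hy
    linarith [dist_triangle y z z₀]
  have hdb : ∀ w ∈ C.trace, ∀ z ∈ Metric.ball z₀ (ρ / 2), ‖deriv (G w) z‖ ≤ M / (ρ / 4) := by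
    intro w hw z hz
    refine Complex.norm_deriv_le_of_forall_mem_sphere_norm_le (by positivity) ?_ ?_
    · exact ((hd w hw).mono fun y hy => (hball y (hsub z hz hy)).2).diffContOnCl_ball subset_rfl
    · exact fun y hy => (hball y (hsub z hz (Metric.sphere_subset_closedBall hy))).1 w hw
  have hderiv : ∀ w ∈ C.trace, ∀ z ∈ Metric.ball z₀ (ρ / 2),
      HasDerivAt (G w) (deriv (G w) z) z := fun w hw z hz =>
    ((hd w hw).differentiableAt (hV.mem_nhds
      (hball z (hsub z hz (Metric.mem_closedBall_self (by positivity)))).2)).hasDerivAt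
  have hmem : ∀ i, ∀ᵐ x : ℝ, x ∈ uIoc (0 : ℝ) 1 → C.loop i x ∈ C.trace := fun i =>
    Eventually.of_forall fun x hx => by
      rw [uIoc_of_le zero_le_one] at hx
      exact C.loop_mem_trace i (Ioc_subset_Icc_self hx)
  simp only [integral]
  refine HasDerivAt.fun_sum fun i _ => ?_
  have hmeas : ∀ z ∈ V, AEStronglyMeasurable (fun x => G (C.loop i x) z * deriv (C.loop i) x)
      (volume.restrict (uIoc (0 : ℝ) 1)) := fun z hz =>
    (intervalIntegrable_iff.1 (intervalIntegrable_integrand (hc z hz) i)).aestronglyMeasurable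
  refine (intervalIntegral.hasDerivAt_integral_of_dominated_loc_of_deriv_le
    (F := fun z x => G (C.loop i x) z * deriv (C.loop i) x)
    (F' := fun z x => deriv (G (C.loop i x)) z * deriv (C.loop i) x)
    (bound := fun x => M / (ρ / 4) * ‖deriv (C.loop i) x‖)
    (Metric.ball_mem_nhds z₀ (half_pos hρ)) ?_ ?_ ?_ ?_ ?_ ?_).2
  · filter_upwards [hV.mem_nhds hz₀] with z hz using hmeas z hz
  · exact intervalIntegrable_integrand (hc z₀ hz₀) i
  -- Measurability of the derivative along the curve is not assumed. It is obtained by writing the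
  -- derivative as a limit of difference quotients along a sequence tending to `z₀` inside the ball.
  · have hlim : Tendsto (fun n : ℕ => z₀ + (ρ / 2 / (n + 2) : ℝ)) atTop (𝓝[≠] z₀) := by
      rw [tendsto_nhdsWithin_iff]
      constructor
      · have : Tendsto (fun n : ℕ => (ρ / 2 / (n + 2) : ℝ)) atTop (𝓝 0) :=
          tendsto_const_nhds.div_atTop
            (tendsto_atTop_add_const_right _ _ tendsto_natCast_atTop_atTop)
        simpa using tendsto_const_nhds.add ((Complex.continuous_ofReal.tendsto _).comp this)
      · refine Eventually.of_forall fun n => ?_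
        have : (ρ / 2 / (n + 2) : ℝ) ≠ 0 := by positivity
        rw [mem_compl_iff, mem_singleton_iff, add_eq_left]
        exact_mod_cast this
    refine aestronglyMeasurable_of_tendsto_ae (u := atTop)
      (f := fun (n : ℕ) x => slope (G (C.loop i x)) z₀ (z₀ + (ρ / 2 / (n + 2) : ℝ)) *
        deriv (C.loop i) x) ?_ ?_
    · intro n
      have hV' : z₀ + (ρ / 2 / (n + 2) : ℝ) ∈ V := by
        refine (hball _ ?_).2
        have h1 : (0 : ℝ) < ρ / 2 / (n + 2) := by positivity
        have h2 : ρ / 2 / ((n : ℝ) + 2) < ρ := by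
          rw [div_lt_iff₀ (by positivity)]
          nlinarith [(Nat.cast_nonneg n : (0 : ℝ) ≤ n)]
        rw [Metric.mem_ball, dist_eq_norm, add_sub_cancel_left, Complex.norm_real,
          Real.norm_of_nonneg h1.le]
        exact h2
      have := ((hmeas _ hV').sub (hmeas _ hz₀)).const_mul
        ((z₀ + (ρ / 2 / (n + 2) : ℝ) - z₀)⁻¹)
      refine this.congr (Eventually.of_forall fun x => ?_)
      simp only [slope, vsub_eq_sub, smul_eq_mul, Pi.sub_apply]
      ring
    · rw [ae_restrict_iff' measurableSet_uIoc]
      filter_upwards [hmem i] with x hx hx'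
      refine Tendsto.mul_const _ ?_
      exact (hasDerivAt_iff_tendsto_slope.1
        (hderiv _ (hx hx') z₀ (Metric.mem_ball_self (half_pos hρ)))).comp hlim
  · filter_upwards [hmem i] with x hx hx' z hz
    rw [norm_mul]
    exact mul_le_mul_of_nonneg_right (hdb _ (hx hx') z hz) (norm_nonneg _)
  · exact (continuous_const.mul (C.continuous_deriv_loop i).norm).intervalIntegrable _ _
  · filter_upwards [hmem i] with x hx hx' z hz
    exact (hderiv _ (hx hx') z hz).mul_const _

lemma exists_forall_le_dist {K : Set ℂ} (hK : IsCompact K) {z₀ : ℂ} (hz₀ : z₀ ∉ K) :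
    ∃ δ > 0, ∀ᶠ z in 𝓝 z₀, ∀ w ∈ K, δ ≤ ‖w - z‖ := by
  obtain ⟨ρ, hρ, h⟩ := Metric.isOpen_iff.1 hK.isClosed.isOpen_compl z₀ hz₀
  refine ⟨ρ / 2, half_pos hρ, ?_⟩
  filter_upwards [Metric.ball_mem_nhds z₀ (half_pos hρ)] with z hz w hw
  by_contra! hlt
  refine h (a := w) ?_ hw
  rw [Metric.mem_ball] at hz ⊢
  rw [← dist_eq_norm] at hlt
  linarith [dist_triangle w z z₀]

lemma exists_forall_norm_le {C : ContourCycle} {F : ℂ → ℂ} (hF : ContinuousOn F C.trace) :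
    ∃ M, ∀ w ∈ C.trace, ‖F w‖ ≤ M :=
  C.isCompact_trace.exists_bound_of_continuousOn hF

/-- The derivative of the Cauchy transform of a continuous function on a cycle. -/
lemma hasDerivAt_cauchyTransform {C : ContourCycle} {F : ℂ → ℂ} (hF : ContinuousOn F C.trace)
    {z₀ : ℂ} (hz₀ : z₀ ∉ C.trace) :
    HasDerivAt (fun z => C.integral fun w => F w * (w - z)⁻¹)
      (C.integral fun w => F w * ((w - z₀) ^ 2)⁻¹) z₀ := by
  have hne : ∀ w ∈ C.trace, ∀ z ∈ C.traceᶜ, w - z ≠ 0 := fun w hw z hz h =>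
    hz (sub_eq_zero.1 h ▸ hw)
  have hder : ∀ w ∈ C.trace, ∀ z ∈ C.traceᶜ,
      HasDerivAt (fun z => F w * (w - z)⁻¹) (F w * ((w - z) ^ 2)⁻¹) z := fun w hw z hz => by
    have := (((hasDerivAt_id z).const_sub w).fun_inv (hne w hw z hz)).const_mul (F w)
    simpa [div_eq_mul_inv] using this
  have := hasDerivAt_integral_param (C := C) (G := fun w z => F w * (w - z)⁻¹)
    C.isCompact_trace.isClosed.isOpen_compl
    (fun z hz => hF.mul ((continuousOn_id.sub continuousOn_const).inv₀ fun w hw => hne w hw z hz))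
    (fun w hw z hz => (hder w hw z hz).differentiableAt.differentiableWithinAt) ?_ hz₀
  · convert this using 1
    exact integral_congr fun w hw => ((hder w hw z₀ hz₀).deriv).symm
  · intro z hz
    obtain ⟨M, hM⟩ := exists_forall_norm_le hF
    obtain ⟨δ, hδ, h⟩ := exists_forall_le_dist C.isCompact_trace hz
    refine ⟨M * δ⁻¹, ?_⟩
    filter_upwards [h] with y hy w hw
    rw [norm_mul, norm_inv]
    exact mul_le_mul (hM w hw) (inv_anti₀ hδ (hy w hw)) (by positivity)
      ((norm_nonneg _).trans (hM w hw))

/-- Differentiation under the integral gives the integrand `(w - z₀)⁻²`, which has the single-valued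
primitive `-(w - z₀)⁻¹`, so its integral over closed curves vanishes. -/
lemma hasDerivAt_winding (C : ContourCycle) {z₀ : ℂ} (hz₀ : z₀ ∉ C.trace) :
    HasDerivAt C.winding 0 z₀ := by
  have h := (hasDerivAt_cauchyTransform (C := C) (F := fun _ => 1) continuousOn_const hz₀).const_mul
    (2 * Real.pi * Complex.I)⁻¹
  have hne : ∀ w ∈ C.trace, w - z₀ ≠ 0 := fun w hw h => hz₀ (sub_eq_zero.1 h ▸ hw)
  have h0 : (C.integral fun w => 1 * ((w - z₀) ^ 2)⁻¹) = 0 := by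
    refine integral_eq_zero_of_hasDerivAt (Φ := fun w => -(w - z₀)⁻¹) ?_ fun w hw => ?_
    · exact continuousOn_const.mul (((continuousOn_id.sub continuousOn_const).pow 2).inv₀
        fun w hw => pow_ne_zero 2 (hne w hw))
    · have := (((hasDerivAt_id w).sub_const z₀).fun_inv (hne w hw)).fun_neg
      simpa [neg_div, div_eq_mul_inv] using this
  rw [h0, mul_zero] at h
  refine h.congr_of_eventuallyEq (Eventually.of_forall fun z => ?_)
  simp [winding]

/-- The winding number is locally constant off the trace. -/
lemma eventually_winding_eq (C : ContourCycle) {z₀ : ℂ} (hz₀ : z₀ ∉ C.trace) :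
    ∀ᶠ z in 𝓝 z₀, z ∉ C.trace ∧ C.winding z = C.winding z₀ := by
  obtain ⟨ρ, hρ, h⟩ := Metric.isOpen_iff.1 C.isCompact_trace.isClosed.isOpen_compl z₀ hz₀
  filter_upwards [Metric.ball_mem_nhds z₀ hρ] with z hz
  refine ⟨h hz, ?_⟩
  refine Metric.isOpen_ball.is_const_of_deriv_eq_zero (s := Metric.ball z₀ ρ)
    (convex_ball _ _).isPreconnected
    (fun y hy => (C.hasDerivAt_winding (h hy)).differentiableAt.differentiableWithinAt)
    (fun y hy => (C.hasDerivAt_winding (h hy)).deriv) hz (Metric.mem_ball_self hρ)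

lemma exists_trace_subset_ball (C : ContourCycle) : ∃ R > 0, C.trace ⊆ Metric.ball 0 R :=
  (C.isCompact_trace.isBounded.subset_ball_lt 0 0).imp fun _ h => h

/-- A cycle does not wind around distant points. -/
lemma winding_eq_zero_of_subset_ball {C : ContourCycle} {R : ℝ} (h : C.trace ⊆ Metric.ball 0 R)
    {z : ℂ} (hz : R ≤ ‖z‖) : z ∉ C.trace ∧ C.winding z = 0 := by
  have hzt : z ∉ C.trace := fun hz' => by
    have := h hz'
    rw [mem_ball_zero_iff] at this
    linarith
  refine ⟨hzt, ?_⟩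
  -- For `‖w‖ < ‖z‖` the number `1 - w / z` stays in the slit plane, so the principal logarithm
  -- provides a primitive of `(w - z)⁻¹`.
  rw [winding, integral_eq_zero_of_hasDerivAt (Φ := fun w => Complex.log (1 - w / z)), mul_zero]
  · exact ((continuousOn_id.sub continuousOn_const).inv₀ fun w hw h =>
      hzt ((sub_eq_zero.1 h : w = z) ▸ hw))
  · intro w hw
    have hw' := h hw
    rw [mem_ball_zero_iff] at hw'
    have hz0 : z ≠ 0 := norm_pos_iff.1 ((norm_nonneg w).trans_lt (hw'.trans_le hz))
    have hwz : w - z ≠ 0 := fun h => hzt (sub_eq_zero.1 h ▸ hw)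
    have hslit : 1 - w / z ∈ Complex.slitPlane := by
      refine Complex.mem_slitPlane_of_norm_lt_one (z := -(w / z)) ?_
      rw [norm_neg, norm_div, div_lt_one (norm_pos_iff.2 hz0)]
      exact hw'.trans_le hz
    have : HasDerivAt (fun w => Complex.log (1 - w / z)) (-(1 / z) / (1 - w / z)) w :=
      (((hasDerivAt_id w).div_const z).const_sub 1).clog hslit
    refine this.congr_deriv ?_
    have h3 : z - w ≠ 0 := fun h => hwz (by linear_combination -h)
    rw [show 1 - w / z = (z - w) / z by field_simp]
    field_simp
    ring

/-- The difference quotients of a holomorphic function, with one point on a compact set, are locally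
bounded in the other point. -/
lemma eventually_norm_dslope_le {F : ℂ → ℂ} {U K : Set ℂ} (hU : IsOpen U)
    (hF : DifferentiableOn ℂ F U) (hK : IsCompact K) (hKU : K ⊆ U) {z₀ : ℂ} (hz₀ : z₀ ∈ U) :
    ∃ M, ∀ᶠ z in 𝓝 z₀, ∀ w ∈ K, ‖dslope F w z‖ ≤ M := by
  obtain ⟨ρ, hρ, hball⟩ := Metric.nhds_basis_closedBall.mem_iff.1 (hU.mem_nhds hz₀)
  have hdF : ContinuousOn (deriv F) U := (hF.deriv hU).continuousOn
  obtain ⟨L, hL⟩ := (isCompact_closedBall z₀ ρ).exists_bound_of_continuousOn (hdF.mono hball)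
  obtain ⟨M₁, hM₁⟩ := hK.exists_bound_of_continuousOn (hF.continuousOn.mono hKU)
  obtain ⟨M₂, hM₂⟩ := (isCompact_closedBall z₀ ρ).exists_bound_of_continuousOn
    (hF.continuousOn.mono hball)
  refine ⟨max L ((M₁ + M₂) / (ρ / 2)), ?_⟩
  filter_upwards [Metric.ball_mem_nhds z₀ (half_pos hρ)] with z hz w hw
  have hz' : z ∈ Metric.closedBall z₀ ρ := by
    rw [Metric.mem_ball] at hz; rw [Metric.mem_closedBall]; linarith
  rcases eq_or_ne z w with rfl | hne
  · rw [dslope_same]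
    exact (hL _ hz').trans (le_max_left _ _)
  have hpos : 0 < ‖z - w‖ := norm_pos_iff.2 (sub_ne_zero.2 hne)
  rw [dslope_of_ne _ hne, slope, vsub_eq_sub, norm_smul, norm_inv, inv_mul_le_iff₀ hpos]
  -- Inside the ball the mean value inequality bounds the quotient; outside it the denominator is at
  -- least `ρ / 2`.
  by_cases hwb : w ∈ Metric.closedBall z₀ ρ
  · refine ((convex_closedBall z₀ ρ).norm_image_sub_le_of_norm_deriv_le
      (fun y hy => hF.differentiableAt (hU.mem_nhds (hball hy))) hL hwb hz').trans ?_
    rw [mul_comm]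
    exact mul_le_mul_of_nonneg_left (le_max_left _ _) hpos.le
  · have h1 : ρ / 2 ≤ ‖z - w‖ := by
      rw [Metric.mem_closedBall, not_le] at hwb
      rw [Metric.mem_ball] at hz
      rw [← dist_eq_norm, dist_comm]
      linarith [dist_triangle w z z₀]
    have h2 : ‖F z - F w‖ ≤ M₁ + M₂ := (norm_sub_le _ _).trans (by
      linarith [hM₁ w hw, hM₂ z hz'])
    have h3 : M₁ + M₂ ≤ (M₁ + M₂) / (ρ / 2) * ‖z - w‖ := by
      rw [div_mul_eq_mul_div, le_div_iff₀ (by positivity)]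
      exact mul_le_mul_of_nonneg_left h1 ((norm_nonneg _).trans h2)
    refine h2.trans (h3.trans ?_)
    rw [mul_comm]
    exact mul_le_mul_of_nonneg_left (le_max_right _ _) hpos.le

lemma dslope_comm (F : ℂ → ℂ) (z w : ℂ) : dslope F z w = dslope F w z := by
  rcases eq_or_ne z w with rfl | h
  · rfl
  · rw [dslope_of_ne _ h.symm, dslope_of_ne _ h, slope_comm]

/-- The homology version of **Cauchy's theorem** (after Dixon): the Cauchy transform. -/
theorem integral_mul_sub_inv_eq_zero {C : ContourCycle} {F : ℂ → ℂ} {U : Set ℂ} (hU : IsOpen U)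
    (hF : DifferentiableOn ℂ F U) (hC : C.trace ⊆ U) (hw : ∀ w ∉ U, C.winding w = 0)
    {z₀ : ℂ} (hz₀ : z₀ ∉ U) : C.integral (fun w => F w * (w - z₀)⁻¹) = 0 := by
  classical
  have hFc : ContinuousOn F C.trace := hF.continuousOn.mono hC
  set h₁ : ℂ → ℂ := fun z => C.integral fun w => dslope F w z with hh₁
  set h₂ : ℂ → ℂ := fun z => C.integral fun w => F w * (w - z)⁻¹ with hh₂
  -- Dixon's function: it is entire and tends to `0` at infinity, hence it vanishes identically by
  -- Liouville's theorem.
  set H : ℂ → ℂ := fun z => if z ∈ U then h₁ z else h₂ z with hH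
  have hds : ∀ z ∈ U, DifferentiableOn ℂ (dslope F z) U := fun z hz =>
    (Complex.differentiableOn_dslope (hU.mem_nhds hz)).2 hF
  -- On `U` the two formulas differ by `F z` times the integral of `(w - z)⁻¹`, that is, by a
  -- multiple of the winding number.
  have hHeq : ∀ z, z ∉ C.trace → C.winding z = 0 → H z = h₂ z := by
    intro z hz hz'
    by_cases hzU : z ∈ U
    · simp only [hH, if_pos hzU, hh₁, hh₂]
      have h0 : C.integral (fun w => (w - z)⁻¹) = 0 := by
        simpa [winding, Real.pi_ne_zero] using hz'
      have hinv : ContinuousOn (fun w => (w - z)⁻¹) C.trace :=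
        (continuousOn_id.sub continuousOn_const).inv₀ fun w hw h =>
          hz ((sub_eq_zero.1 h : w = z) ▸ hw)
      have : C.integral (fun w => dslope F w z) =
          C.integral fun w => F w * (w - z)⁻¹ + (-F z) * (w - z)⁻¹ := by
        refine integral_congr fun w hw => ?_
        have hne : w ≠ z := fun h => hz (h ▸ hw)
        rw [dslope_comm, dslope_of_ne _ hne, slope, vsub_eq_sub, smul_eq_mul]
        ring
      have h4 : ContinuousOn (fun w => -F z * (w - z)⁻¹) C.trace := continuousOn_const.mul hinv
      rw [this, integral_add (F := fun w => F w * (w - z)⁻¹) (hFc.mul hinv) h4,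
        integral_const_mul, h0, mul_zero, add_zero]
    · simp only [hH, if_neg hzU, hh₂]
  have hd₂ : ∀ z, z ∉ C.trace → DifferentiableAt ℂ h₂ z := fun z hz =>
    (hasDerivAt_cauchyTransform hFc hz).differentiableAt
  have hdH : Differentiable ℂ H := by
    intro z
    by_cases hz : z ∈ U
    · have : DifferentiableAt ℂ h₁ z := by
        refine (hasDerivAt_integral_param (C := C) hU ?_ ?_ ?_ hz).differentiableAt
        · intro y hy
          simp_rw [fun w => dslope_comm F w y]
          exact (hds y hy).continuousOn.mono hC
        · exact fun w hw => hds w (hC hw)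
        · exact fun y hy => eventually_norm_dslope_le hU hF C.isCompact_trace hC hy
      refine this.congr_of_eventuallyEq ?_
      filter_upwards [hU.mem_nhds hz] with y hy
      simp only [hH]
      exact if_pos hy
    · have hzt : z ∉ C.trace := fun h => hz (hC h)
      refine (hd₂ z hzt).congr_of_eventuallyEq ?_
      filter_upwards [C.eventually_winding_eq hzt] with y hy
      exact hHeq y hy.1 (hy.2.trans (hw z hz))
  have hlim : Tendsto H (cocompact ℂ) (𝓝 0) := by
    obtain ⟨R, hR, hsub⟩ := C.exists_trace_subset_ball
    obtain ⟨M, hM⟩ := exists_forall_norm_le hFc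
    have hbd : ∃ N : ℝ, ∀ z, 2 * R ≤ ‖z‖ → ‖h₂ z‖ ≤ N * ‖z‖⁻¹ := by
      choose D hD using fun i => (isCompact_Icc (a := (0 : ℝ)) (b := 1)).exists_bound_of_continuousOn
        (C.continuous_deriv_loop i).continuousOn
      refine ⟨∑ i, M * 2 * D i, fun z hz => ?_⟩
      have hz0 : 0 < ‖z‖ := by linarith
      rw [Finset.sum_mul]
      refine (norm_sum_le _ _).trans (Finset.sum_le_sum fun i _ => ?_)
      have := intervalIntegral.norm_integral_le_of_norm_le_const (a := (0 : ℝ)) (b := 1)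
        (f := fun x => F (C.loop i x) * (C.loop i x - z)⁻¹ * deriv (C.loop i) x)
        (C := M * 2 * D i * ‖z‖⁻¹) fun x hx => ?_
      · simpa using this
      · rw [uIoc_of_le zero_le_one] at hx
        have hx' := Ioc_subset_Icc_self hx
        have hm := C.loop_mem_trace i hx'
        have h1 := hM _ hm
        have h2 : ‖(C.loop i x - z)⁻¹‖ ≤ 2 * ‖z‖⁻¹ := by
          rw [norm_inv, inv_le_comm₀ (by
            have := hsub hm; rw [mem_ball_zero_iff] at this
            refine norm_pos_iff.2 (sub_ne_zero.2 fun h => ?_)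
            rw [h] at this; linarith) (by positivity), mul_inv, inv_inv]
          have h3 := hsub hm
          rw [mem_ball_zero_iff] at h3
          have := norm_sub_norm_le z (C.loop i x)
          rw [norm_sub_rev] at this
          linarith
        rw [norm_mul, norm_mul]
        calc _ ≤ M * (2 * ‖z‖⁻¹) * D i := by
              have hM0 := (norm_nonneg _).trans h1
              exact mul_le_mul (mul_le_mul h1 h2 (norm_nonneg _) hM0) (hD i x hx')
                (norm_nonneg _) (by positivity)
          _ = _ := by ring
    obtain ⟨N, hN⟩ := hbd
    have h0 : Tendsto (fun z : ℂ => N * ‖z‖⁻¹) (cocompact ℂ) (𝓝 0) := by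
      simpa using (tendsto_inv_atTop_zero.comp (tendsto_norm_cocompact_atTop (E := ℂ))).const_mul N
    refine squeeze_zero_norm' ?_ h0
    filter_upwards [tendsto_norm_cocompact_atTop.eventually_ge_atTop (2 * R)] with z hz
    obtain ⟨h1, h2⟩ := winding_eq_zero_of_subset_ball hsub (z := z) (by linarith)
    rw [hHeq z h1 h2]
    exact hN z hz
  have := hdH.apply_eq_of_tendsto_cocompact z₀ hlim
  rwa [hHeq z₀ (fun h => hz₀ (hC h)) (hw z₀ hz₀)] at this

/-- The homology version of **Cauchy's theorem**. -/
theorem integral_eq_zero_of_winding {C : ContourCycle} {F : ℂ → ℂ} {U : Set ℂ} (hU : IsOpen U)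
    (hF : DifferentiableOn ℂ F U) (hC : C.trace ⊆ U) (hw : ∀ w ∉ U, C.winding w = 0)
    (h0 : (0 : ℂ) ∉ U) : C.integral F = 0 := by
  -- As `0` lies outside `U`, it can serve as the base point, and the Cauchy kernel `1 / z` cancels
  -- the extra factor `z`.
  have := integral_mul_sub_inv_eq_zero (F := fun z => F z * z) hU (hF.mul differentiableOn_id) hC hw
    h0
  rw [← this]
  refine integral_congr fun w hw' => ?_
  have : w ≠ 0 := fun h => h0 (h ▸ hC hw')
  simp [this]

/-! ### Operations on cycles -/

/-- The formal sum of two cycles. -/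
def add (C D : ContourCycle) : ContourCycle where
  num := C.num + D.num
  loop := Fin.addCases C.loop D.loop
  contDiff i := by
    refine Fin.addCases (fun i => ?_) (fun i => ?_) i
    · simpa using C.contDiff i
    · simpa using D.contDiff i
  closed i := by
    refine Fin.addCases (fun i => ?_) (fun i => ?_) i
    · simpa using C.closed i
    · simpa using D.closed i

lemma add_integral (C D : ContourCycle) (F : ℂ → ℂ) :
    (C.add D).integral F = C.integral F + D.integral F := by
  change (∑ i : Fin (C.num + D.num), _) = _
  simp [Fin.sum_univ_add, integral, add]

lemma add_trace (C D : ContourCycle) : (C.add D).trace = C.trace ∪ D.trace := by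
  ext z
  simp only [trace, mem_iUnion, mem_union]
  constructor
  · rintro ⟨i, hi⟩
    revert hi
    refine Fin.addCases (motive := fun i => z ∈ (C.add D).loop i '' Icc 0 1 → _)
      (fun i hi => ?_) (fun i hi => ?_) i
    · exact Or.inl ⟨i, by simpa [add] using hi⟩
    · exact Or.inr ⟨i, by simpa [add] using hi⟩
  · rintro (⟨i, hi⟩ | ⟨i, hi⟩)
    · exact ⟨Fin.castAdd _ i, by simpa [add] using hi⟩
    · exact ⟨Fin.natAdd _ i, by simpa [add] using hi⟩

lemma add_winding (C D : ContourCycle) (w : ℂ) :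
    (C.add D).winding w = C.winding w + D.winding w := by
  simp [winding, add_integral, mul_add]

/-- The cycle with all curves reversed. -/
def neg (C : ContourCycle) : ContourCycle where
  num := C.num
  loop i x := C.loop i (1 - x)
  contDiff i := (C.contDiff i).comp (contDiff_const.sub contDiff_id)
  closed i := by simp [C.closed i]

lemma neg_integral (C : ContourCycle) (F : ℂ → ℂ) : C.neg.integral F = -C.integral F := by
  simp only [integral, ← Finset.sum_neg_distrib]
  refine Finset.sum_congr rfl fun i _ => ?_
  have hd : ∀ x, deriv (C.neg.loop i) x = -deriv (C.loop i) (1 - x) := fun x =>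
    deriv_comp_const_sub (C.loop i) 1 x
  simp only [hd]
  have := intervalIntegral.integral_comp_sub_left (a := 0) (b := 1)
    (fun x => F (C.loop i x) * deriv (C.loop i) x) 1
  simp only [sub_self, sub_zero] at this
  rw [← this, ← intervalIntegral.integral_neg]
  exact intervalIntegral.integral_congr fun x _ => by simp [neg]

lemma neg_trace (C : ContourCycle) : C.neg.trace = C.trace := by
  simp only [trace]
  refine iUnion_congr fun i => ?_
  ext z
  simp only [mem_image, neg]
  constructor
  · rintro ⟨x, hx, rfl⟩
    exact ⟨1 - x, ⟨by linarith [hx.2], by linarith [hx.1]⟩, rfl⟩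
  · rintro ⟨x, hx, rfl⟩
    exact ⟨1 - x, ⟨by linarith [hx.2], by linarith [hx.1]⟩, by simp⟩

lemma neg_winding (C : ContourCycle) (w : ℂ) : C.neg.winding w = -C.winding w := by
  simp [winding, neg_integral]

/-- Two cycles with the same winding numbers off `U` give the same integrals. -/
theorem integral_eq_of_winding_eq {C D : ContourCycle} {F : ℂ → ℂ} {U : Set ℂ} (hU : IsOpen U)
    (hF : DifferentiableOn ℂ F U) (hC : C.trace ⊆ U) (hD : D.trace ⊆ U)
    (hw : ∀ w ∉ U, C.winding w = D.winding w) (h0 : (0 : ℂ) ∉ U) : C.integral F = D.integral F := by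
  have := integral_eq_zero_of_winding (C := C.add D.neg) hU hF
    (by rw [add_trace, neg_trace]; exact union_subset hC hD)
    (fun w hw' => by rw [add_winding, neg_winding, hw w hw', add_neg_cancel]) h0
  rw [add_integral, neg_integral] at this
  exact add_neg_eq_zero.1 this

/-- The image of a cycle under `z ↦ c z`. -/
def scale (C : ContourCycle) (c : ℂ) : ContourCycle where
  num := C.num
  loop i x := c * C.loop i x
  contDiff i := contDiff_const.mul (C.contDiff i)
  closed i := by simp [C.closed i]

lemma scale_integral (C : ContourCycle) (c : ℂ) (F : ℂ → ℂ) :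
    (C.scale c).integral F = C.integral fun z => c * F (c * z) := by
  refine Finset.sum_congr rfl fun i _ => intervalIntegral.integral_congr fun x _ => ?_
  have : deriv ((C.scale c).loop i) x = c * deriv (C.loop i) x :=
    ((C.hasDerivAt_loop i x).const_mul c).deriv
  simp only [this]
  simp only [scale]
  ring

lemma scale_trace (C : ContourCycle) (c : ℂ) : (C.scale c).trace = (fun z => c * z) '' C.trace := by
  simp only [trace, image_iUnion, image_image]
  rfl

lemma scale_winding (C : ContourCycle) {c : ℂ} (hc : c ≠ 0) (w : ℂ) :
    (C.scale c).winding (c * w) = C.winding w := by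
  simp only [winding, scale_integral]
  congr 2
  ext z
  rw [← mul_sub, mul_inv]
  field_simp

/-- Up to a reparametrization, the image of a cycle under `z ↦ 1 / z`, with reversed curves. -/
def inv (C : ContourCycle) (h0 : (0 : ℂ) ∉ C.trace) : ContourCycle where
  num := C.num
  -- A loop is known to avoid `0` only for parameters in `[0, 1]`, while `C¹` regularity is demanded
  -- on the whole line. The function `sin²` maps the line into `[0, 1]`, and here it runs from `1`
  -- to `0`. The reversal preserves the winding number about `0`.
  loop i x := (C.loop i (Real.sin (Real.pi / 2 * (1 - x)) ^ 2))⁻¹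
  contDiff i := by
    refine ContDiff.inv ?_ ?_
    · exact (C.contDiff i).comp ((Real.contDiff_sin.comp
        (contDiff_const.mul (contDiff_const.sub contDiff_id))).pow 2)
    · intro x h
      refine h0 (h ▸ C.loop_mem_trace i ⟨sq_nonneg _, ?_⟩)
      exact Real.sin_sq_le_one _
  closed i := by simp [C.closed i]

lemma inv_trace_subset {C : ContourCycle} (h0 : (0 : ℂ) ∉ C.trace) {z : ℂ}
    (hz : z ∈ (C.inv h0).trace) : z⁻¹ ∈ C.trace := by
  obtain ⟨i, x, hx, rfl⟩ := mem_iUnion.1 hz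
  simp only [inv, inv_inv]
  exact C.loop_mem_trace i ⟨sq_nonneg _, Real.sin_sq_le_one _⟩

lemma intervalIntegral_reparam {φ φ' : ℝ → ℝ} {G : ℝ → ℂ} (hder : ∀ x, HasDerivAt φ (φ' x) x)
    (hφ' : Continuous φ') (hmem : ∀ x, φ x ∈ Icc (0 : ℝ) 1) (h0 : φ 0 = 1) (h1 : φ 1 = 0)
    (hG : ContinuousOn G (Icc 0 1)) :
    ∫ x in (0 : ℝ)..1, -(φ' x • G (φ x)) = ∫ x in (0 : ℝ)..1, G x := by
  have hsub := intervalIntegral.integral_deriv_smul_comp'' (a := 0) (b := 1) (f := φ) (f' := φ')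
    (g := G) (fun x _ => (hder x).continuousAt.continuousWithinAt)
    (fun x _ => (hder x).hasDerivWithinAt) hφ'.continuousOn
    (hG.mono (by rintro _ ⟨x, _, rfl⟩; exact hmem x))
  rw [h0, h1] at hsub
  rw [intervalIntegral.integral_neg]
  exact (congrArg Neg.neg hsub).trans (intervalIntegral.integral_symm 1 0).symm

lemma inv_integral {C : ContourCycle} (h0 : (0 : ℂ) ∉ C.trace) {F : ℂ → ℂ}
    (hF : ContinuousOn (fun z => F z⁻¹) C.trace) :
    (C.inv h0).integral F = C.integral fun z => (z ^ 2)⁻¹ * F z⁻¹ := by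
  have hc : ContinuousOn (fun z => (z ^ 2)⁻¹ * F z⁻¹) C.trace :=
    ((continuousOn_id.pow 2).inv₀ fun z hz => pow_ne_zero 2 fun h => h0 (h ▸ hz)).mul hF
  have hmem : ∀ x, Real.sin (Real.pi / 2 * (1 - x)) ^ 2 ∈ Icc (0 : ℝ) 1 :=
    fun x => ⟨sq_nonneg _, Real.sin_sq_le_one _⟩
  have hder : ∀ x, HasDerivAt (fun x => Real.sin (Real.pi / 2 * (1 - x)) ^ 2)
      (-(2 * Real.sin (Real.pi / 2 * (1 - x)) *
        (Real.cos (Real.pi / 2 * (1 - x)) * (Real.pi / 2)))) x := fun x => by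
    have : HasDerivAt (fun x => Real.sin (Real.pi / 2 * (1 - x)) ^ 2) _ x :=
      (((hasDerivAt_id x).const_sub 1).const_mul (Real.pi / 2)).sin.pow 2
    refine this.congr_deriv ?_
    simp only [id_eq]
    ring
  refine Finset.sum_congr rfl fun i _ => ?_
  rw [← intervalIntegral_reparam hder (by fun_prop) hmem (by simp) (by simp)
    (continuousOn_integrand hc i)]
  refine intervalIntegral.integral_congr fun x _ => ?_
  have hne : C.loop i (Real.sin (Real.pi / 2 * (1 - x)) ^ 2) ≠ 0 := fun h =>
    h0 (h ▸ C.loop_mem_trace i (hmem x))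
  have hd : deriv ((C.inv h0).loop i) x = _ :=
    (((C.hasDerivAt_loop i _).scomp x (hder x)).fun_inv hne).deriv
  simp only [hd, Function.comp, Complex.real_smul]
  simp only [inv]
  ring

/-- Partial fractions: `z⁻² (z⁻¹ - w)⁻¹ = z⁻¹ - (z - w⁻¹)⁻¹`. -/
lemma inv_winding {C : ContourCycle} (h0 : (0 : ℂ) ∉ C.trace) {w : ℂ} (hw : w ≠ 0)
    (hw' : w⁻¹ ∉ C.trace) : (C.inv h0).winding w = C.winding 0 - C.winding w⁻¹ := by
  have hne : ∀ z ∈ C.trace, z ≠ 0 := fun z hz h => h0 (h ▸ hz)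
  have hne' : ∀ z ∈ C.trace, z - w⁻¹ ≠ 0 := fun z hz h => hw' (sub_eq_zero.1 h ▸ hz)
  have hne'' : ∀ z ∈ C.trace, z⁻¹ - w ≠ 0 := fun z hz h =>
    hw' (by rw [← sub_eq_zero.1 h, inv_inv]; exact hz)
  have hinv : ContinuousOn (fun z : ℂ => z⁻¹) C.trace := continuousOn_id.inv₀ hne
  have h1 : ContinuousOn (fun z => (z - 0)⁻¹) C.trace := by simpa using hinv
  have h2 : ContinuousOn (fun z => -1 * (z - w⁻¹)⁻¹) C.trace :=
    continuousOn_const.mul ((continuousOn_id.sub continuousOn_const).inv₀ hne')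
  simp only [winding]
  rw [inv_integral h0 ((hinv.sub continuousOn_const).inv₀ hne''), ← mul_sub]
  congr 1
  rw [sub_eq_add_neg, ← neg_one_mul, ← integral_const_mul, ← integral_add h1 h2]
  refine integral_congr fun z hz => ?_
  have a := hne z hz
  have b := hne' z hz
  have c := hne'' z hz
  rw [show z - w⁻¹ = (z * w - 1) / w by field_simp] at b ⊢
  rw [show z⁻¹ - w = (1 - z * w) / z by field_simp] at c ⊢
  have b' : z * w - 1 ≠ 0 := fun h => b (by rw [h, zero_div])
  have c' : 1 - z * w ≠ 0 := fun h => b' (by linear_combination -h)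
  rw [sub_zero]
  field_simp
  ring

lemma inv_winding_zero {C : ContourCycle} (h0 : (0 : ℂ) ∉ C.trace) :
    (C.inv h0).winding 0 = C.winding 0 := by
  have hne : ∀ z ∈ C.trace, z ≠ 0 := fun z hz h => h0 (h ▸ hz)
  simp only [winding]
  rw [inv_integral h0]
  · congr 1
    refine integral_congr fun z hz => ?_
    have := hne z hz
    simp only [sub_zero, inv_inv]
    field_simp
  · simpa using! continuousOn_id

/-- The circle with center `c` and radius `r`. -/
def circle (c : ℂ) (r : ℝ) : ContourCycle where
  num := 1
  loop _ x := circleMap c r (2 * Real.pi * x)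
  contDiff _ := (contDiff_circleMap c r).comp (contDiff_const.mul contDiff_id)
  closed _ := by simpa using (periodic_circleMap c r 0).symm

lemma circle_integral (c : ℂ) (r : ℝ) (F : ℂ → ℂ) :
    (circle c r).integral F = ∮ z in C(c, r), F z := by
  have hd : ∀ x, deriv (fun x => circleMap c r (2 * Real.pi * x)) x =
      (2 * Real.pi : ℝ) * deriv (circleMap c r) (2 * Real.pi * x) := fun x => by
    have : HasDerivAt (fun x => circleMap c r (2 * Real.pi * x)) _ x :=
      (differentiable_circleMap c r (2 * Real.pi * x)).hasDerivAt.scomp x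
        ((hasDerivAt_id x).const_mul (2 * Real.pi))
    rw [this.deriv]
    simp
  have := intervalIntegral.smul_integral_comp_mul_left (a := 0) (b := 1)
    (fun θ => deriv (circleMap c r) θ • F (circleMap c r θ)) (2 * Real.pi)
  simp only [mul_zero, mul_one] at this
  change (∑ i : Fin 1, ∫ x in (0 : ℝ)..1, F (circleMap c r (2 * Real.pi * x)) *
    deriv (fun x => circleMap c r (2 * Real.pi * x)) x) = _
  rw [Fin.sum_univ_one, circleIntegral, ← this, ← intervalIntegral.integral_smul]
  refine intervalIntegral.integral_congr fun x _ => ?_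
  simp only [hd, smul_eq_mul, Complex.real_smul]
  ring

lemma circle_trace (c : ℂ) {r : ℝ} (hr : 0 ≤ r) : (circle c r).trace ⊆ Metric.sphere c r := by
  intro z hz
  obtain ⟨i, x, _, rfl⟩ := mem_iUnion.1 hz
  exact circleMap_mem_sphere c hr _

lemma circle_winding_of_lt {c w : ℂ} {r : ℝ} (hw : dist w c < r) : (circle c r).winding w = 1 := by
  rw [winding, circle_integral, circleIntegral.integral_sub_inv_of_mem_ball hw]
  exact inv_mul_cancel₀ Complex.two_pi_I_ne_zero

lemma circle_winding_of_gt {c w : ℂ} {r : ℝ} (hr : 0 ≤ r) (hw : r < dist w c) :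
    (circle c r).winding w = 0 := by
  have hne : ∀ z ∈ Metric.closedBall c r, z - w ≠ 0 := fun z hz h => by
    rw [sub_eq_zero.1 h, Metric.mem_closedBall] at hz
    linarith
  rw [winding, circle_integral, Complex.circleIntegral_eq_zero_of_differentiable_on_off_countable hr
    countable_empty, mul_zero]
  · exact (continuousOn_id.sub continuousOn_const).inv₀ hne
  · exact fun z hz => (differentiableAt_id.sub_const w).inv
      (hne z (Metric.ball_subset_closedBall hz.1))

/-! ### Existence of cycles -/

/-- Only finitely many points of the two sets lie at a norm comparable to that of `e`, so `e ≠ 0` is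
not an accumulation point, and a small circle around it affects no other point. -/
lemma exists_pos_forall_notMem_closedBall {Zin Zout : Set ℂ}
    (hin : ∀ ε > 0, {z ∈ Zin | ε ≤ ‖z‖}.Finite) (hout : ∀ M : ℝ, {z ∈ Zout | ‖z‖ ≤ M}.Finite)
    {e : ℂ} (he : e ≠ 0) :
    ∃ r > 0, ∀ z ∈ Zin ∪ Zout, z ≠ e → r < dist z e := by
  have he' : 0 < ‖e‖ := norm_pos_iff.2 he
  have hfin := (((hin (‖e‖ / 2) (half_pos he')).union (hout (2 * ‖e‖))).subset
    (sdiff_subset (t := {e})))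
  obtain ⟨ρ, hρ, h⟩ := Metric.isOpen_iff.1 hfin.isClosed.isOpen_compl e (fun h => h.2 rfl)
  refine ⟨min ρ (‖e‖ / 2) / 2, by positivity, fun z hz hze => ?_⟩
  by_contra! hle
  have hm : 0 < min ρ (‖e‖ / 2) := by positivity
  have h1 : dist z e < ρ := by linarith [min_le_left ρ (‖e‖ / 2)]
  have h2 : dist z e < ‖e‖ / 2 := by linarith [min_le_right ρ (‖e‖ / 2)]
  rw [dist_eq_norm] at h2
  refine h h1 ⟨?_, hze⟩
  rcases hz with hz | hz
  · refine Or.inl ⟨hz, ?_⟩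
    have := norm_sub_norm_le e z
    rw [norm_sub_rev] at this
    linarith
  · refine Or.inr ⟨hz, ?_⟩
    linarith [norm_sub_norm_le z e]

/-- There is a cycle that separates two disjoint sets, if the first one contains `0` and accumulates
only there, and the second one has no accumulation points. -/
theorem exists_contains_excludes {Zin Zout : Set ℂ} (h0 : (0 : ℂ) ∈ Zin)
    (hdisj : ∀ z ∈ Zin, z ∉ Zout) (hin : ∀ ε > 0, {z ∈ Zin | ε ≤ ‖z‖}.Finite)
    (hout : ∀ M : ℝ, {z ∈ Zout | ‖z‖ ≤ M}.Finite) :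
    ∃ C : ContourCycle, (∀ z ∈ Zin, C.Contains z) ∧ ∀ z ∈ Zout, C.Excludes z := by
  classical
  -- The circle of radius `R` is a first approximation that puts all but finitely many points on the
  -- correct side; `(1, 2)` is any interval in which only finitely many radii are forbidden.
  obtain ⟨R, hR, hRn⟩ : ∃ R ∈ Ioo (1 : ℝ) 2, ∀ z ∈ Zin ∪ Zout, ‖z‖ ≠ R := by
    have hf := ((hin 1 one_pos).union (hout 2)).image (fun z => ‖z‖)
    obtain ⟨R, hR, hR'⟩ := (Ioo_infinite (show (1 : ℝ) < 2 by norm_num)).exists_notMem_finite hf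
    refine ⟨R, hR, fun z hz hzR => hR' ⟨z, ?_, hzR⟩⟩
    exact hz.imp (fun h => ⟨h, by rw [hzR]; exact hR.1.le⟩)
      fun h => ⟨h, by rw [hzR]; exact hR.2.le⟩
  have hR0 : 0 ≤ R := by linarith [hR.1]
  -- Each point of `E` receives its own small circle, positively oriented for a point to be
  -- contained and negatively for one to be excluded. Later `E` is the finite set of points
  -- misplaced by the large circle.
  have key : ∀ E : Finset ℂ, (0 : ℂ) ∉ E → ↑E ⊆ Zin ∪ Zout →
      ∃ C : ContourCycle, ∀ z ∈ Zin ∪ Zout, z ∉ C.trace ∧ C.winding z =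
        (if ‖z‖ < R then 1 else 0) + if z ∈ E then (if z ∈ Zin then 1 else -1) else 0 := by
    intro E
    induction E using Finset.induction_on with
    | empty =>
      refine fun _ _ => ⟨circle 0 R, fun z hz => ⟨fun h => hRn z hz ?_, ?_⟩⟩
      · simpa using circle_trace 0 hR0 h
      · rcases (hRn z hz).lt_or_gt with h | h
        · simp [circle_winding_of_lt (show dist z 0 < R by simpa using h), h]
        · simp [circle_winding_of_gt hR0 (show R < dist z 0 by simpa using h), h.le]
    | insert e E heE ih =>
      intro h0E hsub
      rw [Finset.mem_insert, not_or] at h0E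
      rw [Finset.coe_insert, insert_subset_iff] at hsub
      obtain ⟨C, hC⟩ := ih h0E.2 hsub.2
      obtain ⟨r, hr, hr'⟩ := exists_pos_forall_notMem_closedBall hin hout (Ne.symm h0E.1)
      have htr : ∀ z ∈ Zin ∪ Zout, z ∉ (circle e r).trace := fun z hz h => by
        have := circle_trace e hr.le h
        rw [Metric.mem_sphere] at this
        rcases eq_or_ne z e with rfl | hne
        · rw [dist_self] at this; exact hr.ne this
        · exact (hr' z hz hne).ne' this
      have hwd : ∀ z ∈ Zin ∪ Zout, (circle e r).winding z = if z = e then 1 else 0 := by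
        intro z hz
        split_ifs with h
        · exact circle_winding_of_lt (by rw [h, dist_self]; exact hr)
        · exact circle_winding_of_gt hr.le (hr' z hz h)
      by_cases hein : e ∈ Zin
      · refine ⟨C.add (circle e r), fun z hz => ⟨?_, ?_⟩⟩
        · rw [add_trace]
          exact fun h => h.elim (hC z hz).1 (htr z hz)
        · rw [add_winding, (hC z hz).2, hwd z hz]
          rcases eq_or_ne z e with rfl | hne
          · simp [heE, hein]
          · simp [hne]
      · refine ⟨C.add (circle e r).neg, fun z hz => ⟨?_, ?_⟩⟩
        · rw [add_trace, neg_trace]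
          exact fun h => h.elim (hC z hz).1 (htr z hz)
        · rw [add_winding, neg_winding, (hC z hz).2, hwd z hz]
          rcases eq_or_ne z e with rfl | hne
          · simp [heE, hein]
          · simp [hne]
  have hfin : ({z ∈ Zin | R ≤ ‖z‖} ∪ {z ∈ Zout | ‖z‖ ≤ R}).Finite :=
    (hin R (by linarith [hR.1])).union (hout R)
  obtain ⟨C, hC⟩ := key hfin.toFinset
    (by
      simp only [Finite.mem_toFinset, mem_union, mem_ofPred_eq, norm_zero, not_or, not_and]
      exact ⟨fun _ h => by linarith [hR.1], fun h => (hdisj 0 h0 h).elim⟩)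
    (by
      rw [Finite.coe_toFinset]
      exact union_subset_union (fun z hz => hz.1) fun z hz => hz.1)
  refine ⟨C, fun z hz => ⟨(hC z (Or.inl hz)).1, ?_⟩, fun z hz => ⟨(hC z (Or.inr hz)).1, ?_⟩⟩
  · rw [(hC z (Or.inl hz)).2]
    have := hdisj z hz
    rcases (hRn z (Or.inl hz)).lt_or_gt with h | h
    · simp [hz, this, h]
    · simp [hz, h.le]
  · rw [(hC z (Or.inr hz)).2]
    have : z ∉ Zin := fun h => hdisj z h hz
    rcases (hRn z (Or.inr hz)).lt_or_gt with h | h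
    · simp [hz, this, h, h.le]
    · simp [hz, this, h.le, h.not_ge]

/-! ### Limits of integrals of holomorphic functions -/

lemma exists_eventually_forall_norm_le {ι : Type*} {l : Filter ι} {H : ι → ℂ → ℂ} {K : Set ℂ}
    (hK : IsCompact K) (h : ∀ w ∈ K, ∃ M, ∀ᶠ x : ι × ℂ in l ×ˢ 𝓝 w, ‖H x.1 x.2‖ ≤ M) :
    ∃ M, ∀ᶠ s in l, ∀ w ∈ K, ‖H s w‖ ≤ M := by
  refine hK.induction_on (p := fun K => ∃ M, ∀ᶠ s in l, ∀ w ∈ K, ‖H s w‖ ≤ M) ?_ ?_ ?_ ?_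
  · exact ⟨0, by simp⟩
  · rintro K K' hKK ⟨M, hM⟩
    exact ⟨M, hM.mono fun s hs w hw => hs w (hKK hw)⟩
  · rintro K K' ⟨M, hM⟩ ⟨M', hM'⟩
    refine ⟨max M M', ?_⟩
    filter_upwards [hM, hM'] with s h1 h2 w hw
    exact hw.elim (fun h => (h1 w h).trans (le_max_left _ _))
      fun h => (h2 w h).trans (le_max_right _ _)
  · intro w hw
    obtain ⟨M, hM⟩ := h w hw
    obtain ⟨p, hp, q, hq, hpq⟩ := eventually_prod_iff.1 hM
    exact ⟨{w | q w}, mem_nhdsWithin_of_mem_nhds hq, M, hp.mono fun s hs w hw => hpq hs hw⟩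

/-- If holomorphic functions converge locally uniformly off a countable set, then their integrals
over a cycle converge. -/
theorem tendsto_integral {ι : Type*} {l : Filter ι} [l.IsCountablyGenerated] {C : ContourCycle}
    {H : ι → ℂ → ℂ} {H₀ : ℂ → ℂ} {B : Set ℂ} (hB : B.Countable)
    (hd : ∀ w ∈ C.trace, ∀ᶠ x : ι × ℂ in l ×ˢ 𝓝 w, DifferentiableAt ℂ (H x.1) x.2)
    (hl : ∀ w ∉ B, Tendsto (fun x : ι × ℂ => H x.1 x.2) (l ×ˢ 𝓝 w) (𝓝 (H₀ w))) :
    Tendsto (fun s => C.integral (H s)) l (𝓝 (C.integral H₀)) := by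
  have hbd : ∀ w ∈ C.trace, ∃ M, ∀ᶠ x : ι × ℂ in l ×ˢ 𝓝 w, ‖H x.1 x.2‖ ≤ M := by
    intro w hw
    obtain ⟨p, hp, q, hq, hpq⟩ := eventually_prod_iff.1 (hd w hw)
    obtain ⟨ρ, hρ, hball⟩ := Metric.eventually_nhds_iff_ball.1 hq
    -- The circle of radius `r` about `w` misses the exceptional set, so the functions are
    -- eventually bounded on it; the maximum principle extends the bound to the disc, even if `w`
    -- itself is exceptional.
    obtain ⟨r, hr, hrB⟩ := ((hB.image fun z => dist z w).dense_compl ℝ).exists_mem_open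
      isOpen_Ioo (nonempty_Ioo.2 hρ)
    obtain ⟨M, hM⟩ := exists_eventually_forall_norm_le (l := l) (H := H) (isCompact_sphere w r)
      fun y hy => ⟨‖H₀ y‖ + 1, by
        have hyB : y ∉ B := fun h => hr ⟨y, h, hy⟩
        have := (hl y hyB).norm.eventually_le_const (lt_add_one ‖H₀ y‖)
        exact this⟩
    refine ⟨M, eventually_prod_iff.2 ⟨_, hp.and hM, _, Metric.ball_mem_nhds w hrB.1, ?_⟩⟩
    intro s hs y hy
    refine Complex.norm_le_of_forall_mem_frontier_norm_le Metric.isBounded_ball (f := H s)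
      (U := Metric.ball w r) ?_ ?_ (subset_closure hy)
    · refine DifferentiableOn.diffContOnCl_ball (U := Metric.ball w ρ)
        (fun z hz => (hpq hs.1 (hball z hz)).differentiableWithinAt)
        (Metric.closedBall_subset_ball hrB.2)
    · intro z hz
      rw [frontier_ball w hrB.1.ne'] at hz
      exact hs.2 z hz
  obtain ⟨M, hM⟩ := exists_eventually_forall_norm_le C.isCompact_trace hbd
  have hcont : ∀ᶠ s in l, ContinuousOn (H s) C.trace := by
    have := C.isCompact_trace.induction_on
      (p := fun K => ∀ᶠ s in l, ∀ w ∈ K, DifferentiableAt ℂ (H s) w) (by simp)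
      (fun K K' hKK h => h.mono fun s hs w hw => hs w (hKK hw))
      (fun K K' h h' => by
        filter_upwards [h, h'] with s h1 h2 w hw
        exact hw.elim (h1 w) (h2 w))
      (fun w hw => by
        obtain ⟨p, hp, q, hq, hpq⟩ := eventually_prod_iff.1 (hd w hw)
        exact ⟨{w | q w}, mem_nhdsWithin_of_mem_nhds hq, hp.mono fun s hs w hw => hpq hs hw⟩)
    exact this.mono fun s hs w hw => (hs w hw).continuousAt.continuousWithinAt
  refine tendsto_finsetSum _ fun i _ => ?_
  have hmem : ∀ x, x ∈ uIoc (0 : ℝ) 1 → C.loop i x ∈ C.trace := fun x hx => by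
    rw [uIoc_of_le zero_le_one] at hx
    exact C.loop_mem_trace i (Ioc_subset_Icc_self hx)
  refine intervalIntegral.tendsto_integral_filter_of_dominated_convergence
    (fun x => M * ‖deriv (C.loop i) x‖) ?_ ?_ ?_ ?_
  · filter_upwards [hcont] with s hs
    exact (intervalIntegrable_iff.1 (intervalIntegrable_integrand hs i)).aestronglyMeasurable
  · filter_upwards [hM] with s hs
    refine Eventually.of_forall fun x hx => ?_
    rw [norm_mul]
    exact mul_le_mul_of_nonneg_right (hs _ (hmem x hx)) (norm_nonneg _)
  · exact (continuous_const.mul (C.continuous_deriv_loop i).norm).intervalIntegrable _ _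
  -- At almost every time spent in the exceptional set the velocity is zero, and there both
  -- integrands vanish.
  · filter_upwards [ae_deriv_eq_zero_of_countable (C.hasDerivAt_loop i) hB] with x hx _
    by_cases hxB : C.loop i x ∈ B
    · simp only [hx hxB, mul_zero]
      exact tendsto_const_nhds
    · refine Tendsto.mul_const _ ?_
      exact (hl _ hxB).comp (tendsto_id.prodMk (tendsto_const_nhds (x := C.loop i x)))

end ContourCycle

/-! ### Infinite products -/

lemma summable_pow_mul_pow {a b : ℝ} (ha : 0 ≤ a) (ha1 : a < 1) (hb : 0 ≤ b) (hb1 : b < 1) (c : ℝ) :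
    Summable fun k : ℕ × ℕ => c * a ^ k.1 * b ^ k.2 := by
  simp_rw [mul_assoc]
  exact ((summable_geometric_of_lt_one ha ha1).mul_of_nonneg (summable_geometric_of_lt_one hb hb1)
    (fun _ => pow_nonneg ha _) fun _ => pow_nonneg hb _).mul_left c

/-- Joint continuity in all three variables, by dominated convergence for products. The case `p₀ =
0` is the one that governs `p → 0`. -/
lemma tendsto_qPoch₂ {ι : Type*} {l : Filter ι} {x p q : ι → ℂ} {x₀ p₀ q₀ : ℂ}
    (hx : Tendsto x l (𝓝 x₀)) (hp : Tendsto p l (𝓝 p₀)) (hq : Tendsto q l (𝓝 q₀))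
    (hp₀ : ‖p₀‖ < 1) (hq₀ : ‖q₀‖ < 1) :
    Tendsto (fun i => qPoch₂ (x i) (p i) (q i)) l (𝓝 (qPoch₂ x₀ p₀ q₀)) := by
  obtain ⟨a, ha, ha1⟩ := exists_between hp₀
  obtain ⟨b, hb, hb1⟩ := exists_between hq₀
  have ha0 := (norm_nonneg _).trans ha.le
  have hb0 := (norm_nonneg _).trans hb.le
  simp only [qPoch₂, sub_eq_add_neg]
  refine tendsto_tprod_one_add_of_dominated_convergence
    (summable_pow_mul_pow ha0 ha1 hb0 hb1 (‖x₀‖ + 1))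
    (fun k => ((hx.mul (hp.pow k.1)).mul (hq.pow k.2)).neg) ?_
  filter_upwards [hx.norm.eventually_le_const (lt_add_one ‖x₀‖), hp.norm.eventually_le_const ha,
    hq.norm.eventually_le_const hb] with i h1 h2 h3 k
  rw [norm_neg, norm_mul, norm_mul, norm_pow, norm_pow]
  gcongr

/-- With `0 ^ 0 = 1`, setting `p = 0` leaves only the row `i = 0`. This shows what survives of the
double product as `p → 0` and transfers analytic facts to the single product. -/
lemma qPoch_eq_qPoch₂ (x q : ℂ) : qPoch x q = qPoch₂ x 0 q := by
  rw [qPoch, qPoch₂]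
  have hinj : Function.Injective (fun k : ℕ => ((0, k) : ℕ × ℕ)) := fun a b h => by simpa using h
  rw [← hinj.tprod_eq]
  · simp
  · rintro ⟨i, j⟩ h
    rcases Nat.eq_zero_or_pos i with rfl | hi
    · exact ⟨j, rfl⟩
    · exact absurd (by simp [hi.ne']) h

lemma tendsto_qPoch {ι : Type*} {l : Filter ι} {x q : ι → ℂ} {x₀ q₀ : ℂ}
    (hx : Tendsto x l (𝓝 x₀)) (hq : Tendsto q l (𝓝 q₀)) (hq₀ : ‖q₀‖ < 1) :
    Tendsto (fun i => qPoch (x i) (q i)) l (𝓝 (qPoch x₀ q₀)) := by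
  simp only [qPoch_eq_qPoch₂]
  exact tendsto_qPoch₂ hx tendsto_const_nhds hq (by simp) hq₀

lemma qPoch_zero (q : ℂ) : qPoch 0 q = 1 := by simp [qPoch]

lemma qPoch₂_zero (p q : ℂ) : qPoch₂ 0 p q = 1 := by simp [qPoch₂]

lemma summable_norm_qPoch₂ (x : ℂ) {p q : ℂ} (hp : ‖p‖ < 1) (hq : ‖q‖ < 1) :
    Summable fun k : ℕ × ℕ => ‖-(x * p ^ k.1 * q ^ k.2)‖ := by
  refine (summable_pow_mul_pow (norm_nonneg p) hp (norm_nonneg q) hq ‖x‖).congr fun k => ?_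
  rw [norm_neg, norm_mul, norm_mul, norm_pow, norm_pow]

lemma multipliable_qPoch₂ (x : ℂ) {p q : ℂ} (hp : ‖p‖ < 1) (hq : ‖q‖ < 1) :
    Multipliable fun k : ℕ × ℕ => 1 - x * p ^ k.1 * q ^ k.2 := by
  simp only [sub_eq_add_neg]
  exact multipliable_one_add_of_summable (summable_norm_qPoch₂ x hp hq)

lemma summable_norm_qPoch (x : ℂ) {q : ℂ} (hq : ‖q‖ < 1) :
    Summable fun k : ℕ => ‖-(x * q ^ k)‖ := by
  refine ((summable_geometric_of_lt_one (norm_nonneg q) hq).mul_left ‖x‖).congr fun k => ?_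
  rw [norm_neg, norm_mul, norm_pow]

lemma multipliable_qPoch (x : ℂ) {q : ℂ} (hq : ‖q‖ < 1) :
    Multipliable fun k : ℕ => 1 - x * q ^ k := by
  simp only [sub_eq_add_neg]
  exact multipliable_one_add_of_summable (summable_norm_qPoch x hq)

lemma qPoch₂_ne_zero {x p q : ℂ} (hp : ‖p‖ < 1) (hq : ‖q‖ < 1)
    (h : ∀ i j : ℕ, x * p ^ i * q ^ j ≠ 1) : qPoch₂ x p q ≠ 0 := by
  simp only [qPoch₂, sub_eq_add_neg]
  refine tprod_one_add_ne_zero_of_summable (fun k hk => h k.1 k.2 ?_)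
    (summable_norm_qPoch₂ x hp hq)
  linear_combination -hk

lemma qPoch_ne_zero {x q : ℂ} (hq : ‖q‖ < 1) (h : ∀ j : ℕ, x * q ^ j ≠ 1) : qPoch x q ≠ 0 := by
  simp only [qPoch, sub_eq_add_neg]
  refine tprod_one_add_ne_zero_of_summable (fun k hk => h k ?_) (summable_norm_qPoch x hq)
  linear_combination -hk

lemma qPoch_eq_zero (x q : ℂ) {j : ℕ} (h : x * q ^ j = 1) : qPoch x q = 0 :=
  tprod_of_exists_eq_zero ⟨j, by simp [h]⟩

lemma qPoch₂_symm (x p q : ℂ) : qPoch₂ x p q = qPoch₂ x q p := by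
  rw [qPoch₂, qPoch₂, ← (Equiv.prodComm ℕ ℕ).tprod_eq]
  simp [mul_right_comm]

lemma qPoch₂_eq_mul (x : ℂ) {p q : ℂ} (hp : ‖p‖ < 1) (hq : ‖q‖ < 1) :
    qPoch₂ x p q = qPoch x q * qPoch₂ (p * x) p q := by
  have h : ∀ x, HasProd (fun i => qPoch (x * p ^ i) q) (qPoch₂ x p q) := fun x =>
    (multipliable_qPoch₂ x hp hq).hasProd.prod_fiberwise
      fun i => (multipliable_qPoch (x * p ^ i) hq).hasProd
  have h1 := h (p * x)
  have h2 : (fun i => qPoch (p * x * p ^ i) q) = fun i => qPoch (x * p ^ (i + 1)) q := by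
    ext i; congr 1; ring
  rw [h2] at h1
  rw [← (h x).tprod_eq, tprod_eq_zero_mul' (f := fun i => qPoch (x * p ^ i) q) h1.multipliable,
    h1.tprod_eq, pow_zero, mul_one]

lemma qPoch₂_eq_mul' (x : ℂ) {p q : ℂ} (hp : ‖p‖ < 1) (hq : ‖q‖ < 1) :
    qPoch₂ x p q = qPoch x p * qPoch₂ (q * x) p q := by
  rw [qPoch₂_symm, qPoch₂_eq_mul x hq hp, qPoch₂_symm]

lemma qPoch_eq_mul (x : ℂ) {q : ℂ} (hq : ‖q‖ < 1) : qPoch x q = (1 - x) * qPoch (q * x) q := by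
  have h := multipliable_qPoch (q * x) hq
  have h2 : (fun i => 1 - q * x * q ^ i) = fun i => 1 - x * q ^ (i + 1) := by
    ext i; ring
  rw [h2] at h
  rw [qPoch, tprod_eq_zero_mul' (f := fun i => 1 - x * q ^ i) h, qPoch, h2, pow_zero, mul_one]

lemma differentiable_qPoch₂ {p q : ℂ} (hp : ‖p‖ < 1) (hq : ‖q‖ < 1) :
    Differentiable ℂ fun x => qPoch₂ x p q := by
  intro x₀
  have hloc : HasProdLocallyUniformlyOn (fun (k : ℕ × ℕ) x => 1 + -(x * p ^ k.1 * q ^ k.2))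
      (fun x => ∏' k : ℕ × ℕ, (1 + -(x * p ^ k.1 * q ^ k.2))) (Metric.ball 0 (‖x₀‖ + 1)) := by
    refine Summable.hasProdLocallyUniformlyOn_one_add
      (f := fun (k : ℕ × ℕ) x => -(x * p ^ k.1 * q ^ k.2)) Metric.isOpen_ball
      (summable_pow_mul_pow (norm_nonneg p) hp (norm_nonneg q) hq (‖x₀‖ + 1)) ?_ ?_
    · refine Eventually.of_forall fun k x hx => ?_
      rw [mem_ball_zero_iff] at hx
      rw [norm_neg, norm_mul, norm_mul, norm_pow, norm_pow]
      gcongr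
    · exact fun k => by fun_prop
  have := hloc.differentiableOn (Eventually.of_forall fun s => by
    simpa [Finset.prod_fn] using DifferentiableOn.fun_finsetProd (fun _ _ => by fun_prop))
    Metric.isOpen_ball
  simp only [qPoch₂, sub_eq_add_neg]
  exact this.differentiableAt (Metric.isOpen_ball.mem_nhds (by simp))

lemma differentiable_qPoch {q : ℂ} (hq : ‖q‖ < 1) : Differentiable ℂ fun x => qPoch x q := by
  simp only [qPoch_eq_qPoch₂]
  exact differentiable_qPoch₂ (by simp) hq

/-! ### The theta function -/

lemma theta_div (x : ℂ) {p : ℂ} (hp : p ≠ 0) : theta (p / x) p = theta x p := by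
  rw [theta, theta, div_div_cancel₀ hp, mul_comm]

lemma theta_mul {x p : ℂ} (hp : p ≠ 0) (hp1 : ‖p‖ < 1) (hx : x ≠ 0) :
    theta (p * x) p = -x⁻¹ * theta x p := by
  rw [theta, theta, qPoch_eq_mul x hp1, show p / (p * x) = x⁻¹ by field_simp, qPoch_eq_mul x⁻¹ hp1,
    ← div_eq_mul_inv]
  field_simp
  ring

lemma theta_inv {x p : ℂ} (hp : p ≠ 0) (hp1 : ‖p‖ < 1) (hx : x ≠ 0) :
    theta x⁻¹ p = -x⁻¹ * theta x p := by
  rw [← theta_mul hp hp1 hx, ← theta_div _ hp]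
  simp

lemma theta_one (p : ℂ) : theta 1 p = 0 := by
  rw [theta, qPoch_eq_zero 1 p (j := 0) (by simp), zero_mul]

lemma differentiableAt_theta {x p : ℂ} (hp : ‖p‖ < 1) (hx : x ≠ 0) :
    DifferentiableAt ℂ (fun x => theta x p) x :=
  (differentiable_qPoch hp x).mul ((differentiable_qPoch hp (p / x)).comp x
    ((differentiableAt_const p).div differentiableAt_id hx))

lemma theta_ne_zero {x p : ℂ} (hp : p ≠ 0) (hp1 : ‖p‖ < 1) (h : ∀ n : ℤ, x ≠ p ^ n) :
    theta x p ≠ 0 := by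
  refine mul_ne_zero (qPoch_ne_zero hp1 fun j hj => h (-j) ?_) (qPoch_ne_zero hp1 fun j hj => ?_)
  · rw [zpow_neg, zpow_natCast]
    exact eq_inv_of_mul_eq_one_left hj
  · refine h (j + 1) ?_
    have hx : x ≠ 0 := by rintro rfl; simp at hj
    rw [zpow_add₀ hp, zpow_natCast, zpow_one]
    field_simp at hj
    linear_combination -hj

/-! ### The elliptic gamma function -/

lemma ellGamma_mul_q {x p q : ℂ} (hp1 : ‖p‖ < 1) (hq : q ≠ 0) (hq1 : ‖q‖ < 1)
    (hA : qPoch₂ x p q ≠ 0) : ellGamma (q * x) p q = theta x p * ellGamma x p q := by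
  have h1 := qPoch₂_eq_mul' x hp1 hq1
  have h2 := qPoch₂_eq_mul' (p / x) hp1 hq1
  rw [h1] at hA
  rw [ellGamma, ellGamma, theta, h1, show p * q / (q * x) = p / x by field_simp, h2,
    show p * q / x = q * (p / x) by ring]
  have := left_ne_zero_of_mul hA
  have := right_ne_zero_of_mul hA
  field_simp

lemma ellGamma_mul_p {x p q : ℂ} (hp : p ≠ 0) (hp1 : ‖p‖ < 1) (hq1 : ‖q‖ < 1)
    (hA : qPoch₂ x p q ≠ 0) : ellGamma (p * x) p q = theta x q * ellGamma x p q := by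
  have h1 := qPoch₂_eq_mul x hp1 hq1
  have h2 := qPoch₂_eq_mul (q / x) hp1 hq1
  rw [h1] at hA
  rw [ellGamma, ellGamma, theta, h1, show p * q / (p * x) = q / x by field_simp, h2,
    show p * q / x = p * (q / x) by ring]
  have := left_ne_zero_of_mul hA
  have := right_ne_zero_of_mul hA
  field_simp

lemma differentiableAt_ellGamma {x p q : ℂ} (hp1 : ‖p‖ < 1) (hq1 : ‖q‖ < 1) (hx : x ≠ 0)
    (hA : qPoch₂ x p q ≠ 0) : DifferentiableAt ℂ (fun x => ellGamma x p q) x :=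
  ((differentiable_qPoch₂ hp1 hq1 (p * q / x)).comp x
    ((differentiableAt_const (p * q)).div differentiableAt_id hx)).div
    (differentiable_qPoch₂ hp1 hq1 x) hA

/-- The reflection formula. -/
lemma ellGamma_mul_ellGamma_inv {x p q : ℂ} (hp1 : ‖p‖ < 1) (hq1 : ‖q‖ < 1)
    (h3 : qPoch₂ (p * q / x) p q ≠ 0)
    (h4 : qPoch₂ (p * q * x) p q ≠ 0) :
    (ellGamma x p q * ellGamma x⁻¹ p q)⁻¹ = theta x p * theta x⁻¹ q := by
  rcases eq_or_ne x 0 with rfl | hx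
  · simp [ellGamma, theta, qPoch₂_zero, qPoch_zero]
  have e1 := qPoch₂_eq_mul' x hp1 hq1
  have e2 := qPoch₂_eq_mul (q * x) hp1 hq1
  have e3 := qPoch₂_eq_mul x⁻¹ hp1 hq1
  have e4 := qPoch₂_eq_mul' (p * x⁻¹) hp1 hq1
  rw [show p * (q * x) = p * q * x by ring] at e2
  rw [show q * (p * x⁻¹) = p * q / x by ring] at e4
  rw [e2] at e1
  rw [e4] at e3
  rw [ellGamma, ellGamma, theta, theta, div_inv_eq_mul, div_inv_eq_mul, e1, e3,
    div_eq_mul_inv p x]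
  field_simp

/-! ### The addition formula for theta functions -/

/-- A holomorphic function on `ℂ*` with a multiplicative period is constant. -/
lemma eq_of_multiplicative_period {q : ℂ} (hq0 : q ≠ 0) (hq1 : ‖q‖ < 1) {E : ℂ → ℂ}
    (hE : ∀ z, z ≠ 0 → DifferentiableAt ℂ E z) (hper : ∀ z, z ≠ 0 → E (q * z) = E z)
    {z w : ℂ} (hz : z ≠ 0) (hw : w ≠ 0) : E z = E w := by
  have hper' : ∀ (n : ℤ) z, z ≠ 0 → E (q ^ n * z) = E z := by
    intro n z hz
    induction n using Int.induction_on with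
    | zero => simp
    | succ n ih =>
      rw [zpow_add_one₀ hq0, mul_comm _ q, mul_assoc, hper _ (mul_ne_zero (zpow_ne_zero _ hq0) hz),
        ih]
    | pred n ih =>
      rw [← ih, ← hper (q ^ (-(n : ℤ) - 1) * z) (mul_ne_zero (zpow_ne_zero _ hq0) hz), ← mul_assoc,
        mul_comm q, ← zpow_add_one₀ hq0, sub_add_cancel]
  -- This compact annulus meets every orbit under multiplication by `q`, so the function is bounded,
  -- and Liouville's theorem applies after composition with the exponential.
  have hK : IsCompact (Metric.closedBall (0 : ℂ) ‖q‖⁻¹ \ Metric.ball 0 1) :=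
    (isCompact_closedBall _ _).diff Metric.isOpen_ball
  obtain ⟨M, hM⟩ := hK.exists_bound_of_continuousOn (f := E) fun y hy =>
    (hE y (by rintro rfl; simp at hy)).continuousAt.continuousWithinAt
  have hbd : ∀ z, z ≠ 0 → ‖E z‖ ≤ M := by
    intro z hz
    have hq0' : 0 < ‖q‖ := norm_pos_iff.2 hq0
    obtain ⟨n, hn1, hn2⟩ := exists_mem_Ico_zpow (norm_pos_iff.2 hz) ((one_lt_inv₀ hq0').2 hq1)
    rw [← hper' n z hz]
    rw [inv_zpow] at hn1 hn2
    have hpos : 0 < ‖q‖ ^ n := zpow_pos hq0' n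
    refine hM _ ⟨?_, ?_⟩
    · rw [mem_closedBall_zero_iff, norm_mul, norm_zpow]
      rw [zpow_add_one₀ hq0'.ne', mul_inv] at hn2
      have := mul_le_mul_of_nonneg_left hn2.le hpos.le
      rwa [mul_inv_cancel_left₀ hpos.ne'] at this
    · rw [mem_ball_zero_iff, norm_mul, norm_zpow, not_lt]
      have := mul_le_mul_of_nonneg_left hn1 hpos.le
      rwa [mul_inv_cancel₀ hpos.ne'] at this
  have := Differentiable.apply_eq_apply_of_bounded (f := fun x => E (Complex.exp x))
    (fun x => (hE _ (Complex.exp_ne_zero x)).comp x Complex.differentiableAt_exp)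
    (isBounded_iff_forall_norm_le.2 ⟨M, by
      rintro _ ⟨x, rfl⟩
      exact hbd _ (Complex.exp_ne_zero x)⟩) (Complex.log z) (Complex.log w)
  simpa [Complex.exp_log hz, Complex.exp_log hw] using this

/-- Two holomorphic functions on `ℂ*` with the same quasi-periodicity are proportional, if the
second one has simple zeros only and the first one vanishes there. -/
lemma exists_eq_mul_of_quasiperiodic {q : ℂ} (hq0 : q ≠ 0) (hq1 : ‖q‖ < 1) {D Θ m : ℂ → ℂ}
    (hD : ∀ z, z ≠ 0 → DifferentiableAt ℂ D z) (hΘ : ∀ z, z ≠ 0 → DifferentiableAt ℂ Θ z)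
    (hDq : ∀ z, z ≠ 0 → D (q * z) = m z * D z) (hΘq : ∀ z, z ≠ 0 → Θ (q * z) = m z * Θ z)
    (hm : ∀ z, z ≠ 0 → m z ≠ 0) (hsimple : ∀ z, z ≠ 0 → Θ z = 0 → deriv Θ z ≠ 0)
    (hzero : ∀ z, z ≠ 0 → Θ z = 0 → D z = 0) : ∃ c, ∀ z, z ≠ 0 → D z = c * Θ z := by
  classical
  -- The quotient `D / Θ`, completed at the simple zeros of `Θ` by its removable value.
  set E : ℂ → ℂ := fun z => if Θ z = 0 then deriv D z / deriv Θ z else D z / Θ z with hE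
  have hpunct : ∀ z, z ≠ 0 → ∀ᶠ y in 𝓝[≠] z, Θ y ≠ 0 := by
    intro z hz
    by_cases h : Θ z = 0
    · exact (hΘ z hz).hasDerivAt.eventually_ne (hsimple z hz h)
    · exact ((hΘ z hz).continuousAt.eventually_ne h).filter_mono nhdsWithin_le_nhds
  have hEd : ∀ z, z ≠ 0 → DifferentiableAt ℂ E z := by
    intro z hz
    have hne : ∀ᶠ y in 𝓝 z, y ≠ 0 := eventually_ne_nhds hz
    by_cases h : Θ z = 0
    · have hds : ∀ F : ℂ → ℂ, (∀ z, z ≠ 0 → DifferentiableAt ℂ F z) →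
          DifferentiableAt ℂ (dslope F z) z := fun F hF =>
        ((Complex.differentiableOn_dslope (s := {0}ᶜ) (isOpen_compl_singleton.mem_nhds hz)).2
          fun y hy => (hF y hy).differentiableWithinAt).differentiableAt
          (isOpen_compl_singleton.mem_nhds hz)
      have hs : dslope Θ z z ≠ 0 := by rw [dslope_same]; exact hsimple z hz h
      refine ((hds D hD).div (hds Θ hΘ) hs).congr_of_eventuallyEq ?_
      filter_upwards [(hds Θ hΘ).continuousAt.eventually_ne hs] with y hy
      rcases eq_or_ne y z with rfl | hyz
      · simp [hE, h, dslope_same]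
      · have h1 := sub_smul_dslope Θ z y
        have h2 := sub_smul_dslope D z y
        rw [h, sub_zero, smul_eq_mul] at h1
        rw [hzero z hz h, sub_zero, smul_eq_mul] at h2
        have h3 := sub_ne_zero.2 hyz
        have h4 : Θ y ≠ 0 := by rw [← h1]; exact mul_ne_zero h3 hy
        simp only [hE, if_neg h4, Pi.div_apply]
        rw [← h1, ← h2, mul_div_mul_left _ _ h3]
    · refine ((hD z hz).div (hΘ z hz) h).congr_of_eventuallyEq ?_
      filter_upwards [(hΘ z hz).continuousAt.eventually_ne h] with y hy
      simp [hE, hy]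
  have hper : ∀ z, z ≠ 0 → E (q * z) = E z := by
    intro z hz
    have h1 : Tendsto (fun y => E (q * y)) (𝓝[≠] z) (𝓝 (E (q * z))) := by
      have : ContinuousAt (fun y => E (q * y)) z :=
        ContinuousAt.comp (f := fun y => q * y) (hEd _ (mul_ne_zero hq0 hz)).continuousAt
          (by fun_prop)
      exact this.tendsto.mono_left nhdsWithin_le_nhds
    have h2 : Tendsto E (𝓝[≠] z) (𝓝 (E z)) :=
      (hEd z hz).continuousAt.tendsto.mono_left nhdsWithin_le_nhds
    refine tendsto_nhds_unique (h1.congr' ?_) h2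
    filter_upwards [hpunct z hz, (eventually_ne_nhds hz).filter_mono nhdsWithin_le_nhds] with y hy hy0
    have : Θ (q * y) ≠ 0 := by rw [hΘq y hy0]; exact mul_ne_zero (hm y hy0) hy
    simp only [hE, if_neg hy, if_neg this]
    rw [hDq y hy0, hΘq y hy0, mul_div_mul_left _ _ (hm y hy0)]
  refine ⟨E 1, fun z hz => ?_⟩
  by_cases h : Θ z = 0
  · rw [h, hzero z hz h, mul_zero]
  · rw [eq_of_multiplicative_period hq0 hq1 hEd hper one_ne_zero hz]
    simp only [hE, if_neg h]
    field_simp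

lemma theta_eq_zero_iff {x q : ℂ} (hq0 : q ≠ 0) (hq1 : ‖q‖ < 1) :
    theta x q = 0 ↔ ∃ n : ℤ, x = q ^ n := by
  constructor
  · intro h
    by_contra! hn
    exact theta_ne_zero hq0 hq1 hn h
  · rintro ⟨n, rfl⟩
    rcases n with n | n
    · rcases n with _ | n
      · simpa using theta_one q
      · rw [theta, qPoch_eq_zero (q / _) q (j := n), mul_zero]
        rw [Int.ofNat_eq_natCast, zpow_natCast, pow_succ]
        field_simp
    · rw [theta, qPoch_eq_zero _ q (j := n + 1), zero_mul]
      rw [zpow_negSucc]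
      exact inv_mul_cancel₀ (pow_ne_zero _ hq0)

lemma deriv_theta_ne_zero {q : ℂ} (hq0 : q ≠ 0) (hq1 : ‖q‖ < 1) (n : ℤ) :
    deriv (fun x => theta x q) (q ^ n) ≠ 0 := by
  -- Differentiating the quasi-periodicity relation at a zero carries simplicity of the zero from
  -- `x` to `q x` and back, so only the zero at `1` needs a computation.
  have hstep : ∀ x, x ≠ 0 → theta x q = 0 →
      deriv (fun x => theta x q) (q * x) * q = -x⁻¹ * deriv (fun x => theta x q) x := by
    intro x hx h
    have h1 : HasDerivAt (fun y => theta (q * y) q) (deriv (fun x => theta x q) (q * x) * q) x := by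
      have := (differentiableAt_theta hq1 (mul_ne_zero hq0 hx)).hasDerivAt.comp x
        ((hasDerivAt_id x).const_mul q)
      simpa using! this
    have h2 := ((hasDerivAt_inv hx).fun_neg).fun_mul (differentiableAt_theta hq1 hx).hasDerivAt
    rw [h, mul_zero, zero_add] at h2
    refine h1.unique (h2.congr_of_eventuallyEq ?_)
    filter_upwards [eventually_ne_nhds hx] with y hy using theta_mul hq0 hq1 hy
  induction n using Int.induction_on with
  | zero =>
    have h1 : HasDerivAt (fun x : ℂ => 1 - x) (-1) 1 := by
      simpa using! (hasDerivAt_id (1 : ℂ)).const_sub 1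
    have h2 : DifferentiableAt ℂ (fun x => qPoch (q * x) q * qPoch (q / x) q) 1 :=
      ((differentiable_qPoch hq1 _).comp 1 (by fun_prop)).mul
        ((differentiable_qPoch hq1 (q / 1)).comp (1 : ℂ) (by fun_prop (disch := simp)))
    have h3 := h1.fun_mul h2.hasDerivAt
    have h4 : (fun x => theta x q) = fun x => (1 - x) * (qPoch (q * x) q * qPoch (q / x) q) := by
      ext x
      rw [theta, qPoch_eq_mul x hq1, mul_assoc]
    have hqq : qPoch q q ≠ 0 := qPoch_ne_zero hq1 fun j h => by
      have := congrArg norm h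
      rw [← pow_succ', norm_pow, norm_one] at this
      exact (pow_lt_one₀ (norm_nonneg q) hq1 (Nat.succ_ne_zero j)).ne this
    rw [zpow_zero, h4, h3.deriv]
    simpa using hqq
  | succ n ih =>
    have := hstep (q ^ (n : ℤ)) (zpow_ne_zero _ hq0) ((theta_eq_zero_iff hq0 hq1).2 ⟨n, rfl⟩)
    rw [zpow_add_one₀ hq0, mul_comm]
    intro h
    rw [h, zero_mul] at this
    exact mul_ne_zero (neg_ne_zero.2 (inv_ne_zero (zpow_ne_zero _ hq0))) ih this.symm
  | pred n ih =>
    have := hstep (q ^ (-(n : ℤ) - 1)) (zpow_ne_zero _ hq0)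
      ((theta_eq_zero_iff hq0 hq1).2 ⟨_, rfl⟩)
    rw [mul_comm q, ← zpow_add_one₀ hq0, sub_add_cancel] at this
    intro h
    rw [h, mul_zero] at this
    exact mul_ne_zero ih hq0 this

/-- The addition formula, in a form that breaks the symmetry under `z ↦ 1 / z`. -/
theorem theta_addition {q : ℂ} (hq0 : q ≠ 0) (hq1 : ‖q‖ < 1) {A B C z : ℂ} (hA : A ≠ 0)
    (hB : B ≠ 0) (hC : C ≠ 0) (hz : z ≠ 0) :
    theta (A * B * C / z) q * theta (A * z) q * theta (B * z) q * theta (C * z) q -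
      z ^ 2 * (theta (A * B * C * z) q * theta (A / z) q * theta (B / z) q * theta (C / z) q) =
    theta (z ^ 2) q * (theta (A * B) q * theta (A * C) q * theta (B * C) q) := by
  have hmul : ∀ x, x ≠ 0 → theta (q * x) q = -x⁻¹ * theta x q := fun x => theta_mul hq0 hq1
  have hdiv : ∀ x, x ≠ 0 → theta x q = -x * theta (q * x) q := fun x hx => by
    rw [hmul x hx]; field_simp
  have hdθ : ∀ (g : ℂ → ℂ) (y : ℂ), DifferentiableAt ℂ g y → g y ≠ 0 →
      DifferentiableAt ℂ (fun y => theta (g y) q) y := fun g y hg hy =>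
    (differentiableAt_theta hq1 hy).comp y hg
  -- The difference of the two sides has in `z` the quasi-periodicity of `θ(z²; q)` and vanishes at
  -- its zeros, so it is a constant multiple of it. The first argument stays variable for the
  -- continuity argument at the end.
  set D : ℂ → ℂ → ℂ := fun A z =>
    theta (A * B * C / z) q * theta (A * z) q * theta (B * z) q * theta (C * z) q -
      z ^ 2 * (theta (A * B * C * z) q * theta (A / z) q * theta (B / z) q * theta (C / z) q) -
    theta (z ^ 2) q * (theta (A * B) q * theta (A * C) q * theta (B * C) q) with hDdef
  have hquasi : ∀ A, A ≠ 0 → ∀ z, z ≠ 0 → D A (q * z) = (q * z ^ 4)⁻¹ * D A z := by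
    intro A hA z hz
    have e1 : ∀ x, x ≠ 0 → theta (x / (q * z)) q = -(x / (q * z)) * theta (x / z) q :=
      fun x hx => by
        rw [hdiv (x / (q * z)) (div_ne_zero hx (mul_ne_zero hq0 hz))]
        congr 2
        field_simp
    have e2 : ∀ x, x ≠ 0 → theta (x * (q * z)) q = -(x * z)⁻¹ * theta (x * z) q := fun x hx => by
      rw [← hmul _ (mul_ne_zero hx hz)]; congr 1; ring
    have e3 : theta ((q * z) ^ 2) q = (q * z ^ 4)⁻¹ * theta (z ^ 2) q := by
      rw [show (q * z) ^ 2 = q * (q * z ^ 2) by ring, hmul _ (mul_ne_zero hq0 (pow_ne_zero 2 hz)),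
        hmul _ (pow_ne_zero 2 hz)]
      field_simp
    have hABC := mul_ne_zero (mul_ne_zero hA hB) hC
    simp only [hDdef]
    rw [e1 _ hABC, e1 A hA, e1 B hB, e1 C hC, e2 _ hABC, e2 A hA, e2 B hB, e2 C hC, e3]
    field_simp
  have hroot : ∀ A, A ≠ 0 → ∀ z, z ≠ 0 → ∀ n : ℤ, D A (q ^ n * z) = 0 → D A z = 0 := by
    intro A hA z hz n
    induction n using Int.induction_on with
    | zero => simp
    | succ n ih =>
      intro h
      rw [zpow_add_one₀ hq0, mul_comm _ q, mul_assoc, hquasi A hA _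
        (mul_ne_zero (zpow_ne_zero _ hq0) hz)] at h
      refine ih ((mul_eq_zero.1 h).resolve_left (inv_ne_zero ?_))
      exact mul_ne_zero hq0 (pow_ne_zero 4 (mul_ne_zero (zpow_ne_zero _ hq0) hz))
    | pred n ih =>
      intro h
      refine ih ?_
      have := hquasi A hA (q ^ (-(n : ℤ) - 1) * z) (mul_ne_zero (zpow_ne_zero _ hq0) hz)
      rwa [h, mul_zero, ← mul_assoc, mul_comm q, ← zpow_add_one₀ hq0, sub_add_cancel] at this
  have hone : ∀ A, A ≠ 0 → ∀ z, z ^ 2 = 1 → D A z = 0 := by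
    intro A hA z hz
    have hz0 : z ≠ 0 := by rintro rfl; simp at hz
    have hinv : ∀ x, x / z = x * z := fun x => by
      rw [div_eq_iff hz0, mul_assoc, ← sq, hz, mul_one]
    simp only [hDdef, hinv, hz, theta_one]
    ring
  have hq : ∀ A, A ≠ 0 → ∀ z, z ^ 2 = q → D A z = 0 := by
    intro A hA z hz
    have hz0 : z ≠ 0 := by rintro rfl; exact hq0 (by simpa using hz.symm)
    have e1 : ∀ x, x ≠ 0 → theta (x / z) q = -(x / z) * theta (x * z) q := fun x hx => by
      rw [hdiv _ (div_ne_zero hx hz0)]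
      congr 2
      rw [← hz]
      field_simp
    have hABC := mul_ne_zero (mul_ne_zero hA hB) hC
    have hΘ : theta (z ^ 2) q = 0 := (theta_eq_zero_iff hq0 hq1).2 ⟨1, by simpa using hz⟩
    simp only [hDdef]
    rw [hΘ, e1 _ hABC, e1 A hA, e1 B hB, e1 C hC]
    field_simp
    ring
  have hvanish : ∀ A, A ≠ 0 → ∀ z, z ≠ 0 → theta (z ^ 2) q = 0 → D A z = 0 := by
    intro A hA z hz h
    obtain ⟨n, hn⟩ := (theta_eq_zero_iff hq0 hq1).1 h
    -- Quasi-periodicity moves a zero with `z² = q^n` to one with `z² = q^(n mod 2)`, so only `z² =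
    -- 1` and `z² = q` have to be checked.
    refine hroot A hA z hz (-(n / 2)) ?_
    have hsq : (q ^ (-(n / 2)) * z) ^ 2 = q ^ (n % 2) := by
      rw [mul_pow, hn, ← zpow_natCast, ← zpow_mul, ← zpow_add₀ hq0]
      congr 1
      push_cast
      omega
    rcases Int.emod_two_eq_zero_or_one n with h | h
    · exact hone A hA _ (by rw [hsq, h, zpow_zero])
    · exact hq A hA _ (by rw [hsq, h, zpow_one])
  have hgeneric : ∀ A, A ≠ 0 → theta (A⁻¹ ^ 2) q ≠ 0 → ∀ z, z ≠ 0 → D A z = 0 := by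
    intro A hA hgen z hz
    obtain ⟨c, hc⟩ := exists_eq_mul_of_quasiperiodic hq0 hq1 (D := D A)
      (Θ := fun z => theta (z ^ 2) q) (m := fun z => (q * z ^ 4)⁻¹)
      (by
        intro y hy
        have hABC := mul_ne_zero (mul_ne_zero hA hB) hC
        have h1 : ∀ x, x ≠ 0 → DifferentiableAt ℂ (fun y => theta (x * y) q) y := fun x hx =>
          hdθ _ y (by fun_prop) (mul_ne_zero hx hy)
        have h2 : ∀ x, x ≠ 0 → DifferentiableAt ℂ (fun y => theta (x / y) q) y := fun x hx =>
          hdθ _ y (by fun_prop (disch := exact hy)) (div_ne_zero hx hy)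
        have h3 : DifferentiableAt ℂ (fun y => theta (y ^ 2) q) y :=
          hdθ _ y (by fun_prop) (pow_ne_zero 2 hy)
        exact ((((h2 _ hABC).mul (h1 A hA)).mul (h1 B hB)).mul (h1 C hC)).sub
          ((differentiableAt_id.pow 2).mul
            ((((h1 _ hABC).mul (h2 A hA)).mul (h2 B hB)).mul (h2 C hC))) |>.sub
          (h3.mul (differentiableAt_const _)))
      (fun y hy => hdθ _ y (by fun_prop) (pow_ne_zero 2 hy))
      (hquasi A hA)
      (fun y hy => by
        rw [show (q * y) ^ 2 = q * (q * y ^ 2) by ring,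
          hmul _ (mul_ne_zero hq0 (pow_ne_zero 2 hy)), hmul _ (pow_ne_zero 2 hy)]
        field_simp)
      (fun y hy => inv_ne_zero (mul_ne_zero hq0 (pow_ne_zero 4 hy)))
      (fun y hy h => by
        obtain ⟨n, hn⟩ := (theta_eq_zero_iff hq0 hq1).1 h
        have h1 : HasDerivAt (fun y => theta (y ^ 2) q)
            (deriv (fun x => theta x q) (y ^ 2) * (2 * y)) y := by
          have := (differentiableAt_theta hq1 (pow_ne_zero 2 hy)).hasDerivAt.comp y
            ((hasDerivAt_id y).pow 2)
          simpa using! this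
        rw [h1.deriv, hn]
        exact mul_ne_zero (deriv_theta_ne_zero hq0 hq1 n) (mul_ne_zero two_ne_zero hy))
      (hvanish A hA)
    -- At `z = 1 / A` the first product contains `θ(1; q) = 0` and the other two terms cancel; if
    -- `θ(z²; q)` does not vanish there, the constant is zero.
    have h0 : D A A⁻¹ = 0 := by
      have e : theta (A⁻¹ ^ 2) q = -(A ^ 2)⁻¹ * theta (A ^ 2) q := by
        rw [inv_pow]; exact theta_inv hq0 hq1 (pow_ne_zero 2 hA)
      simp only [hDdef]
      rw [mul_inv_cancel₀ hA, theta_one, e, show A * B * C * A⁻¹ = B * C by field_simp,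
        show A / A⁻¹ = A ^ 2 by field_simp, show B / A⁻¹ = A * B by field_simp,
        show C / A⁻¹ = A * C by field_simp]
      field_simp
      ring
    have hc0 : c = 0 := by
      have := hc A⁻¹ (inv_ne_zero hA)
      rw [h0] at this
      exact (mul_eq_zero.1 this.symm).resolve_right hgen
    rw [hc z hz, hc0, zero_mul]
  refine sub_eq_zero.1 (?_ : D A z = 0)
  by_contra hne
  -- The remaining values of `A` form a countable set, whose complement is dense, so continuity in
  -- `A` finishes the argument.
  have hcont : ContinuousAt (fun A => D A z) A := by
    have h1 : ∀ (g : ℂ → ℂ), ContinuousAt g A → g A ≠ 0 →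
        ContinuousAt (fun A => theta (g A) q) A := fun g hg h =>
      ContinuousAt.comp (f := g) (differentiableAt_theta hq1 h).continuousAt hg
    have hABC := mul_ne_zero (mul_ne_zero hA hB) hC
    have k1 := h1 (fun A => A * B * C / z) (by fun_prop) (div_ne_zero hABC hz)
    have k2 := h1 (fun A => A * z) (by fun_prop) (mul_ne_zero hA hz)
    have k3 := h1 (fun A => A * B * C * z) (by fun_prop) (mul_ne_zero hABC hz)
    have k4 := h1 (fun A => A / z) (by fun_prop) (div_ne_zero hA hz)
    have k5 := h1 (fun A => A * B) (by fun_prop) (mul_ne_zero hA hB)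
    have k6 := h1 (fun A => A * C) (by fun_prop) (mul_ne_zero hA hC)
    simp only [hDdef]
    fun_prop
  have hcount : {A : ℂ | ∃ n : ℤ, A⁻¹ ^ 2 = q ^ n}.Countable := by
    rw [Set.ofPred_exists]
    refine Set.countable_iUnion fun n => ?_
    obtain ⟨y, hy⟩ := IsAlgClosed.exists_pow_nat_eq (q ^ n) (n := 2) (by norm_num)
    refine ((Set.countable_singleton y⁻¹).union (Set.countable_singleton (-y)⁻¹)).mono ?_
    intro x hx
    have hx' : x⁻¹ ^ 2 = y ^ 2 := by rw [hy]; exact hx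
    rcases sq_eq_sq_iff_eq_or_eq_neg.1 hx' with h | h
    · exact Or.inl (by rw [Set.mem_singleton_iff, ← h, inv_inv])
    · exact Or.inr (by rw [Set.mem_singleton_iff, ← h, inv_inv])
  have hev := (hcont.eventually_ne hne).and (eventually_ne_nhds hA)
  obtain ⟨A', hA', hA''⟩ := (hcount.dense_compl ℂ).inter_nhds_nonempty hev
  exact hA''.1 (hgeneric A' hA''.2
    (fun h => hA' ((theta_eq_zero_iff hq0 hq1).1 h)) z hz)

/-! ### The integrand with broken symmetry -/

lemma thetaPoch_ne_zero_left {x q p : ℂ} {m : ℕ} (h : ∀ k : ℕ, theta (x * q ^ k) p ≠ 0) :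
    thetaPoch x q p m ≠ 0 :=
  Finset.prod_ne_zero_iff.2 fun k _ => h k

/-- The `q`-difference equation applied `m` times; the theta factors are rewritten by `θ(p/x; p) =
θ(x; p)` to match the shape of `poleFactor`. -/
lemma ellGamma_eq_thetaPoch_mul {x p q : ℂ} (hp : p ≠ 0) (hp1 : ‖p‖ < 1) (hq : q ≠ 0)
    (hq1 : ‖q‖ < 1) (hx : x ≠ 0) (m : ℕ) (hA : qPoch₂ (x / q ^ m) p q ≠ 0) :
    ellGamma x p q = thetaPoch (p * q / x) q p m * ellGamma (x / q ^ m) p q := by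
  induction m with
  | zero => simp [thetaPoch]
  | succ m ih =>
    have e : x / q ^ m = q * (x / q ^ (m + 1)) := by rw [pow_succ]; field_simp
    have hA' : qPoch₂ (x / q ^ m) p q ≠ 0 := by
      rw [qPoch₂_eq_mul' _ hp1 hq1, ← e] at hA
      exact right_ne_zero_of_mul hA
    rw [ih hA', e, ellGamma_mul_q hp1 hq hq1 hA, thetaPoch, thetaPoch, Finset.prod_range_succ,
      ← theta_div _ hp, mul_assoc]
    congr 3
    rw [pow_succ]
    field_simp

lemma thetaPoch_eq_mul {x p q : ℂ} (hp : p ≠ 0) (hp1 : ‖p‖ < 1) (hq : q ≠ 0) (hx : x ≠ 0) (m : ℕ) :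
    thetaPoch x q p m = (∏ k ∈ Finset.range m, -(x * q ^ k)) * thetaPoch (p * x) q p m := by
  rw [thetaPoch, thetaPoch, ← Finset.prod_mul_distrib]
  refine Finset.prod_congr rfl fun k _ => ?_
  have hxk : x * q ^ k ≠ 0 := mul_ne_zero hx (pow_ne_zero k hq)
  rw [mul_assoc p, theta_mul hp hp1 hxk]
  field_simp

/-- `p` for `r ∈ T`, and `1` otherwise. -/
def shift (T : Finset (Fin 6)) (p : ℂ) (r : Fin 6) : ℂ := if r ∈ T then p else 1

lemma shift_ne_zero {T : Finset (Fin 6)} {p : ℂ} (hp : p ≠ 0) (r : Fin 6) : shift T p r ≠ 0 := by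
  unfold shift; split_ifs <;> simp [hp]

/-- The elliptic weight with the symmetry under `z ↦ 1 / z` broken. -/
def brokenWeight (q p : ℂ) (T : Finset (Fin 6)) (u : Fin 6 → ℂ) (τ z : ℂ) : ℂ :=
  (∏ r, ellGamma (shift T p r * (u r * z)) p q * ellGamma (u r / z) p q) * theta (τ / z) q *
    (-(z ^ 2)⁻¹ * theta (z ^ 2) p)

/-- The set where the broken weight is holomorphic. -/
def regularSet (q p : ℂ) (T : Finset (Fin 6)) (v : Fin 6 → ℂ) : Set ℂ :=
  {z | z ≠ 0 ∧ ∀ r, qPoch₂ (shift T p r * (v r * z)) p q ≠ 0 ∧ qPoch₂ (v r / z) p q ≠ 0}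

/-- The elliptic weight. -/
def ellWeight (q p : ℂ) (u : Fin 6 → ℂ) (z : ℂ) : ℂ :=
  (∏ r, ellGamma (u r * z) p q * ellGamma (u r / z) p q) /
    (ellGamma (z ^ 2) p q * ellGamma (z⁻¹ ^ 2) p q)

lemma isOpen_regularSet {q p : ℂ} (hp1 : ‖p‖ < 1) (hq1 : ‖q‖ < 1) (T : Finset (Fin 6))
    (v : Fin 6 → ℂ) : IsOpen (regularSet q p T v) := by
  have hA : Continuous fun x => qPoch₂ x p q := (differentiable_qPoch₂ hp1 hq1).continuous
  rw [isOpen_iff_mem_nhds]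
  rintro z ⟨hz, h⟩
  have : ∀ r, ∀ᶠ y in 𝓝 z, qPoch₂ (shift T p r * (v r * y)) p q ≠ 0 ∧ qPoch₂ (v r / y) p q ≠ 0 :=
    fun r => by
      have h1 : ContinuousAt (fun y => qPoch₂ (shift T p r * (v r * y)) p q) z :=
        (hA.comp (by fun_prop : Continuous fun y => shift T p r * (v r * y))).continuousAt
      have h2 : ContinuousAt (fun y => qPoch₂ (v r / y) p q) z :=
        hA.continuousAt.comp (f := fun y => v r / y) (by fun_prop (disch := exact hz))
      exact (h1.eventually_ne (h r).1).and (h2.eventually_ne (h r).2)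
  filter_upwards [eventually_ne_nhds hz, eventually_all.2 this] with y h1 h2 using ⟨h1, h2⟩

lemma differentiableAt_brokenWeight {q p : ℂ} (hp0 : p ≠ 0) (hp1 : ‖p‖ < 1) (hq1 : ‖q‖ < 1)
    {T : Finset (Fin 6)} {v : Fin 6 → ℂ} (hv : ∀ r, v r ≠ 0) {τ z : ℂ} (hτ : τ ≠ 0)
    (hz : z ∈ regularSet q p T v) : DifferentiableAt ℂ (brokenWeight q p T v τ) z := by
  obtain ⟨hz0, h⟩ := hz
  have h1 : ∀ r, DifferentiableAt ℂ (fun z => ellGamma (shift T p r * (v r * z)) p q) z := fun r =>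
    DifferentiableAt.fun_comp' (f := fun z => shift T p r * (v r * z)) z
      (differentiableAt_ellGamma hp1 hq1 (mul_ne_zero (shift_ne_zero hp0 r)
        (mul_ne_zero (hv r) hz0)) (h r).1)
      (by fun_prop : DifferentiableAt ℂ (fun z => shift T p r * (v r * z)) z)
  have h2 : ∀ r, DifferentiableAt ℂ (fun z => ellGamma (v r / z) p q) z := fun r =>
    (differentiableAt_ellGamma hp1 hq1 (div_ne_zero (hv r) hz0) (h r).2).comp z
      (by fun_prop (disch := exact hz0) : DifferentiableAt ℂ (fun z => v r / z) z)
  have h3 : DifferentiableAt ℂ (fun z => theta (τ / z) q) z :=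
    (differentiableAt_theta hq1 (div_ne_zero hτ hz0)).comp z
      (by fun_prop (disch := exact hz0) : DifferentiableAt ℂ (fun z => τ / z) z)
  have h4 : DifferentiableAt ℂ (fun z => theta (z ^ 2) p) z :=
    DifferentiableAt.fun_comp' (f := fun z => z ^ 2) z
      (differentiableAt_theta hp1 (pow_ne_zero 2 hz0))
      (by fun_prop : DifferentiableAt ℂ (fun z : ℂ => z ^ 2) z)
  exact ((DifferentiableAt.fun_finsetProd fun r _ => (h1 r).mul (h2 r)).mul h3).mul
    (((differentiableAt_id.pow 2).inv (pow_ne_zero 2 hz0)).neg.mul h4)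

/-- The factor by which the broken weight changes, apart from the pole factors, if its parameters
are divided by powers of `q`. -/
def shiftMonomial (q : ℂ) (T : Finset (Fin 6)) (u : Fin 6 → ℂ) (m : Fin 6 → ℕ) (z : ℂ) : ℂ :=
  ∏ r ∈ T, ∏ k ∈ Finset.range (m r), -(q / (u r * z) * q ^ k)

/-- This trades the poles of `f` and `g` for a change of parameters: the pole factors make `f` and
`g` holomorphic, and the remaining weight has the parameters `u_r / q^{m_r}`. For `r ∈ T` one theta
factor is off by a factor `p` in its argument, which costs only a monomial. -/
lemma brokenWeight_eq_mul {q p : ℂ} (hp0 : p ≠ 0) (hp1 : ‖p‖ < 1) (hq0 : q ≠ 0) (hq1 : ‖q‖ < 1)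
    {T : Finset (Fin 6)} {u : Fin 6 → ℂ} (hu : ∀ r, u r ≠ 0) (m : Fin 6 → ℕ) {τ z : ℂ}
    (hz : z ∈ regularSet q p T fun r => u r / q ^ m r) :
    brokenWeight q p T u τ z = (∏ r, poleFactor q p (u r) (m r) z) * shiftMonomial q T u m z *
      brokenWeight q p T (fun r => u r / q ^ m r) τ z := by
  obtain ⟨hz0, h⟩ := hz
  have key : ∀ r, ellGamma (shift T p r * (u r * z)) p q * ellGamma (u r / z) p q =
      poleFactor q p (u r) (m r) z *
        (if r ∈ T then ∏ k ∈ Finset.range (m r), -(q / (u r * z) * q ^ k) else 1) *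
        (ellGamma (shift T p r * (u r / q ^ m r * z)) p q * ellGamma (u r / q ^ m r / z) p q) := by
    intro r
    have huz : u r * z ≠ 0 := mul_ne_zero (hu r) hz0
    have e1 : u r / q ^ m r / z = u r / z / q ^ m r := div_right_comm _ _ _
    have e2 : shift T p r * (u r / q ^ m r * z) = shift T p r * (u r * z) / q ^ m r := by ring
    have h1 := (h r).1
    have h2 := (h r).2
    rw [e1] at h2
    rw [e2] at h1
    have g1 := ellGamma_eq_thetaPoch_mul hp0 hp1 hq0 hq1
      (mul_ne_zero (shift_ne_zero hp0 r) huz) (m r) h1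
    have g2 := ellGamma_eq_thetaPoch_mul hp0 hp1 hq0 hq1 (div_ne_zero (hu r) hz0) (m r) h2
    rw [e1, e2, g1, g2, poleFactor]
    have e3 : p * q / (u r / z) = p * q * z / u r := by have := hu r; field_simp
    have e5 : p * q * z⁻¹ / u r = p * (q / (u r * z)) := by have := hu r; field_simp
    rw [e3, e5]
    by_cases hr : r ∈ T
    · have e4 : p * q / (shift T p r * (u r * z)) = q / (u r * z) := by
        simp only [shift, if_pos hr]; field_simp
      rw [e4, if_pos hr, thetaPoch_eq_mul hp0 hp1 hq0 (div_ne_zero hq0 huz)]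
      ring
    · have e4 : p * q / (shift T p r * (u r * z)) = p * (q / (u r * z)) := by
        simp only [shift, if_neg hr, one_mul]; ring
      rw [e4, if_neg hr]
      ring
  rw [brokenWeight, brokenWeight, Finset.prod_congr rfl fun r _ => key r, Finset.prod_mul_distrib,
    Finset.prod_mul_distrib, Finset.prod_ite_mem, Finset.univ_inter, shiftMonomial]
  ring

/-- Each theta factor turns `Γ(u_r z)` into `Γ(p u_r z)`. The reflection formula gives `1/Γ(z^{±2})
= θ(z²; p) θ(z⁻²; q)`, and its second factor is `-z⁻² θ(z²; q)`. -/
lemma ellWeight_mul_theta {q p : ℂ} (hp0 : p ≠ 0) (hp1 : ‖p‖ < 1) (hq0 : q ≠ 0) (hq1 : ‖q‖ < 1)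
    {T : Finset (Fin 6)} {u : Fin 6 → ℂ} {τ z : ℂ} (hz : z ≠ 0)
    (h1 : ∀ r, qPoch₂ (u r * z) p q ≠ 0) (h2 : qPoch₂ (p * q * z ^ 2) p q ≠ 0)
    (h3 : qPoch₂ (p * q / z ^ 2) p q ≠ 0) :
    ellWeight q p u z * (theta (τ / z) q * ∏ r ∈ T, theta (u r * z) q) =
      theta (z ^ 2) q * brokenWeight q p T u τ z := by
  have e1 : (∏ r, ellGamma (shift T p r * (u r * z)) p q * ellGamma (u r / z) p q) =
      (∏ r ∈ T, theta (u r * z) q) * ∏ r, ellGamma (u r * z) p q * ellGamma (u r / z) p q := by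
    have : ∀ r, ellGamma (shift T p r * (u r * z)) p q =
        (if r ∈ T then theta (u r * z) q else 1) * ellGamma (u r * z) p q := by
      intro r
      by_cases hr : r ∈ T
      · simp only [shift, if_pos hr]
        exact ellGamma_mul_p hp0 hp1 hq1 (h1 r)
      · simp only [shift, if_neg hr, one_mul]
    simp_rw [this, mul_assoc]
    rw [Finset.prod_mul_distrib, Finset.prod_ite_mem, Finset.univ_inter]
  have e2 := ellGamma_mul_ellGamma_inv hp1 hq1 h3 h2
  rw [theta_inv hq0 hq1 (pow_ne_zero 2 hz)] at e2
  rw [ellWeight, brokenWeight, e1, div_eq_mul_inv, inv_pow, e2]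
  ring

/-! ### Exceptional sets -/

/-- Integrals over cycles ignore countable sets, so it suffices to prove identities between
integrands for generic `z`, where no denominator vanishes. The cocountable filter combines such
genericity conditions. -/
lemma eventually_cocountable_iff {P : ℂ → Prop} :
    (∀ᶠ z in cocountable, P z) ↔ {z | ¬ P z}.Countable :=
  mem_cocountable

lemma eventually_cocountable_forall {κ : Type*} [Countable κ] {P : κ → ℂ → Prop}
    (h : ∀ k, ∀ᶠ z in cocountable, P k z) : ∀ᶠ z in cocountable, ∀ k, P k z := by
  simp only [eventually_cocountable_iff] at h ⊢
  refine (Set.countable_iUnion h).mono fun z hz => ?_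
  simpa using! hz

lemma eventually_cocountable_ne (x : ℂ) : ∀ᶠ z in cocountable, z ≠ x :=
  eventually_cocountable_iff.2 ((Set.countable_singleton x).mono fun z hz => by simpa using! hz)

lemma eventually_cocountable_comp {P : ℂ → Prop} (hP : ∀ᶠ z in cocountable, P z) {φ : ℂ → ℂ}
    (hφ : φ.Injective) : ∀ᶠ z in cocountable, P (φ z) :=
  eventually_cocountable_iff.2 ((eventually_cocountable_iff.1 hP).preimage hφ)

/-- Squaring is not injective, but its fibres have at most two elements. -/
lemma eventually_cocountable_sq {P : ℂ → Prop} (hP : ∀ᶠ z in cocountable, P z) :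
    ∀ᶠ z in cocountable, P (z ^ 2) := by
  have : {z | ¬ P (z ^ 2)} ⊆ ⋃ w ∈ {z | ¬ P z}, {z | z ^ 2 = w} := fun z hz =>
    Set.mem_iUnion₂.2 ⟨z ^ 2, hz, rfl⟩
  refine eventually_cocountable_iff.2 (Set.Countable.mono this
    (Set.Countable.biUnion (eventually_cocountable_iff.1 hP) fun w _ => ?_))
  rcases Set.eq_empty_or_nonempty {z : ℂ | z ^ 2 = w} with h | ⟨y, hy⟩
  · rw [h]; exact Set.countable_empty
  · refine ((Set.countable_singleton y).union (Set.countable_singleton (-y))).mono fun x hx => ?_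
    exact sq_eq_sq_iff_eq_or_eq_neg.1 ((hx : x ^ 2 = w).trans (hy : y ^ 2 = w).symm)

lemma eventually_cocountable_qPoch₂_ne_zero {p q : ℂ} (hp1 : ‖p‖ < 1) (hq1 : ‖q‖ < 1) :
    ∀ᶠ z in cocountable, qPoch₂ z p q ≠ 0 := by
  refine eventually_cocountable_iff.2
    ((Set.countable_range fun k : ℕ × ℕ => (p ^ k.1 * q ^ k.2)⁻¹).mono fun z hz => ?_)
  by_contra hn
  refine hz (qPoch₂_ne_zero hp1 hq1 fun i j h => hn ⟨(i, j), ?_⟩)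
  rw [mul_assoc] at h
  exact (eq_inv_of_mul_eq_one_left h).symm

lemma eventually_cocountable_theta_ne_zero {p : ℂ} (hp0 : p ≠ 0) (hp1 : ‖p‖ < 1) :
    ∀ᶠ z in cocountable, theta z p ≠ 0 := by
  refine eventually_cocountable_iff.2
    ((Set.countable_range fun n : ℤ => p ^ n).mono fun z hz => ?_)
  by_contra hn
  exact hz (theta_ne_zero hp0 hp1 fun n h => hn ⟨n, h.symm⟩)

lemma eventually_cocountable_poleFactor_ne_zero {p q u : ℂ} (hp0 : p ≠ 0) (hp1 : ‖p‖ < 1)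
    (hq0 : q ≠ 0) (hu : u ≠ 0) (m : ℕ) : ∀ᶠ z in cocountable, poleFactor q p u m z ≠ 0 := by
  have h1 : ∀ k : ℕ, ∀ᶠ z in cocountable, theta (p * q * z / u * q ^ k) p ≠ 0 := fun k => by
    refine eventually_cocountable_comp (eventually_cocountable_theta_ne_zero hp0 hp1)
      (φ := fun z => p * q * z / u * q ^ k) fun x y h => ?_
    have := pow_ne_zero k hq0
    field_simp at h
    exact h
  have h2 : ∀ k : ℕ, ∀ᶠ z in cocountable, theta (p * q * z⁻¹ / u * q ^ k) p ≠ 0 := fun k => by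
    exact eventually_cocountable_comp (h1 k) inv_injective
  filter_upwards [eventually_cocountable_forall h1, eventually_cocountable_forall h2] with z a b
  exact mul_ne_zero (thetaPoch_ne_zero_left a) (thetaPoch_ne_zero_left b)

lemma eventually_cocountable_mem_regularSet {p q : ℂ} (hp0 : p ≠ 0) (hp1 : ‖p‖ < 1) (hq1 : ‖q‖ < 1)
    (T : Finset (Fin 6)) {v : Fin 6 → ℂ} (hv : ∀ r, v r ≠ 0) :
    ∀ᶠ z in cocountable, z ∈ regularSet q p T v := by
  have h1 : ∀ r, ∀ᶠ z in cocountable, qPoch₂ (shift T p r * (v r * z)) p q ≠ 0 := fun r =>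
    eventually_cocountable_comp (eventually_cocountable_qPoch₂_ne_zero hp1 hq1)
      (φ := fun z => shift T p r * (v r * z)) fun x y h =>
        mul_left_cancel₀ (hv r) (mul_left_cancel₀ (shift_ne_zero hp0 r) h)
  have h2 : ∀ r, ∀ᶠ z in cocountable, qPoch₂ (v r / z) p q ≠ 0 := fun r =>
    eventually_cocountable_comp (eventually_cocountable_qPoch₂_ne_zero hp1 hq1)
      (φ := fun z => v r / z) fun x y h => by
        simp only [div_eq_mul_inv] at h
        exact inv_injective (mul_left_cancel₀ (hv r) h)
  filter_upwards [eventually_cocountable_ne 0, eventually_cocountable_forall h1,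
    eventually_cocountable_forall h2] with z h0 a b
  exact ⟨h0, fun r => ⟨a r, b r⟩⟩

/-! ### Splitting the integrand into a function and its image under `z ↦ 1/z` -/

lemma poleFactor_inv (q p u : ℂ) (m : ℕ) (z : ℂ) :
    poleFactor q p u m z⁻¹ = poleFactor q p u m z := by
  simp [poleFactor, mul_comm]

lemma ellWeight_inv (q p : ℂ) (u : Fin 6 → ℂ) (z : ℂ) :
    ellWeight q p u z⁻¹ = ellWeight q p u z := by
  simp only [ellWeight, inv_inv, div_inv_eq_mul, ← div_eq_mul_inv]
  congr 1
  · exact Finset.prod_congr rfl fun r _ => mul_comm _ _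
  · exact mul_comm _ _

/-- The order of the poles of `f` and `g`. -/
def poleOrder (mf mg : ℕ) : Fin 6 → ℕ := ![0, 0, 0, 0, mf, mg]

lemma prod_poleFactor (q p : ℂ) (u : Fin 6 → ℂ) (mf mg : ℕ) (z : ℂ) :
    ∏ r, poleFactor q p (u r) (poleOrder mf mg r) z =
      poleFactor q p (u 4) mf z * poleFactor q p (u 5) mg z := by
  simp [Fin.prod_univ_six, poleOrder, poleFactor, thetaPoch]

/-- The integrand of the elliptic bilinear form, up to a constant, is the sum over `z ↦ 1 / z` of a
function that is holomorphic on the regular set. -/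
theorem exists_broken_integrand {q p : ℂ} (hp0 : p ≠ 0) (hp1 : ‖p‖ < 1) (hq0 : q ≠ 0) (hq1 : ‖q‖ < 1)
    {u : Fin 6 → ℂ} (hu : ∀ r, u r ≠ 0) {mf mg : ℕ} {f g : ℂ → ℂ} (hf : InA q p (u 4) mf f)
    (hg : InA q p (u 5) mg g) {a b c : Fin 6} (hab : a ≠ b) (hac : a ≠ c) (hbc : b ≠ c) :
    ∃ W : ℂ → ℂ,
      DifferentiableOn ℂ W (regularSet q p {a, b, c} fun r => u r / q ^ poleOrder mf mg r) ∧
      (∀ z ∈ regularSet q p {a, b, c} fun r => u r / q ^ poleOrder mf mg r,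
        poleFactor q p (u 4) mf z ≠ 0 → poleFactor q p (u 5) mg z ≠ 0 →
        W z = f z * g z * brokenWeight q p {a, b, c} u (u a * u b * u c) z *
          (2 * Real.pi * Complex.I * z)⁻¹) ∧
      ∀ᶠ z in cocountable, theta (u a * u b) q * theta (u a * u c) q * theta (u b * u c) q *
        (f z * g z * ellWeight q p u z * (2 * Real.pi * Complex.I * z)⁻¹) =
          W z + (z ^ 2)⁻¹ * W z⁻¹ := by
  obtain ⟨⟨Hf, hHf, hHf'⟩, hfs, -⟩ := hf
  obtain ⟨⟨Hg, hHg, hHg'⟩, hgs, -⟩ := hg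
  set T : Finset (Fin 6) := {a, b, c} with hT
  set m := poleOrder mf mg with hm
  set v : Fin 6 → ℂ := fun r => u r / q ^ m r with hv
  set τ := u a * u b * u c with hτ
  have hτ0 : τ ≠ 0 := mul_ne_zero (mul_ne_zero (hu a) (hu b)) (hu c)
  have hv0 : ∀ r, v r ≠ 0 := fun r => div_ne_zero (hu r) (pow_ne_zero _ hq0)
  -- Built from the holomorphic functions `Hf` and `Hg` instead of `f` and `g`, whose values at
  -- zeros of the pole factors carry no information.
  set W : ℂ → ℂ := fun z => Hf z * Hg z * shiftMonomial q T u m z * brokenWeight q p T v τ z *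
    (2 * Real.pi * Complex.I * z)⁻¹ with hW
  have hprodT : ∀ F : Fin 6 → ℂ, ∏ r ∈ T, F r = F a * F b * F c := fun F => by
    rw [hT, Finset.prod_insert (by simp [hab, hac]), Finset.prod_insert (by simp [hbc]),
      Finset.prod_singleton, mul_assoc]
  have hWE : ∀ z ∈ regularSet q p T v, poleFactor q p (u 4) mf z ≠ 0 →
      poleFactor q p (u 5) mg z ≠ 0 →
      W z = f z * g z * brokenWeight q p T u τ z * (2 * Real.pi * Complex.I * z)⁻¹ := by
    intro z hz h4 h5
    rw [brokenWeight_eq_mul hp0 hp1 hq0 hq1 hu m hz, prod_poleFactor]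
    simp only [hW]
    rw [← hHf' z hz.1 h4, ← hHg' z hz.1 h5]
    ring
  refine ⟨W, ?_, hWE, ?_⟩
  · intro z hz
    have hz0 : z ≠ 0 := hz.1
    refine DifferentiableAt.differentiableWithinAt ?_
    have hd : ∀ F : ℂ → ℂ, DifferentiableOn ℂ F {0}ᶜ → DifferentiableAt ℂ F z := fun F hF =>
      hF.differentiableAt (isOpen_compl_singleton.mem_nhds hz0)
    have h1 : DifferentiableAt ℂ (shiftMonomial q T u m) z := by
      refine DifferentiableAt.fun_finsetProd fun r _ => DifferentiableAt.fun_finsetProd fun k _ => ?_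
      have := mul_ne_zero (hu r) hz0
      fun_prop (disch := assumption)
    have h2 : DifferentiableAt ℂ (fun z : ℂ => (2 * Real.pi * Complex.I * z)⁻¹) z :=
      (by fun_prop : DifferentiableAt ℂ (fun z : ℂ => 2 * Real.pi * Complex.I * z) z).fun_inv
        (mul_ne_zero Complex.two_pi_I_ne_zero hz0)
    exact (((hd _ hHf).mul (hd _ hHg)).mul h1).mul
      (differentiableAt_brokenWeight hp0 hp1 hq1 hv0 hτ0 hz) |>.mul h2
  · have hA := eventually_cocountable_qPoch₂_ne_zero hp1 hq1
    have hreg := eventually_cocountable_mem_regularSet hp0 hp1 hq1 T hv0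
    have hreg' := eventually_cocountable_comp hreg inv_injective
    have h1 : ∀ r, ∀ᶠ z in cocountable, qPoch₂ (u r * z) p q ≠ 0 := fun r =>
      eventually_cocountable_comp hA (mul_right_injective₀ (hu r))
    have h1' : ∀ r, ∀ᶠ z in cocountable, qPoch₂ (u r * z⁻¹) p q ≠ 0 := fun r =>
      eventually_cocountable_comp (h1 r) inv_injective
    have h2 : ∀ᶠ z in cocountable, qPoch₂ (p * q * z ^ 2) p q ≠ 0 :=
      eventually_cocountable_sq (eventually_cocountable_comp hA
        (mul_right_injective₀ (mul_ne_zero hp0 hq0)))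
    have h2' : ∀ᶠ z in cocountable, qPoch₂ (p * q * z⁻¹ ^ 2) p q ≠ 0 :=
      eventually_cocountable_comp h2 inv_injective
    filter_upwards [hreg, hreg', eventually_cocountable_forall h1,
      eventually_cocountable_forall h1', h2, h2',
      eventually_cocountable_poleFactor_ne_zero hp0 hp1 hq0 (hu 4) mf,
      eventually_cocountable_poleFactor_ne_zero hp0 hp1 hq0 (hu 5) mg,
      eventually_cocountable_sq (eventually_cocountable_theta_ne_zero hq0 hq1)]
      with z k1 k2 k3 k4 k5 k6 k7 k8 k9
    have hz0 : z ≠ 0 := k1.1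
    rw [hWE z k1 k7 k8, hWE z⁻¹ k2 (by rwa [poleFactor_inv]) (by rwa [poleFactor_inv]),
      hfs z hz0 k7, hgs z hz0 k8]
    have k5' : qPoch₂ (p * q / z⁻¹ ^ 2) p q ≠ 0 := by simpa using k5
    have k6' : qPoch₂ (p * q / z ^ 2) p q ≠ 0 := by simpa [div_eq_mul_inv] using k6
    have s1 := ellWeight_mul_theta hp0 hp1 hq0 hq1 (T := T) (τ := τ) hz0 k3 k5 k6'
    have s2 := ellWeight_mul_theta hp0 hp1 hq0 hq1 (T := T) (τ := τ) k2.1 k4 k6 k5'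
    rw [ellWeight_inv, inv_pow, theta_inv hq0 hq1 (pow_ne_zero 2 hz0)] at s2
    have hadd := theta_addition hq0 hq1 (hu a) (hu b) (hu c) hz0
    rw [hprodT] at s1 s2
    simp only [div_inv_eq_mul, ← div_eq_mul_inv] at s2
    rw [← hτ] at hadd
    -- The addition formula multiplied by the weight: its two terms are the broken weights at `z`
    -- and `1/z`, and the common factor `θ(z²; q)` is cancelled.
    have s3 : ellWeight q p u z * (theta (u a * u b) q * theta (u a * u c) q *
        theta (u b * u c) q) =
        brokenWeight q p T u τ z + brokenWeight q p T u τ z⁻¹ := by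
      refine mul_left_cancel₀ k9 ?_
      calc _ = ellWeight q p u z * (theta (z ^ 2) q *
            (theta (u a * u b) q * theta (u a * u c) q * theta (u b * u c) q)) := by ring
        _ = ellWeight q p u z * (theta (τ / z) q * (theta (u a * z) q * theta (u b * z) q *
              theta (u c * z) q)) - z ^ 2 * (ellWeight q p u z * (theta (τ * z) q *
              (theta (u a / z) q * theta (u b / z) q * theta (u c / z) q))) := by
            rw [← hadd]; ring
        _ = _ := by
            rw [s1, s2]
            field_simp
            ring
    calc _ = f z * g z * (2 * Real.pi * Complex.I * z)⁻¹ * (ellWeight q p u z *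
          (theta (u a * u b) q * theta (u a * u c) q * theta (u b * u c) q)) := by ring
      _ = _ := by
          rw [s3]
          have := Complex.two_pi_I_ne_zero
          field_simp

/-! ### The contours of the bilinear forms -/

lemma finite_iUnion_image_of_tendsto {ρ κ : Type*} [Finite ρ] {a : ρ → κ → ℂ}
    (ha : ∀ r, Tendsto (a r) cofinite (𝓝 0)) {ε : ℝ} (hε : 0 < ε) :
    (⋃ r, a r '' {k | ε ≤ ‖a r k‖}).Finite := by
  refine Set.finite_iUnion fun r => Set.Finite.image _ ?_
  have := (ha r).norm.eventually_lt_const (u := ε) (by simpa using hε)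
  simpa [eventually_cofinite] using this

lemma ContourCycle.exists_contains_excludes_of_tendsto {ρ ρ' κ κ' : Type*} [Finite ρ] [Finite ρ']
    {a : ρ → κ → ℂ} {b : ρ' → κ' → ℂ} (ha : ∀ r, Tendsto (a r) cofinite (𝓝 0))
    (hb : ∀ r, Tendsto (b r) cofinite (𝓝 0)) (hb0 : ∀ r k, b r k ≠ 0)
    (hab : ∀ r r' k k', a r k * b r' k' ≠ 1) :
    ∃ C : ContourCycle, C.Contains 0 ∧ (∀ r k, C.Contains (a r k)) ∧
      ∀ r k, C.Excludes (b r k)⁻¹ := by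
  have hdisj : ∀ z ∈ insert 0 (⋃ r, Set.range (a r)), z ∉ ⋃ r, Set.range fun k => (b r k)⁻¹ := by
    intro z hz hz'
    obtain ⟨r', k', rfl⟩ := Set.mem_iUnion.1 hz'
    rcases hz with hz | hz
    · exact inv_ne_zero (hb0 r' k') hz
    · obtain ⟨r, k, hk⟩ := Set.mem_iUnion.1 hz
      refine hab r r' k k' ?_
      rw [hk]
      exact inv_mul_cancel₀ (hb0 r' k')
  have hin : ∀ ε > 0, {z ∈ insert 0 (⋃ r, Set.range (a r)) | ε ≤ ‖z‖}.Finite := by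
    intro ε hε
    refine (finite_iUnion_image_of_tendsto ha hε).subset ?_
    rintro z ⟨hz | hz, hz'⟩
    · rw [hz, norm_zero] at hz'
      linarith
    · obtain ⟨r, k, rfl⟩ := Set.mem_iUnion.1 hz
      exact Set.mem_iUnion.2 ⟨r, k, hz', rfl⟩
  have hout : ∀ M : ℝ, {z ∈ ⋃ r, Set.range fun k => (b r k)⁻¹ | ‖z‖ ≤ M}.Finite := by
    intro M
    refine ((finite_iUnion_image_of_tendsto hb (ε := (|M| + 1)⁻¹) (by positivity)).image (fun z => z⁻¹)).subset ?_
    rintro z ⟨hz, hz'⟩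
    obtain ⟨r, k, rfl⟩ := Set.mem_iUnion.1 hz
    refine ⟨b r k, Set.mem_iUnion.2 ⟨r, k, ?_, rfl⟩, rfl⟩
    change (|M| + 1)⁻¹ ≤ ‖b r k‖
    rw [norm_inv] at hz'
    exact inv_le_of_inv_le₀ (norm_pos_iff.2 (hb0 r k))
      (hz'.trans ((le_abs_self M).trans (le_add_of_nonneg_right zero_le_one)))
  obtain ⟨C, h1, h2⟩ := ContourCycle.exists_contains_excludes (Set.mem_insert _ _) hdisj hin hout
  refine ⟨C, h1 0 (Set.mem_insert _ _), fun r k => h1 _ (Or.inr ?_), fun r k => h2 _ ?_⟩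
  · exact Set.mem_iUnion.2 ⟨r, k, rfl⟩
  · exact Set.mem_iUnion.2 ⟨r, k, rfl⟩

lemma tendsto_pow_mul_pow_cofinite {p q : ℂ} (hp1 : ‖p‖ < 1) (hq1 : ‖q‖ < 1) (x : ℂ) :
    Tendsto (fun k : ℕ × ℕ => p ^ k.1 * q ^ k.2 * x) cofinite (𝓝 0) := by
  refine Summable.tendsto_cofinite_zero (Summable.of_norm ?_)
  refine (summable_pow_mul_pow (norm_nonneg p) hp1 (norm_nonneg q) hq1 ‖x‖).congr fun k => ?_
  rw [norm_mul, norm_mul, norm_pow, norm_pow]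
  ring

/-- The contour of the elliptic bilinear form exists. -/
lemma exists_isEllipticContour {q p : ℂ} (hp0 : p ≠ 0) (hp1 : ‖p‖ < 1) (hq0 : q ≠ 0) (hq1 : ‖q‖ < 1)
    {v : Fin 6 → ℂ} (hv : ∀ r, v r ≠ 0) (h : Nondegenerate q p v) :
    ∃ C, IsEllipticContour q p v C := by
  obtain ⟨C, h0, h1, h2⟩ := ContourCycle.exists_contains_excludes_of_tendsto
    (a := fun r (k : ℕ × ℕ) => p ^ k.1 * q ^ k.2 * v r)
    (b := fun r (k : ℕ × ℕ) => p ^ k.1 * q ^ k.2 * v r)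
    (fun r => tendsto_pow_mul_pow_cofinite hp1 hq1 (v r))
    (fun r => tendsto_pow_mul_pow_cofinite hp1 hq1 (v r))
    (fun r k => mul_ne_zero (mul_ne_zero (pow_ne_zero _ hp0) (pow_ne_zero _ hq0)) (hv r))
    (fun r r' k k' hk => h r r' (k.1 + k'.1) (k.2 + k'.2) (by
      rw [← hk, pow_add, pow_add]; ring))
  exact ⟨C, h0, fun r i j => ⟨h1 r (i, j), h2 r (i, j)⟩⟩

/-- The condition `1 ≤ i` for `r ∈ T` is what the broken symmetry gains: the extra factor `p` in
`Γ(p v_r z)` removes the row `i = 0` of reciprocal poles. -/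
lemma notMem_regularSet {q p : ℂ} (hp1 : ‖p‖ < 1) (hq1 : ‖q‖ < 1)
    {T : Finset (Fin 6)} {v : Fin 6 → ℂ} {z : ℂ}
    (hz : z ∉ regularSet q p T v) :
    z = 0 ∨ (∃ (r : Fin 6) (i j : ℕ), z = p ^ i * q ^ j * v r) ∨
      ∃ (r : Fin 6) (i j : ℕ), (r ∈ T → 1 ≤ i) ∧ z = (p ^ i * q ^ j * v r)⁻¹ := by
  by_contra! hcon
  obtain ⟨hz0, h1, h2⟩ := hcon
  refine hz ⟨hz0, fun r => ⟨qPoch₂_ne_zero hp1 hq1 fun i j h => ?_,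
    qPoch₂_ne_zero hp1 hq1 fun i j h => ?_⟩⟩
  · by_cases hr : r ∈ T
    · refine h2 r (i + 1) j (fun _ => Nat.le_add_left _ _) (eq_inv_of_mul_eq_one_left ?_)
      rw [← h, shift, if_pos hr, pow_succ]
      ring
    · refine h2 r i j (fun h => absurd h hr) (eq_inv_of_mul_eq_one_left ?_)
      rw [← h, shift, if_neg hr]
      ring
  · refine h1 r i j ?_
    field_simp at h
    linear_combination -h

/-- In the integral over the contour of the elliptic bilinear form, the symmetry can be broken, and
then other contours may be used. -/
theorem IsEllipticContour.integral_eq {q p : ℂ} (hp0 : p ≠ 0) (hp1 : ‖p‖ < 1) (hq0 : q ≠ 0)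
    (hq1 : ‖q‖ < 1) {T : Finset (Fin 6)} {v : Fin 6 → ℂ} (hv : ∀ r, v r ≠ 0) {C D : ContourCycle}
    (hC : IsEllipticContour q p v C) (hD0 : D.Contains 0)
    (hDin : ∀ (r : Fin 6) (i j : ℕ), D.Contains (p ^ i * q ^ j * v r))
    (hDout : ∀ (r : Fin 6) (i j : ℕ), (r ∈ T → 1 ≤ i) → D.Excludes (p ^ i * q ^ j * v r)⁻¹)
    {W J : ℂ → ℂ} (hW : DifferentiableOn ℂ W (regularSet q p T v))
    (hJ : ∀ᶠ z in cocountable, J z = W z + (z ^ 2)⁻¹ * W z⁻¹) :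
    C.integral J = 2 * D.integral W := by
  have hopen := isOpen_regularSet hp1 hq1 T v
  have h0 : (0 : ℂ) ∉ regularSet q p T v := fun h => h.1 rfl
  have hx0 : ∀ (r : Fin 6) (i j : ℕ), p ^ i * q ^ j * v r ≠ 0 := fun r i j =>
    mul_ne_zero (mul_ne_zero (pow_ne_zero _ hp0) (pow_ne_zero _ hq0)) (hv r)
  have hC0 : (0 : ℂ) ∉ C.trace := hC.1.1
  have hCreg : C.trace ⊆ regularSet q p T v := fun z hz => by
    by_contra hn
    rcases notMem_regularSet hp1 hq1 hn with rfl | ⟨r, i, j, rfl⟩ | ⟨r, i, j, -, rfl⟩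
    · exact hC0 hz
    · exact (hC.2 r i j).1.1 hz
    · exact (hC.2 r i j).2.1 hz
  have hCinv : ∀ z ∈ C.trace, z⁻¹ ∈ regularSet q p T v := fun z hz => by
    by_contra hn
    rcases notMem_regularSet hp1 hq1 hn with h | ⟨r, i, j, h⟩ | ⟨r, i, j, -, h⟩
    · exact hC0 (by rwa [inv_eq_zero.1 h] at hz)
    · refine (hC.2 r i j).2.1 ?_
      rwa [← h, inv_inv]
    · refine (hC.2 r i j).1.1 ?_
      rwa [← inv_inj.1 h]
  have hDreg : D.trace ⊆ regularSet q p T v := fun z hz => by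
    by_contra hn
    rcases notMem_regularSet hp1 hq1 hn with rfl | ⟨r, i, j, rfl⟩ | ⟨r, i, j, hi, rfl⟩
    · exact hD0.1 hz
    · exact (hDin r i j).1 hz
    · exact (hDout r i j hi).1 hz
  have hinvc : ContinuousOn (fun z : ℂ => z⁻¹) C.trace :=
    continuousOn_id.inv₀ fun z hz h => hC0 (h ▸ hz)
  have hWinv : ContinuousOn (fun z => W z⁻¹) C.trace :=
    hW.continuousOn.comp hinvc fun z hz => hCinv z hz
  have h2 : ContinuousOn (fun z => (z ^ 2)⁻¹ * W z⁻¹) C.trace :=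
    ((continuousOn_id.pow 2).inv₀ fun z hz => pow_ne_zero 2 fun h => hC0 (h ▸ hz)).mul hWinv
  -- The summand `z⁻² W(1/z)` is the pullback of `W` under inversion, with the sign absorbed by the
  -- reversed orientation.
  have e1 : C.integral J = C.integral W + (C.inv hC0).integral W := by
    rw [ContourCycle.inv_integral hC0 hWinv,
      ← ContourCycle.integral_add (hW.continuousOn.mono hCreg) h2]
    refine ContourCycle.integral_congr_of_countable (eventually_cocountable_iff.1 hJ) ?_
    exact fun z _ hz => not_not.1 hz
  have e2 : C.integral W = D.integral W := by
    refine ContourCycle.integral_eq_of_winding_eq hopen hW hCreg hDreg (fun w hw => ?_) h0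
    rcases notMem_regularSet hp1 hq1 hw with rfl | ⟨r, i, j, rfl⟩ | ⟨r, i, j, hi, rfl⟩
    · rw [hC.1.2, hD0.2]
    · rw [(hC.2 r i j).1.2, (hDin r i j).2]
    · rw [(hC.2 r i j).2.2, (hDout r i j hi).2]
  -- The inverted cycle has winding number `1 - 0` about the points to be contained and `1 - 1`
  -- about those to be excluded, so it separates the poles in the same way as `C`.
  have e3 : (C.inv hC0).integral W = D.integral W := by
    refine ContourCycle.integral_eq_of_winding_eq hopen hW
      (fun z hz => by simpa using hCinv _ (ContourCycle.inv_trace_subset hC0 hz)) hDreg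
      (fun w hw => ?_) h0
    rcases notMem_regularSet hp1 hq1 hw with rfl | ⟨r, i, j, rfl⟩ | ⟨r, i, j, hi, rfl⟩
    · rw [ContourCycle.inv_winding_zero, hC.1.2, hD0.2]
    · rw [ContourCycle.inv_winding hC0 (hx0 r i j) (hC.2 r i j).2.1, (hC.2 r i j).2.2, hC.1.2,
        (hDin r i j).2, sub_zero]
    · rw [ContourCycle.inv_winding hC0 (inv_ne_zero (hx0 r i j))
        (by rw [inv_inv]; exact (hC.2 r i j).1.1), inv_inv, (hC.2 r i j).1.2, hC.1.2,
        (hDout r i j hi).2, sub_self]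
  rw [e1, e2, e3, two_mul]

/-! ### Real powers of `p` -/

lemma ppow_add (s : ℂ) (x y : ℝ) : ppow s (x + y) = ppow s x * ppow s y := by
  rw [ppow, ppow, ppow, ← Complex.exp_add]; congr 1; push_cast; ring

lemma ppow_zero (s : ℂ) : ppow s 0 = 1 := by simp [ppow]

lemma ppow_one (s : ℂ) : ppow s 1 = Complex.exp s := by simp [ppow]

lemma ppow_ne_zero (s : ℂ) (x : ℝ) : ppow s x ≠ 0 := Complex.exp_ne_zero _

lemma ppow_neg (s : ℂ) (x : ℝ) : ppow s (-x) = (ppow s x)⁻¹ := by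
  rw [ppow, ppow, ← Complex.exp_neg]; congr 1; push_cast; ring

lemma ppow_sub (s : ℂ) (x y : ℝ) : ppow s (x - y) = ppow s x / ppow s y := by
  rw [sub_eq_add_neg, ppow_add, ppow_neg, div_eq_mul_inv]

lemma ppow_intCast (s : ℂ) (n : ℤ) : ppow s n = Complex.exp s ^ n := by
  rw [ppow, ← Complex.exp_int_mul]; norm_cast

lemma ppow_natCast (s : ℂ) (n : ℕ) : ppow s n = Complex.exp s ^ n := by
  rw [ppow, ← Complex.exp_nat_mul]; norm_cast

lemma norm_ppow (s : ℂ) (x : ℝ) : ‖ppow s x‖ = Real.exp (x * s.re) := by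
  rw [ppow, Complex.norm_exp]; simp

instance : pToZero.IsCountablyGenerated :=
  inferInstanceAs (comap Complex.re atBot).IsCountablyGenerated

lemma tendsto_re_pToZero : Tendsto Complex.re pToZero atBot := tendsto_comap

lemma tendsto_ppow {γ : ℝ} (hγ : 0 < γ) : Tendsto (fun s => ppow s γ) pToZero (𝓝 0) := by
  rw [tendsto_zero_iff_norm_tendsto_zero]
  simp only [norm_ppow]
  exact Real.tendsto_exp_atBot.comp (tendsto_re_pToZero.const_mul_atBot hγ)

lemma tendsto_exp_pToZero : Tendsto Complex.exp pToZero (𝓝 0) := by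
  simpa [ppow_one] using tendsto_ppow one_pos

lemma eventually_re_neg : ∀ᶠ s in pToZero, s.re < 0 :=
  tendsto_re_pToZero.eventually (eventually_lt_atBot 0)

lemma norm_exp_lt_one {s : ℂ} (hs : s.re < 0) : ‖Complex.exp s‖ < 1 := by
  rw [Complex.norm_exp]; simpa using hs

/-- All but countably many `p` are nondegenerate. -/
lemma countable_degenerate {q : ℂ} {v : Fin 6 → ℂ} (α : Fin 6 → ℝ)
    (hv : ∀ r r' (j : ℕ), q ^ j * (v r * v r') ≠ 1) :
    {s : ℂ | ¬ Nondegenerate q (Complex.exp s) fun r => v r * ppow s (α r)}.Countable := by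
  have hsub : {s : ℂ | ¬ Nondegenerate q (Complex.exp s) fun r => v r * ppow s (α r)} ⊆
      ⋃ k : (Fin 6 × Fin 6) × ℕ × ℕ, {s | Complex.exp (((k.2.1 + α k.1.1 + α k.1.2 : ℝ) : ℂ) * s) *
        (q ^ k.2.2 * (v k.1.1 * v k.1.2)) = 1} := by
    intro s hs
    simp only [Nondegenerate, Set.mem_ofPred_eq, not_forall, not_not] at hs
    obtain ⟨r, r', i, j, h⟩ := hs
    refine Set.mem_iUnion.2 ⟨((r, r'), i, j), ?_⟩
    rw [Set.mem_ofPred_eq, ← h]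
    change ppow s (i + α r + α r') * _ = _
    rw [ppow_add, ppow_add, ppow_natCast]
    ring
  refine (Set.countable_iUnion fun k => ?_).mono hsub
  -- If the exponent of `p` is zero, the equation does not involve `s` and is ruled out by `hv`.
  -- Otherwise any two solutions differ by an integer multiple of `2πi` over the exponent.
  by_cases he : (k.2.1 + α k.1.1 + α k.1.2 : ℝ) = 0
  · convert Set.countable_empty
    refine Set.eq_empty_of_forall_notMem fun s hs => hv k.1.1 k.1.2 k.2.2 ?_
    rw [Set.mem_ofPred_eq, he] at hs
    simpa using hs
  · rcases Set.eq_empty_or_nonempty {s | Complex.exp (((k.2.1 + α k.1.1 + α k.1.2 : ℝ) : ℂ) * s) *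
        (q ^ k.2.2 * (v k.1.1 * v k.1.2)) = 1} with h | ⟨s₀, hs₀⟩
    · rw [h]; exact Set.countable_empty
    · set e : ℂ := ((k.2.1 + α k.1.1 + α k.1.2 : ℝ) : ℂ) with hedef
      have he' : e ≠ 0 := by rw [hedef]; exact_mod_cast he
      refine (Set.countable_range fun n : ℤ => s₀ + n * (2 * Real.pi * Complex.I) / e).mono ?_
      intro s hs
      have hne : q ^ k.2.2 * (v k.1.1 * v k.1.2) ≠ 0 := by
        intro h0
        rw [Set.mem_ofPred_eq, h0, mul_zero] at hs
        exact zero_ne_one hs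
      have := mul_right_cancel₀ hne ((hs : _ = (1 : ℂ)).trans (hs₀ : _ = (1 : ℂ)).symm)
      obtain ⟨n, hn⟩ := Complex.exp_eq_exp_iff_exists_int.1 this
      refine ⟨n, ?_⟩
      simp only
      field_simp
      linear_combination -hn

/-! ### Asymptotics as `p → 0` -/

section Asymptotics

variable {ι : Type*} {l : Filter ι} {σ : ι → ℂ} {x : ι → ℂ} {x₀ q : ℂ} {γ : ℝ}

lemma tendsto_qPoch₂_ppow (hσ : Tendsto σ l pToZero) (hx : Tendsto x l (𝓝 x₀)) (hq1 : ‖q‖ < 1)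
    (hγ : 0 ≤ γ) :
    Tendsto (fun i => qPoch₂ (ppow (σ i) γ * x i) (Complex.exp (σ i)) q) l
      (𝓝 (if γ = 0 then qPoch x₀ q else 1)) := by
  have hp : Tendsto (fun i => Complex.exp (σ i)) l (𝓝 0) := tendsto_exp_pToZero.comp hσ
  have h0 : ‖(0 : ℂ)‖ < 1 := by simp
  split_ifs with h
  · subst h
    simp only [ppow_zero, one_mul]
    rw [qPoch_eq_qPoch₂]
    exact tendsto_qPoch₂ hx hp tendsto_const_nhds h0 hq1
  · have := (tendsto_ppow (lt_of_le_of_ne hγ (Ne.symm h))).comp hσ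
    have h2 := tendsto_qPoch₂ (this.mul hx) hp (tendsto_const_nhds (x := q)) h0 hq1
    rwa [zero_mul, qPoch₂_zero] at h2

/-- The limit of `Γ(p^γ x)` for `0 ≤ γ ≤ 1`. -/
def gammaLimit (q : ℂ) (γ : ℝ) (x : ℂ) : ℂ :=
  (if γ = 1 then qPoch (q / x) q else 1) / (if γ = 0 then qPoch x q else 1)

/-- Numerator and denominator are double products at `p^{1-γ} q/x` and `p^γ x`. Both exponents are
nonnegative, and a product tends to `1` unless its exponent is zero. -/
lemma tendsto_ellGamma_ppow (hσ : Tendsto σ l pToZero) (hx : Tendsto x l (𝓝 x₀)) (hq1 : ‖q‖ < 1)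
    (hγ : 0 ≤ γ) (hγ1 : γ ≤ 1) (hx₀ : x₀ ≠ 0) (hne : γ = 0 → qPoch x₀ q ≠ 0) :
    Tendsto (fun i => ellGamma (ppow (σ i) γ * x i) (Complex.exp (σ i)) q) l
      (𝓝 (gammaLimit q γ x₀)) := by
  have e : ∀ i, ellGamma (ppow (σ i) γ * x i) (Complex.exp (σ i)) q =
      qPoch₂ (ppow (σ i) (1 - γ) * (q / x i)) (Complex.exp (σ i)) q /
        qPoch₂ (ppow (σ i) γ * x i) (Complex.exp (σ i)) q := by
    intro i
    rw [ellGamma, ppow_sub, ppow_one, mul_div_mul_comm]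
  simp only [e]
  have h1 := tendsto_qPoch₂_ppow hσ (tendsto_const_nhds.div hx hx₀ : Tendsto (fun i => q / x i) l _)
    hq1 (sub_nonneg.2 hγ1)
  have h2 := tendsto_qPoch₂_ppow hσ hx hq1 hγ
  have := h1.div h2 (by split_ifs with h; exacts [hne h, one_ne_zero])
  simp only [sub_eq_zero, eq_comm (a := (1 : ℝ))] at this
  exact this

lemma eventually_ppow_mul_ne_zpow (hσ : Tendsto σ l pToZero) (hx : Tendsto x l (𝓝 x₀))
    (hx₀ : x₀ ≠ 0) (hx₁ : x₀ ≠ 1) (γ : ℝ) :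
    ∀ᶠ i in l, ∀ n : ℤ, ppow (σ i) γ * x i ≠ Complex.exp (σ i) ^ n := by
  -- The distance from `γ` to the nearest integer different from `γ`, or a lower bound for it. For
  -- small `p` one has `|p|^d < |x| < |p|^{-d}`, which excludes `x = p^{n-γ}` for `n ≠ γ`; for `n =
  -- γ` one uses `x₀ ≠ 1`.
  obtain ⟨d, hd, hdn⟩ : ∃ d > 0, ∀ n : ℤ, (n : ℝ) ≠ γ → d ≤ |n - γ| := by
    by_cases h : (round γ : ℝ) = γ
    · refine ⟨1, one_pos, fun n hn => ?_⟩
      rw [← h] at hn ⊢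
      exact_mod_cast Int.one_le_abs (sub_ne_zero.2 fun h' => hn (by rw [h']))
    · refine ⟨|γ - round γ|, abs_pos.2 (sub_ne_zero.2 (Ne.symm h)), fun n _ => ?_⟩
      rw [abs_sub_comm (n : ℝ)]
      exact round_le γ n
  have hre := tendsto_re_pToZero.comp hσ
  have hE : Tendsto (fun i => Real.exp (d * (σ i).re)) l (𝓝 0) :=
    Real.tendsto_exp_atBot.comp (hre.const_mul_atBot hd)
  have h1 := hE.eventually_lt hx.norm (norm_pos_iff.2 hx₀)
  have h2 := (hE.mul hx.norm).eventually_lt_const (u := 1) (by simp)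
  filter_upwards [h1, h2, hx.eventually_ne hx₁, hre.eventually (eventually_lt_atBot 0)]
    with i h1 h2 h3 h4 n hn
  simp only [Function.comp_apply] at h4
  rw [← ppow_intCast] at hn
  have hx' : x i = ppow (σ i) (n - γ) := by
    rw [ppow_sub, ← hn, mul_div_cancel_left₀ _ (ppow_ne_zero _ _)]
  by_cases hnγ : (n : ℝ) = γ
  · rw [hnγ, sub_self, ppow_zero] at hx'
    exact h3 hx'
  · have hnorm : ‖x i‖ = Real.exp ((n - γ) * (σ i).re) := by rw [hx', norm_ppow]
    rw [hnorm] at h1 h2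
    rw [← Real.exp_add, Real.exp_lt_one_iff] at h2
    rw [Real.exp_lt_exp] at h1
    rcases le_abs'.1 (hdn n hnγ) with h | h <;> nlinarith

lemma eventually_thetaPoch_ppow_ne_zero (hσ : Tendsto σ l pToZero) (hx : Tendsto x l (𝓝 x₀))
    (hq0 : q ≠ 0) (hx₀ : x₀ ≠ 0) (hx₁ : ∀ k : ℕ, x₀ * q ^ k ≠ 1) (γ : ℝ) (m : ℕ) :
    ∀ᶠ i in l, thetaPoch (ppow (σ i) γ * x i) q (Complex.exp (σ i)) m ≠ 0 := by
  have : ∀ k ∈ Finset.range m, ∀ᶠ i in l,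
      theta (ppow (σ i) γ * x i * q ^ k) (Complex.exp (σ i)) ≠ 0 := by
    intro k _
    filter_upwards [eventually_ppow_mul_ne_zpow hσ (hx.mul_const (q ^ k))
      (mul_ne_zero hx₀ (pow_ne_zero k hq0)) (hx₁ k) γ, hσ.eventually eventually_re_neg]
      with i hi hre
    rw [mul_assoc]
    exact theta_ne_zero (Complex.exp_ne_zero _) (norm_exp_lt_one hre) hi
  filter_upwards [(Filter.eventually_all_finset _).2 this] with i hi
  exact Finset.prod_ne_zero_iff.2 hi

/-- The values of `f` and `g` are meaningful only where their pole factors do not vanish; for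
generic `x₀` this holds near `p^ζ x₀` once `p` is small. -/
lemma eventually_poleFactor_ppow_ne_zero (hσ : Tendsto σ l pToZero) (hx : Tendsto x l (𝓝 x₀))
    (hq0 : q ≠ 0) (hx₀ : x₀ ≠ 0) {t : ℂ} (ht : t ≠ 0)
    (h₁ : ∀ k : ℕ, q * x₀ / t * q ^ k ≠ 1) (h₂ : ∀ k : ℕ, q * x₀⁻¹ / t * q ^ k ≠ 1)
    (α ζ : ℝ) (m : ℕ) :
    ∀ᶠ i in l, poleFactor q (Complex.exp (σ i)) (t * ppow (σ i) α) m (ppow (σ i) ζ * x i) ≠ 0 := by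
  have hA := eventually_thetaPoch_ppow_ne_zero hσ ((hx.const_mul q).div_const t) hq0
    (div_ne_zero (mul_ne_zero hq0 hx₀) ht) h₁ (1 + ζ - α) m
  have hB := eventually_thetaPoch_ppow_ne_zero hσ (((hx.inv₀ hx₀).const_mul q).div_const t) hq0
    (div_ne_zero (mul_ne_zero hq0 (inv_ne_zero hx₀)) ht) h₂ (1 - ζ - α) m
  filter_upwards [hA, hB] with i hA hB
  rw [poleFactor]
  refine mul_ne_zero ?_ ?_
  · convert hA using 2
    rw [ppow_sub, ppow_add, ppow_one]
    have := ppow_ne_zero (σ i) α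
    field_simp
  · convert hB using 2
    rw [ppow_sub, ppow_sub, ppow_one, mul_inv]
    have := ppow_ne_zero (σ i) α
    have := ppow_ne_zero (σ i) ζ
    field_simp

/-- `θ(z²; p)` at `z = p^ζ w`, up to a monomial. -/
lemma tendsto_theta_sq_ppow (hσ : Tendsto σ l pToZero) (hx : Tendsto x l (𝓝 x₀)) (hx₀ : x₀ ≠ 0)
    {ζ : ℝ} (hζ : -1 / 2 ≤ ζ) (hζ0 : ζ < 0) :
    Tendsto (fun i => -((ppow (σ i) ζ * x i) ^ 2)⁻¹ *
      theta ((ppow (σ i) ζ * x i) ^ 2) (Complex.exp (σ i))) l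
      (𝓝 (if ζ = -1 / 2 then 1 - x₀ ^ 2 else 1)) := by
  have hp : Tendsto (fun i => Complex.exp (σ i)) l (𝓝 0) := tendsto_exp_pToZero.comp hσ
  have h0 : ‖(0 : ℂ)‖ < 1 := by simp
  -- With `z = p^ζ x`, the first factor `1 - z²` of `(z²; p)` combines with `-z⁻²` to `1 - z⁻²`,
  -- which tends to `1` as `ζ < 0`. What is left has exponents `1 + 2ζ` and `1 - 2ζ`, of which only
  -- the first can vanish, namely for `ζ = -1/2`.
  have e : ∀ᶠ i in l, -((ppow (σ i) ζ * x i) ^ 2)⁻¹ *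
      theta ((ppow (σ i) ζ * x i) ^ 2) (Complex.exp (σ i)) =
      (1 - ppow (σ i) (-2 * ζ) * (x i ^ 2)⁻¹) *
        (qPoch (ppow (σ i) (1 + 2 * ζ) * x i ^ 2) (Complex.exp (σ i)) *
        qPoch (ppow (σ i) (1 - 2 * ζ) * (x i ^ 2)⁻¹) (Complex.exp (σ i))) := by
    filter_upwards [hσ.eventually eventually_re_neg, hx.eventually_ne hx₀] with i hre hxi
    have hA : ppow (σ i) (2 * ζ) = ppow (σ i) ζ ^ 2 := by rw [two_mul, ppow_add, sq]
    have hB : ppow (σ i) (-2 * ζ) = (ppow (σ i) ζ ^ 2)⁻¹ := by rw [neg_mul, ppow_neg, hA]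
    rw [theta, qPoch_eq_mul _ (norm_exp_lt_one hre), hB, ppow_add, ppow_sub, ppow_one, hA]
    have := ppow_ne_zero (σ i) ζ
    rw [show Complex.exp (σ i) * (ppow (σ i) ζ * x i) ^ 2 =
      Complex.exp (σ i) * ppow (σ i) ζ ^ 2 * x i ^ 2 by ring,
      show Complex.exp (σ i) / (ppow (σ i) ζ * x i) ^ 2 =
      Complex.exp (σ i) / ppow (σ i) ζ ^ 2 * (x i ^ 2)⁻¹ by field_simp, ← mul_assoc, ← mul_assoc,
      ← mul_assoc]
    congr 2
    field_simp
    ring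
  refine Tendsto.congr' (EventuallyEq.symm e) ?_
  have h1 := (tendsto_ppow (γ := -2 * ζ) (by linarith)).comp hσ
  have h2 := (tendsto_ppow (γ := 1 - 2 * ζ) (by linarith)).comp hσ
  have hx2 := (hx.pow 2).inv₀ (pow_ne_zero 2 hx₀)
  have L1 := (h1.mul hx2).const_sub 1
  have L3 := tendsto_qPoch (h2.mul hx2) hp h0
  have L2 : Tendsto (fun i => qPoch (ppow (σ i) (1 + 2 * ζ) * x i ^ 2) (Complex.exp (σ i))) l
      (𝓝 (if ζ = -1 / 2 then 1 - x₀ ^ 2 else 1)) := by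
    split_ifs with h
    · have : 1 + 2 * ζ = 0 := by rw [h]; norm_num
      simp only [this, ppow_zero, one_mul]
      have h3 := tendsto_qPoch (hx.pow 2) hp h0
      rwa [qPoch_eq_mul _ h0, zero_mul, qPoch_zero, mul_one] at h3
    · have : 0 < 1 + 2 * ζ := by
        have := lt_of_le_of_ne hζ (Ne.symm h)
        linarith
      have h3 := tendsto_qPoch (((tendsto_ppow this).comp hσ).mul (hx.pow 2)) hp h0
      rwa [zero_mul, qPoch_zero] at h3
  have := L1.mul (L2.mul L3)
  rw [zero_mul, qPoch_zero, mul_one, sub_zero, one_mul] at this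
  exact this

end Asymptotics

/-! ### The limit of the integrand -/

lemma tendsto_eval_ratFunc {R : RatFunc ℂ} {w : ℂ} (h : R.denom.eval w ≠ 0) :
    Tendsto (fun z => R.eval (RingHom.id ℂ) z) (𝓝 w) (𝓝 (R.eval (RingHom.id ℂ) w)) := by
  simp only [RatFunc.eval, Polynomial.eval₂_id]
  exact R.num.continuous.continuousAt.div R.denom.continuous.continuousAt h

/-- Uniform convergence on a closed disc reduces the limit, jointly in `p` and `z`, to the finite
partial sums, where every term except the leading one carries a positive power of `p`. -/
lemma Represents.exists_tendsto {S : HahnSeries ℝ (RatFunc ℂ)} {F : ℂ → ℂ → ℂ}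
    (h : Represents S F) :
    ∃ P : Polynomial ℂ, P ≠ 0 ∧ ∀ w, P.eval w ≠ 0 →
      Tendsto (fun x : ℂ × ℂ => ppow x.1 (-S.order) * F x.1 x.2) (pToZero ×ˢ 𝓝 w)
        (𝓝 (S.leadingCoeff.eval (RingHom.id ℂ) w)) := by
  obtain ⟨hS, hfin, P, hP, hden, hunif⟩ := h
  refine ⟨P, hP, fun w hw => ?_⟩
  have hopen : IsOpen {z | P.eval z ≠ 0} := isOpen_ne_fun P.continuous continuous_const
  obtain ⟨r, hr, hball⟩ := Metric.nhds_basis_closedBall.mem_iff.1 (hopen.mem_nhds hw)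
  obtain ⟨ε, hε, hu⟩ := hunif (Metric.closedBall w r) (isCompact_closedBall w r)
    fun z hz => hball hz
  have hmem : {x : ℂ × ℂ | ‖Complex.exp x.1‖ ≤ ε ∧ x.2 ∈ Metric.closedBall w r} ∈
      pToZero ×ˢ 𝓝 w := by
    have h1 : ∀ᶠ s in pToZero, ‖Complex.exp s‖ ≤ ε :=
      (tendsto_exp_pToZero.norm.eventually_lt_const (by simpa using hε)).mono fun s hs => hs.le
    exact (h1.prod_inl (𝓝 w)).and ((Metric.closedBall_mem_nhds w hr : _ ∈ 𝓝 w) |>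
      fun h => Eventually.prod_inr h pToZero)
  have hu' := (tendstoUniformlyOn_iff_tendstoUniformlyOnFilter.1 hu).mono_right
    (le_principal_iff.2 hmem)
  refine hu'.tendsto_of_eventually_tendsto ?_ tendsto_const_nhds
  filter_upwards [eventually_ge_atTop S.order] with N hN
  simp only [partialEval]
  have e : ∀ x : ℂ × ℂ, (∑ᶠ t ∈ S.support ∩ Set.Iic N,
      (S.coeff t).eval (RingHom.id ℂ) x.2 * ppow x.1 (t - S.order)) =
      ∑ t ∈ (hfin N).toFinset, (S.coeff t).eval (RingHom.id ℂ) x.2 * ppow x.1 (t - S.order) :=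
    fun x => finsum_mem_eq_finite_toFinset_sum _ (hfin N)
  simp only [e]
  have hlim : ∑ t ∈ (hfin N).toFinset, (if t = S.order then
      S.leadingCoeff.eval (RingHom.id ℂ) w else 0) = S.leadingCoeff.eval (RingHom.id ℂ) w := by
    rw [Finset.sum_ite_eq', if_pos]
    simp [hN, HahnSeries.coeff_order_eq_zero, hS]
  rw [← hlim]
  refine tendsto_finsetSum _ fun t ht => ?_
  have hev := (tendsto_eval_ratFunc (hden t w hw)).comp (tendsto_snd (f := pToZero) (g := 𝓝 w))
  split_ifs with hto
  · subst hto
    simpa [ppow_zero, HahnSeries.leadingCoeff_eq] using! hev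
  · have hpos : 0 < t - S.order := by
      have : t ∈ S.support := by simp only [Set.Finite.mem_toFinset] at ht; exact ht.1
      have := HahnSeries.order_le_of_coeff_ne_zero this
      exact sub_pos.2 (lt_of_le_of_ne this (Ne.symm hto))
    simpa using! hev.mul ((tendsto_ppow hpos).comp (tendsto_fst (f := pToZero) (g := 𝓝 w)))

/-- The limit of the weight at `p^ζ w`, before the factors equal to one are left out. -/
def gammaWeight (q : ℂ) (t : Fin 6 → ℂ) (α : Fin 6 → ℝ) (T : Finset (Fin 6)) (ζ : ℝ) (w : ℂ) : ℂ :=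
  (∏ r, gammaLimit q ((if r ∈ T then 1 else 0) + α r + ζ) (t r * w) *
    gammaLimit q (α r - ζ) (t r / w)) * theta ((∏ r ∈ T, t r) / w) q *
    (if ζ = -1 / 2 then 1 - w ^ 2 else 1)

section Weight

variable {q : ℂ} {t : Fin 6 → ℂ} {α : Fin 6 → ℝ} {T : Finset (Fin 6)} {ζ : ℝ}

/-- A gamma factor contributes only where its exponent is `0` or `1`, that is, where an inequality
on `α_r` is an equality. Some of these equalities force `ζ = -1/2` and make up the conditional
factor of the weight, together with `1 - w² = (w²; q) / (q w²; q)`. -/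
lemma gammaWeight_eq_limitWeight (hq0 : q ≠ 0) (hq1 : ‖q‖ < 1) (hζ : -1 / 2 ≤ ζ) (hζ0 : ζ < 0)
    (hin : ∀ r ∈ T, ζ ≤ α r ∧ α r ≤ -ζ) (hout : ∀ r ∉ T, -ζ ≤ α r ∧ α r ≤ 1 + ζ) {w : ℂ}
    (hw : qPoch (q * w ^ 2) q ≠ 0) :
    gammaWeight q t α T ζ w = limitWeight q t α T ζ w := by
  have key : ∀ r, gammaLimit q ((if r ∈ T then 1 else 0) + α r + ζ) (t r * w) *
      gammaLimit q (α r - ζ) (t r / w) =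
      ((if r ∈ T ∧ α r = -ζ then qPoch (q / (t r * w)) q else 1) *
        (if r ∉ T ∧ α r = 1 + ζ then qPoch (q * w / t r) q else 1)) /
      ((if r ∈ T ∧ α r = ζ then qPoch (t r / w) q else 1) *
        (if r ∉ T ∧ α r = -ζ then qPoch (t r * w) q else 1)) *
      ((if ζ = -1 / 2 ∧ r ∈ T ∧ α r = 1 / 2 then qPoch (q * w / t r) q else 1) /
        (if ζ = -1 / 2 ∧ r ∈ T ∧ α r = -1 / 2 then qPoch (t r * w) q else 1)) := by
    intro r
    rw [gammaLimit, gammaLimit, div_div_eq_mul_div]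
    by_cases hr : r ∈ T
    · obtain ⟨h1, h2⟩ := hin r hr
      have e1 : 1 + α r + ζ = 1 ↔ α r = -ζ := by constructor <;> intro h <;> linarith
      have e2 : 1 + α r + ζ = 0 ↔ ζ = -1 / 2 ∧ α r = -1 / 2 :=
        ⟨fun h => ⟨by linarith, by linarith⟩, fun h => by linarith [h.1, h.2]⟩
      have e3 : α r - ζ = 1 ↔ ζ = -1 / 2 ∧ α r = 1 / 2 :=
        ⟨fun h => ⟨by linarith, by linarith⟩, fun h => by linarith [h.1, h.2]⟩
      have e4 : α r - ζ = 0 ↔ α r = ζ := sub_eq_zero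
      simp only [hr, if_true, e1, e2, e3, e4, true_and, not_true_eq_false, false_and, if_false,
        mul_one]
      ring
    · obtain ⟨h1, h2⟩ := hout r hr
      have e1 : ¬ (0 + α r + ζ = 1) := by intro h; linarith
      have e2 : 0 + α r + ζ = 0 ↔ α r = -ζ := by constructor <;> intro h <;> linarith
      have e3 : α r - ζ = 1 ↔ α r = 1 + ζ := by constructor <;> intro h <;> linarith
      have e4 : ¬ (α r - ζ = 0) := by intro h; linarith
      simp only [hr, if_false, e1, e2, e3, e4, false_and, not_false_eq_true, true_and, one_mul,
        and_false, mul_one, div_one]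
      ring
  rw [gammaWeight, limitWeight, Finset.prod_congr rfl fun r _ => key r]
  simp only [Finset.prod_mul_distrib, Finset.prod_div_distrib, Finset.prod_filter]
  rw [← theta_div ((∏ r ∈ T, t r) / w) hq0, div_div_eq_mul_div, qPoch_eq_mul (w ^ 2) hq1]
  split_ifs with h
  · simp only [h, true_and]
    rw [mul_assoc (1 - w ^ 2), mul_div_assoc (1 - w ^ 2), mul_div_mul_left _ _ hw]
    ring
  · simp only [h, false_and, if_false, Finset.prod_const_one, div_one, mul_one]

variable {ι : Type*} {l : Filter ι} {σ : ι → ℂ} {x : ι → ℂ} {x₀ : ℂ}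

/-- At `z = p^ζ x` the gamma factors have exponents `α_r - ζ` and `α_r + ζ`, the latter raised by
one for `r ∈ T`; all lie in `[0, 1]`. The theta function does not see `p`, since the `α_r` with `r ∈
T` add up to `ζ`. -/
lemma tendsto_brokenWeight (hσ : Tendsto σ l pToZero) (hx : Tendsto x l (𝓝 x₀))
    (hx₀ : x₀ ≠ 0) (hq1 : ‖q‖ < 1) (ht : ∀ r, t r ≠ 0)
    (hζ : -1 / 2 ≤ ζ) (hζ0 : ζ < 0)
    (hin : ∀ r ∈ T, ζ ≤ α r ∧ α r ≤ -ζ) (hout : ∀ r ∉ T, -ζ ≤ α r ∧ α r ≤ 1 + ζ)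
    (hsum : ∑ r ∈ T, α r = ζ)
    (h₁ : ∀ r, qPoch (t r * x₀) q ≠ 0) (h₂ : ∀ r, qPoch (t r / x₀) q ≠ 0) :
    Tendsto (fun i => brokenWeight q (Complex.exp (σ i)) T (fun r => t r * ppow (σ i) (α r))
      (∏ r ∈ T, t r * ppow (σ i) (α r)) (ppow (σ i) ζ * x i)) l
      (𝓝 (gammaWeight q t α T ζ x₀)) := by
  have hprod : ∀ s, ∏ r ∈ T, ppow s (α r) = ppow s ζ := fun s => by
    rw [← hsum]
    simp only [ppow, ← Complex.exp_sum, Complex.ofReal_sum, Finset.sum_mul]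
  have e : ∀ i, brokenWeight q (Complex.exp (σ i)) T (fun r => t r * ppow (σ i) (α r))
      (∏ r ∈ T, t r * ppow (σ i) (α r)) (ppow (σ i) ζ * x i) =
      (∏ r, ellGamma (ppow (σ i) ((if r ∈ T then 1 else 0) + α r + ζ) * (t r * x i))
          (Complex.exp (σ i)) q *
        ellGamma (ppow (σ i) (α r - ζ) * (t r / x i)) (Complex.exp (σ i)) q) *
      theta ((∏ r ∈ T, t r) / x i) q *
      (-((ppow (σ i) ζ * x i) ^ 2)⁻¹ *
        theta ((ppow (σ i) ζ * x i) ^ 2) (Complex.exp (σ i))) := by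
    intro i
    rw [brokenWeight, Finset.prod_mul_distrib (s := T), hprod]
    congr 2
    · refine Finset.prod_congr rfl fun r _ => ?_
      congr 2
      · rw [ppow_add, ppow_add, shift]
        split_ifs <;> simp only [ppow_one, ppow_zero] <;> ring
      · rw [ppow_sub, mul_comm (t r), mul_div_mul_comm]
    · rw [mul_comm, mul_div_mul_left _ _ (ppow_ne_zero _ _)]
  simp only [e]
  have hτ : Tendsto (fun i => theta ((∏ r ∈ T, t r) / x i) q) l
      (𝓝 (theta ((∏ r ∈ T, t r) / x₀) q)) :=
    (differentiableAt_theta hq1 (div_ne_zero (Finset.prod_ne_zero_iff.2 fun r _ => ht r)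
      hx₀)).continuousAt.tendsto.comp (tendsto_const_nhds.div hx hx₀)
  refine ((tendsto_finsetProd _ fun r _ => ?_).mul hτ).mul (tendsto_theta_sq_ppow hσ hx hx₀ hζ hζ0)
  have hb : 0 ≤ (if r ∈ T then 1 else 0) + α r + ζ ∧ (if r ∈ T then 1 else 0) + α r + ζ ≤ 1 ∧
      0 ≤ α r - ζ ∧ α r - ζ ≤ 1 := by
    split_ifs with h
    · have := hin r h
      refine ⟨?_, ?_, ?_, ?_⟩ <;> linarith [this.1, this.2]
    · have := hout r h
      refine ⟨?_, ?_, ?_, ?_⟩ <;> linarith [this.1, this.2]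
  exact (tendsto_ellGamma_ppow hσ (hx.const_mul (t r)) hq1 hb.1 hb.2.1
    (mul_ne_zero (ht r) hx₀) fun _ => h₁ r).mul (tendsto_ellGamma_ppow hσ
    (tendsto_const_nhds.div hx hx₀) hq1 hb.2.2.1 hb.2.2.2 (div_ne_zero (ht r) hx₀) fun _ => h₂ r)

end Weight

/-! ### The contour of the limiting integral, rescaled -/

lemma ContourCycle.scale_contains {C : ContourCycle} {c w : ℂ} (hc : c ≠ 0) (h : C.Contains w) :
    (C.scale c).Contains (c * w) := by
  refine ⟨?_, (C.scale_winding hc w).trans h.2⟩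
  rw [C.scale_trace]
  rintro ⟨z, hz, hzw⟩
  exact h.1 (mul_left_cancel₀ hc hzw ▸ hz)

lemma ContourCycle.scale_excludes {C : ContourCycle} {c w : ℂ} (hc : c ≠ 0) (h : C.Excludes w) :
    (C.scale c).Excludes (c * w) := by
  refine ⟨?_, (C.scale_winding hc w).trans h.2⟩
  rw [C.scale_trace]
  rintro ⟨z, hz, hzw⟩
  exact h.1 (mul_left_cancel₀ hc hzw ▸ hz)

lemma eventually_norm_ppow_mul_lt {q : ℂ} (hq1 : ‖q‖ < 1) {b : ℝ} (hb : 0 ≤ b) (x : ℂ) {ε : ℝ}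
    (hε : 0 < ε) :
    ∀ᶠ s in pToZero, ∀ i j : ℕ, b + i ≠ 0 → ‖ppow s (b + i) * (x * q ^ j)‖ < ε := by
  -- A positive lower bound for the nonzero exponents makes the estimate uniform in `i` and `j`.
  obtain ⟨d, hd, hdi⟩ : ∃ d > 0, ∀ i : ℕ, b + i ≠ 0 → d ≤ b + i := by
    rcases hb.eq_or_lt with rfl | hb
    · refine ⟨1, one_pos, fun i hi => ?_⟩
      rw [zero_add] at hi ⊢
      exact_mod_cast Nat.one_le_iff_ne_zero.2 (by exact_mod_cast hi)
    · exact ⟨b, hb, fun i _ => le_add_of_nonneg_right i.cast_nonneg⟩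
  have := ((tendsto_ppow hd).norm.mul_const ‖x‖).eventually_lt_const (u := ε) (by simpa using hε)
  filter_upwards [this, eventually_re_neg] with s hs hre i j hi
  refine lt_of_le_of_lt ?_ hs
  rw [norm_mul, norm_mul, norm_pow, norm_ppow, norm_ppow]
  have h1 : Real.exp ((b + i) * s.re) ≤ Real.exp (d * s.re) :=
    Real.exp_le_exp.2 (mul_le_mul_of_nonpos_right (hdi i hi) hre.le)
  have h2 : ‖x‖ * ‖q‖ ^ j ≤ ‖x‖ :=
    mul_le_of_le_one_right (norm_nonneg x) (pow_le_one₀ (norm_nonneg q) hq1.le)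
  exact mul_le_mul h1 h2 (by positivity) (Real.exp_pos _).le

section LimitContour

variable {q : ℂ} {v : Fin 6 → ℂ} {α : Fin 6 → ℝ} {T : Finset (Fin 6)} {ζ : ℝ} {C : ContourCycle}

lemma IsLimitContour.contains (hC : IsLimitContour q v α T ζ C)
    (hζ0 : ζ < 0) (hout : ∀ r ∉ T, -ζ ≤ α r ∧ α r ≤ 1 + ζ) {r : Fin 6} (hr : α r - ζ = 0) (k : ℕ) :
    C.Contains (v r * q ^ k) := by
  refine hC.2.1 r ?_ (sub_eq_zero.1 hr) k
  by_contra h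
  linarith [(hout r h).1]

lemma IsLimitContour.excludes (hC : IsLimitContour q v α T ζ C) (hζ : -1 / 2 ≤ ζ)
    (hin : ∀ r ∈ T, ζ ≤ α r ∧ α r ≤ -ζ) {r : Fin 6}
    (hr : (if r ∈ T then 1 else 0) + α r + ζ = 0) (k : ℕ) :
    C.Excludes (v r * q ^ k)⁻¹ := by
  split_ifs at hr with h
  · exact hC.2.2.2 (by linarith [(hin r h).1]) r h (by linarith [(hin r h).1]) k
  · exact hC.2.2.1 r h (by linarith) k

/-- Divided by `p^ζ`, the poles are `p^γ v_r q^j` or reciprocals of such points, with `γ ≥ 0`. For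
`γ = 0` they are the fixed points named in the definition of the limit contour. For `γ > 0` they
move uniformly to `0`, near which the winding number is `1`, or to infinity, where it is `0`. -/
lemma IsLimitContour.eventually_scale (hC : IsLimitContour q v α T ζ C) (hq0 : q ≠ 0)
    (hq1 : ‖q‖ < 1) (hv : ∀ r, v r ≠ 0) (hζ : -1 / 2 ≤ ζ) (hζ0 : ζ < 0)
    (hin : ∀ r ∈ T, ζ ≤ α r ∧ α r ≤ -ζ) (hout : ∀ r ∉ T, -ζ ≤ α r ∧ α r ≤ 1 + ζ) :
    ∀ᶠ s in pToZero, (C.scale (ppow s ζ)).Contains 0 ∧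
      (∀ r i j, (C.scale (ppow s ζ)).Contains (Complex.exp s ^ i * q ^ j * (v r * ppow s (α r)))) ∧
      ∀ r i j, (r ∈ T → 1 ≤ i) →
        (C.scale (ppow s ζ)).Excludes (Complex.exp s ^ i * q ^ j * (v r * ppow s (α r)))⁻¹ := by
  obtain ⟨ε, hε, hball⟩ := Metric.eventually_nhds_iff_ball.1 (C.eventually_winding_eq hC.1.1)
  obtain ⟨R, hR, hCR⟩ := C.exists_trace_subset_ball
  have h₁ : ∀ r, ∀ᶠ s in pToZero, ∀ i j : ℕ, α r - ζ + i ≠ 0 →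
      ‖ppow s (α r - ζ + i) * (v r * q ^ j)‖ < ε := by
    refine fun r => eventually_norm_ppow_mul_lt hq1 ?_ _ hε
    by_cases h : r ∈ T
    · linarith [(hin r h).1]
    · linarith [(hout r h).1]
  have h₂ : ∀ r, ∀ᶠ s in pToZero, ∀ i j : ℕ, (if r ∈ T then 1 else 0) + α r + ζ + i ≠ 0 →
      ‖ppow s ((if r ∈ T then 1 else 0) + α r + ζ + i) * (v r * q ^ j)‖ < R⁻¹ := by
    refine fun r => eventually_norm_ppow_mul_lt hq1 ?_ _ (inv_pos.2 hR)
    split_ifs with h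
    · linarith [(hin r h).1]
    · linarith [(hout r h).1]
  have hnonneg₁ : ∀ r, 0 ≤ α r - ζ := fun r => by
    by_cases h : r ∈ T
    · linarith [(hin r h).1]
    · linarith [(hout r h).1]
  have hnonneg₂ : ∀ r, 0 ≤ (if r ∈ T then 1 else 0) + α r + ζ := fun r => by
    split_ifs with h
    · linarith [(hin r h).1]
    · linarith [(hout r h).1]
  filter_upwards [eventually_all.2 h₁, eventually_all.2 h₂] with s h₁ h₂
  have hc := ppow_ne_zero s ζ
  refine ⟨by simpa using! ContourCycle.scale_contains hc hC.1, fun r i j => ?_, fun r i j hi => ?_⟩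
  · have e : Complex.exp s ^ i * q ^ j * (v r * ppow s (α r)) =
        ppow s ζ * (ppow s (α r - ζ + i) * (v r * q ^ j)) := by
      rw [ppow_add, ppow_sub, ppow_natCast]
      field_simp
    rw [e]
    refine ContourCycle.scale_contains hc ?_
    by_cases h : α r - ζ + i = 0
    · have hi : (0 : ℝ) ≤ i := i.cast_nonneg
      rw [h, ppow_zero, one_mul]
      exact hC.contains hζ0 hout (by linarith [hnonneg₁ r]) j
    · have := hball _ (mem_ball_zero_iff.2 (h₁ r i j h))
      exact ⟨this.1, this.2.trans hC.1.2⟩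
  · obtain ⟨k, rfl⟩ : ∃ k : ℕ, i = (if r ∈ T then 1 else 0) + k := by
      refine ⟨i - if r ∈ T then 1 else 0, ?_⟩
      split_ifs with h
      · have := hi h
        omega
      · omega
    have e : (Complex.exp s ^ ((if r ∈ T then 1 else 0) + k) * q ^ j * (v r * ppow s (α r)))⁻¹ =
        ppow s ζ * (ppow s ((if r ∈ T then 1 else 0) + α r + ζ + k) * (v r * q ^ j))⁻¹ := by
      rw [← ppow_natCast, ppow_add, ppow_add, ppow_add, Nat.cast_add, ppow_add, Nat.cast_ite,
        Nat.cast_one, Nat.cast_zero]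
      have := ppow_ne_zero s (if r ∈ T then 1 else 0)
      have := ppow_ne_zero s (α r)
      have := ppow_ne_zero s k
      have := hv r
      field_simp
    rw [e]
    refine ContourCycle.scale_excludes hc ?_
    by_cases h : (if r ∈ T then 1 else 0) + α r + ζ + k = 0
    · have hk : (0 : ℝ) ≤ k := k.cast_nonneg
      rw [h, ppow_zero, one_mul]
      exact hC.excludes hζ hin (by linarith [hnonneg₂ r]) j
    · refine C.winding_eq_zero_of_subset_ball hCR ?_
      rw [norm_inv]
      refine (le_inv_comm₀ hR (norm_pos_iff.2 ?_)).2 (h₂ r k j h).le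
      exact mul_ne_zero (ppow_ne_zero _ _) (mul_ne_zero (hv r) (pow_ne_zero j hq0))

lemma eventually_mem_regularSet (hq1 : ‖q‖ < 1) (hζ : -1 / 2 ≤ ζ) (hζ0 : ζ < 0)
    (hin : ∀ r ∈ T, ζ ≤ α r ∧ α r ≤ -ζ) (hout : ∀ r ∉ T, -ζ ≤ α r ∧ α r ≤ 1 + ζ) {w : ℂ}
    (hw0 : w ≠ 0) (hv₁ : ∀ r, (if r ∈ T then 1 else 0) + α r + ζ = 0 → qPoch (v r * w) q ≠ 0)
    (hv₂ : ∀ r, α r - ζ = 0 → qPoch (v r / w) q ≠ 0) :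
    ∀ᶠ x : ℂ × ℂ in pToZero ×ˢ 𝓝 w, ppow x.1 ζ * x.2 ∈
      regularSet q (Complex.exp x.1) T fun r => v r * ppow x.1 (α r) := by
  have hσ : Tendsto Prod.fst (pToZero ×ˢ 𝓝 w) pToZero := tendsto_fst
  have hx : Tendsto Prod.snd (pToZero ×ˢ 𝓝 w) (𝓝 w) := tendsto_snd
  have h₁ : ∀ r, ∀ᶠ x : ℂ × ℂ in pToZero ×ˢ 𝓝 w,
      qPoch₂ (ppow x.1 ((if r ∈ T then 1 else 0) + α r + ζ) * (v r * x.2)) (Complex.exp x.1) q ≠ 0 := by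
    intro r
    refine (tendsto_qPoch₂_ppow hσ (hx.const_mul (v r)) hq1 ?_).eventually_ne ?_
    · split_ifs with h
      · linarith [(hin r h).1]
      · linarith [(hout r h).1]
    · by_cases hb : (if r ∈ T then 1 else 0) + α r + ζ = 0
      · rw [if_pos hb]
        exact hv₁ r hb
      · rw [if_neg hb]
        exact one_ne_zero
  have h₂ : ∀ r, ∀ᶠ x : ℂ × ℂ in pToZero ×ˢ 𝓝 w,
      qPoch₂ (ppow x.1 (α r - ζ) * (v r / x.2)) (Complex.exp x.1) q ≠ 0 := by
    intro r
    refine (tendsto_qPoch₂_ppow hσ (tendsto_const_nhds.div hx hw0) hq1 ?_).eventually_ne ?_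
    · by_cases h : r ∈ T
      · linarith [(hin r h).1]
      · linarith [(hout r h).1]
    · split_ifs with hb
      · exact hv₂ r hb
      · exact one_ne_zero
  filter_upwards [eventually_all.2 h₁, eventually_all.2 h₂, hx.eventually_ne hw0]
    with x h₁ h₂ hx0
  refine ⟨mul_ne_zero (ppow_ne_zero _ _) hx0, fun r => ⟨?_, ?_⟩⟩
  · convert h₁ r using 2
    rw [ppow_add, ppow_add, shift]
    split_ifs <;> simp only [ppow_one, ppow_zero] <;> ring
  · convert h₂ r using 2
    change v r * ppow x.1 (α r) / (ppow x.1 ζ * x.2) = _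
    rw [ppow_sub, mul_comm (v r), mul_div_mul_comm]

lemma IsLimitContour.eventually_mem_regularSet (hC : IsLimitContour q v α T ζ C)
    (hq1 : ‖q‖ < 1) (hζ : -1 / 2 ≤ ζ) (hζ0 : ζ < 0)
    (hin : ∀ r ∈ T, ζ ≤ α r ∧ α r ≤ -ζ) (hout : ∀ r ∉ T, -ζ ≤ α r ∧ α r ≤ 1 + ζ)
    {w : ℂ} (hw : w ∈ C.trace) :
    ∀ᶠ x : ℂ × ℂ in pToZero ×ˢ 𝓝 w, ppow x.1 ζ * x.2 ∈
      regularSet q (Complex.exp x.1) T fun r => v r * ppow x.1 (α r) := by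
  have hw0 : w ≠ 0 := by
    rintro rfl
    exact hC.1.1 hw
  refine EllipticLimit.eventually_mem_regularSet hq1 hζ hζ0 hin hout hw0 (fun r hb => ?_)
    fun r hb => ?_
  · refine qPoch_ne_zero hq1 fun j hj => (hC.excludes hζ hin hb j).1 ?_
    have : w = (v r * q ^ j)⁻¹ := eq_inv_of_mul_eq_one_left (by linear_combination hj)
    exact this ▸ hw
  · refine qPoch_ne_zero hq1 fun j hj => (hC.contains hζ0 hout hb j).1 ?_
    have : w = v r * q ^ j := by
      field_simp at hj
      exact hj.symm
    exact this ▸ hw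

end LimitContour

/-! ### The limit of the integral -/

lemma eventually_cocountable_qPoch_ne_zero {q : ℂ} (hq1 : ‖q‖ < 1) :
    ∀ᶠ z in cocountable, qPoch z q ≠ 0 := by
  have := eventually_cocountable_qPoch₂_ne_zero (p := 0) (q := q) (by simp) hq1
  simpa only [← qPoch_eq_qPoch₂] using this

lemma eventually_cocountable_eval_ne_zero {P : Polynomial ℂ} (hP : P ≠ 0) :
    ∀ᶠ z in cocountable, P.eval z ≠ 0 := by
  rw [eventually_cocountable_iff]
  simpa using! (Polynomial.finite_setOfPred_isRoot hP).countable

lemma div_right_injective {x : ℂ} (hx : x ≠ 0) : Function.Injective fun z : ℂ => x / z := by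
  intro y z h
  simpa [div_eq_mul_inv, hx] using h

theorem tendsto_integral_ellWeight {q : ℂ} (hq0 : q ≠ 0) (hq1 : ‖q‖ < 1) {t : Fin 6 → ℂ}
    (ht : ∀ r, t r ≠ 0) {a b c : Fin 6} (hab : a ≠ b) (hac : a ≠ c) (hbc : b ≠ c)
    {α : Fin 6 → ℝ} {ζ : ℝ} (hζ : -1 / 2 ≤ ζ) (hζ0 : ζ < 0) (habc : α a + α b + α c = ζ)
    (hin : ∀ r ∈ ({a, b, c} : Finset (Fin 6)), ζ ≤ α r ∧ α r ≤ -ζ)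
    (hout : ∀ r ∉ ({a, b, c} : Finset (Fin 6)), -ζ ≤ α r ∧ α r ≤ 1 + ζ)
    {mf mg : ℕ} {f g : ℂ → ℂ → ℂ} {Sf Sg : HahnSeries ℝ (RatFunc ℂ)}
    (hf : InATilde q (t 4) (α 4) ζ mf f Sf) (hg : InATilde q (t 5) (α 5) ζ mg g Sg)
    {N : Set ℂ} {C : ℂ → ContourCycle} {C' : ContourCycle}
    (hC : ∀ s ∈ N, s.re < 0 →
      IsEllipticContour q (Complex.exp s) (fun r => tTilde q mf mg t r * ppow s (α r)) (C s))
    (hC' : IsLimitContour q (tTilde q mf mg t) α {a, b, c} ζ C') :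
    Tendsto (fun s => ppow s (-Sf.order - Sg.order) *
      (theta (t a * ppow s (α a) * (t b * ppow s (α b))) q *
        theta (t a * ppow s (α a) * (t c * ppow s (α c))) q *
        theta (t b * ppow s (α b) * (t c * ppow s (α c))) q *
      (C s).integral fun z => f s z * g s z *
        ellWeight q (Complex.exp s) (fun r => t r * ppow s (α r)) z *
          (2 * Real.pi * Complex.I * z)⁻¹)) (pToZero ⊓ 𝓟 N)
      (𝓝 (2 * C'.integral fun z => Sf.leadingCoeff.eval (RingHom.id ℂ) z *
        Sg.leadingCoeff.eval (RingHom.id ℂ) z * limitWeight q t α {a, b, c} ζ z *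
          (2 * Real.pi * Complex.I * z)⁻¹)) := by
  set T : Finset (Fin 6) := {a, b, c} with hT
  set v := tTilde q mf mg t with hvdef
  have hv : ∀ r, v r ≠ 0 := fun r => div_ne_zero (ht r) (pow_ne_zero _ hq0)
  have huv : ∀ s, (fun r => t r * ppow s (α r) / q ^ poleOrder mf mg r) =
      fun r => v r * ppow s (α r) := fun s => funext fun r => by
    change _ = t r / q ^ poleOrder mf mg r * ppow s (α r)
    rw [div_mul_eq_mul_div]
  have hτ : ∀ s, t a * ppow s (α a) * (t b * ppow s (α b)) * (t c * ppow s (α c)) =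
      ∏ r ∈ T, t r * ppow s (α r) := fun s => by
    rw [hT, Finset.prod_insert (by simp [hab, hac]), Finset.prod_insert (by simp [hbc]),
      Finset.prod_singleton, mul_assoc]
  have hsum : ∑ r ∈ T, α r = ζ := by
    rw [hT, Finset.sum_insert (by simp [hab, hac]), Finset.sum_insert (by simp [hbc]),
      Finset.sum_singleton, ← habc, add_assoc]
  -- The zero function is a default value for those `s` at which the hypotheses fail; only small `p`
  -- matter.
  have hW : ∀ s, ∃ W : ℂ → ℂ, s.re < 0 → InA q (Complex.exp s) (t 4 * ppow s (α 4)) mf (f s) →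
      InA q (Complex.exp s) (t 5 * ppow s (α 5)) mg (g s) → _ := fun s => by
    by_cases h : s.re < 0 ∧ InA q (Complex.exp s) (t 4 * ppow s (α 4)) mf (f s) ∧
      InA q (Complex.exp s) (t 5 * ppow s (α 5)) mg (g s)
    · obtain ⟨W, hW⟩ := exists_broken_integrand (u := fun r => t r * ppow s (α r))
        (Complex.exp_ne_zero s) (norm_exp_lt_one h.1) hq0 hq1
        (fun r => mul_ne_zero (ht r) (ppow_ne_zero s _)) h.2.1 h.2.2 hab hac hbc
      exact ⟨W, fun _ _ _ => hW⟩
    · exact ⟨0, fun h1 h2 h3 => absurd ⟨h1, h2, h3⟩ h⟩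
  choose W hW using hW
  simp only [huv, hτ] at hW
  have hgood : ∀ᶠ s in pToZero, s.re < 0 ∧
      InA q (Complex.exp s) (t 4 * ppow s (α 4)) mf (f s) ∧
      InA q (Complex.exp s) (t 5 * ppow s (α 5)) mg (g s) :=
    eventually_re_neg.and (hf.1.and hg.1)
  -- On the scaled limit contour this convergence holds along all `p → 0`; nondegeneracy enters only
  -- when the elliptic contour is replaced by the scaled one.
  have hlim : Tendsto (fun s => C'.integral fun w => ppow s (-Sf.order - Sg.order) *
      (ppow s ζ * W s (ppow s ζ * w))) pToZero (𝓝 (C'.integral fun z =>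
        Sf.leadingCoeff.eval (RingHom.id ℂ) z * Sg.leadingCoeff.eval (RingHom.id ℂ) z *
          limitWeight q t α T ζ z * (2 * Real.pi * Complex.I * z)⁻¹)) := by
    obtain ⟨Pf, hPf0, hPf⟩ := hf.2.exists_tendsto
    obtain ⟨Pg, hPg0, hPg⟩ := hg.2.exists_tendsto
    have hqP := eventually_cocountable_qPoch_ne_zero hq1
    -- Generic points avoid the exceptional polynomials of both series, the zeros of the
    -- `q`-products for `t` and for `t̃`, the zeros of `(q w²; q)`, and the points where a pole
    -- factor could vanish in the limit.
    have hgen := ((eventually_cocountable_ne 0).and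
      ((eventually_cocountable_eval_ne_zero hPf0).and
      ((eventually_cocountable_eval_ne_zero hPg0).and
      ((eventually_cocountable_forall fun r => eventually_cocountable_comp hqP
        (mul_right_injective₀ (ht r))).and
      ((eventually_cocountable_forall fun r => eventually_cocountable_comp hqP
        (div_right_injective (ht r))).and
      ((eventually_cocountable_forall fun r => eventually_cocountable_comp hqP
        (mul_right_injective₀ (hv r))).and
      ((eventually_cocountable_forall fun r => eventually_cocountable_comp hqP
        (div_right_injective (hv r))).and
      (eventually_cocountable_sq (eventually_cocountable_comp hqP
        (mul_right_injective₀ hq0)))))))))).and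
      ((eventually_cocountable_forall fun k : ℕ => eventually_cocountable_forall fun r : Fin 6 =>
        eventually_cocountable_ne (t r / (q * q ^ k))).and
      (eventually_cocountable_forall fun k : ℕ => eventually_cocountable_forall fun r : Fin 6 =>
        eventually_cocountable_ne (q * q ^ k / t r)))
    refine ContourCycle.tendsto_integral (eventually_cocountable_iff.1 hgen) ?_ ?_
    · intro w hw
      filter_upwards [hC'.eventually_mem_regularSet hq1 hζ hζ0 hin hout hw,
        hgood.prod_inl (𝓝 w)] with x hx hs
      have hd := (hW x.1 hs.1 hs.2.1 hs.2.2).1.differentiableAt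
        ((isOpen_regularSet (norm_exp_lt_one hs.1) hq1 T _).mem_nhds hx)
      exact ((hd.fun_comp' x.2 (differentiableAt_id.const_mul _)).const_mul _).const_mul _
    · intro w hw
      rw [Set.mem_ofPred_eq, not_not] at hw
      obtain ⟨⟨hw0, hwf, hwg, ht₁, ht₂, hv₁, hv₂, hsq⟩, hp₁, hp₂⟩ := hw
      have hσ : Tendsto Prod.fst (pToZero ×ˢ 𝓝 w) pToZero := tendsto_fst
      have hx : Tendsto Prod.snd (pToZero ×ˢ 𝓝 w) (𝓝 w) := tendsto_snd
      have hb := tendsto_brokenWeight hσ hx hw0 hq1 ht hζ hζ0 hin hout hsum ht₁ ht₂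
      rw [gammaWeight_eq_limitWeight hq0 hq1 hζ hζ0 hin hout hsq] at hb
      have hinv : Tendsto (fun x : ℂ × ℂ => (2 * Real.pi * Complex.I * x.2)⁻¹) (pToZero ×ˢ 𝓝 w)
          (𝓝 (2 * Real.pi * Complex.I * w)⁻¹) :=
        (hx.const_mul _).inv₀ (mul_ne_zero Complex.two_pi_I_ne_zero hw0)
      refine ((((hPf w hwf).mul (hPg w hwg)).mul hb).mul hinv).congr' ?_
      have hpole : ∀ r α ζ m, ∀ᶠ x : ℂ × ℂ in pToZero ×ˢ 𝓝 w,
          poleFactor q (Complex.exp x.1) (t r * ppow x.1 α) m (ppow x.1 ζ * x.2) ≠ 0 :=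
        fun r α ζ m => eventually_poleFactor_ppow_ne_zero hσ hx hq0 hw0 (ht r)
          (fun k hk => hp₁ k r <| by
            have := ht r
            have := pow_ne_zero k hq0
            field_simp at hk ⊢
            linear_combination hk)
          (fun k hk => hp₂ k r <| by
            have := ht r
            field_simp at hk ⊢
            linear_combination -hk) α ζ m
      filter_upwards [eventually_mem_regularSet hq1 hζ hζ0 hin hout hw0 (fun r _ => hv₁ r)
        (fun r _ => hv₂ r), hgood.prod_inl (𝓝 w), hpole 4 (α 4) ζ mf, hpole 5 (α 5) ζ mg,
        hx.eventually_ne hw0] with x hx hs h4 h5 hx0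
      rw [(hW x.1 hs.1 hs.2.1 hs.2.2).2.1 _ hx h4 h5, sub_eq_add_neg, ppow_add]
      have := ppow_ne_zero x.1 ζ
      rw [show 2 * Real.pi * Complex.I * (ppow x.1 ζ * x.2) =
        ppow x.1 ζ * (2 * Real.pi * Complex.I * x.2) by ring, mul_inv (ppow x.1 ζ)]
      field_simp
      rfl
  refine ((hlim.const_mul 2).mono_left inf_le_left).congr' ?_
  filter_upwards [hgood.filter_mono inf_le_left,
    (hC'.eventually_scale hq0 hq1 hv hζ hζ0 hin hout).filter_mono inf_le_left,
    mem_inf_of_right (mem_principal_self N)] with s hs hD hsN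
  obtain ⟨hd, -, hJ⟩ := hW s hs.1 hs.2.1 hs.2.2
  have := IsEllipticContour.integral_eq (Complex.exp_ne_zero s) (norm_exp_lt_one hs.1) hq0 hq1
    (fun r => mul_ne_zero (hv r) (ppow_ne_zero s _)) (hC s hsN hs.1) hD.1 hD.2.1 hD.2.2 hd hJ
  rw [ContourCycle.integral_const_mul, ContourCycle.scale_integral] at this
  rw [this, ContourCycle.integral_const_mul]
  ring

/-! ### The constant in front of the integral -/

lemma prod_pairs_of_lt {T : Finset (Fin 6)} {a b c : Fin 6} (hab : a < b) (hbc : b < c)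
    (hT : T = {a, b, c}) (F : Fin 6 → Fin 6 → ℂ) :
    ∏ x : Fin 6 × Fin 6 with x.1 < x.2 ∧ x.1 ∈ T ∧ x.2 ∈ T, F x.1 x.2 =
      F a b * F a c * F b c := by
  have hac := hab.trans hbc
  have : ({x : Fin 6 × Fin 6 | x.1 < x.2 ∧ x.1 ∈ T ∧ x.2 ∈ T} : Finset _) =
      {(a, b), (a, c), (b, c)} := by
    subst hT
    ext ⟨x, y⟩
    simp only [Finset.mem_filter, Finset.mem_univ, true_and, Finset.mem_insert,
      Finset.mem_singleton, Prod.mk.injEq]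
    constructor
    · rintro ⟨h, rfl | rfl | rfl, rfl | rfl | rfl⟩ <;>
        first | exact absurd h (lt_irrefl _) | exact absurd h (not_lt_of_gt ‹_›) | simp
    · rintro (⟨rfl, rfl⟩ | ⟨rfl, rfl⟩ | ⟨rfl, rfl⟩) <;> simp [*]
  rw [this, Finset.prod_insert (by simp [hab.ne, hbc.ne]), Finset.prod_insert (by simp [hab.ne]),
    Finset.prod_singleton, mul_assoc]

lemma prod_pairs {a b c : Fin 6} (hab : a ≠ b) (hac : a ≠ c) (hbc : b ≠ c)
    (F : Fin 6 → Fin 6 → ℂ) (hF : ∀ x y, F x y = F y x) :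
    ∏ x : Fin 6 × Fin 6 with x.1 < x.2 ∧ x.1 ∈ ({a, b, c} : Finset (Fin 6)) ∧
      x.2 ∈ ({a, b, c} : Finset (Fin 6)), F x.1 x.2 = F a b * F a c * F b c := by
  rcases hab.lt_or_gt with h₁ | h₁ <;> rcases hac.lt_or_gt with h₂ | h₂ <;>
    rcases hbc.lt_or_gt with h₃ | h₃
  · exact prod_pairs_of_lt h₁ h₃ rfl F
  · rw [prod_pairs_of_lt h₂ h₃ (by ext; simp; tauto), hF c b]; ring
  · exact absurd (h₁.trans h₃) h₂.not_gt
  · rw [prod_pairs_of_lt h₂ h₁ (by ext; simp; tauto), hF c a, hF c b]; ring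
  · rw [prod_pairs_of_lt h₁ h₂ (by ext; simp; tauto), hF b a]; ring
  · exact absurd (h₃.trans h₁) h₂.not_gt
  · rw [prod_pairs_of_lt h₃ h₂ (by ext; simp; tauto), hF b a, hF c a]; ring
  · rw [prod_pairs_of_lt h₃ h₁ (by ext; simp; tauto), hF b a, hF c a, hF c b]; ring

/-- Needed for the mixed pairs, which `limitConst` lists as ordered pairs (first index in `T`,
second not), while the gamma factors run over `x < y`. -/
lemma prod_univ_eq_prod_lt (g : Fin 6 → Fin 6 → ℂ) (hg : ∀ x, g x x = 1) :
    ∏ x : Fin 6 × Fin 6, g x.1 x.2 =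
      ∏ x : Fin 6 × Fin 6 with x.1 < x.2, (g x.1 x.2 * g x.2 x.1) := by
  rw [← Finset.prod_filter_mul_prod_filter_not _ fun x : Fin 6 × Fin 6 => x.1 < x.2,
    Finset.prod_mul_distrib]
  congr 1
  simp only [Finset.prod_filter]
  rw [← (Equiv.prodComm (Fin 6) (Fin 6)).prod_comp]
  refine Finset.prod_congr rfl fun x _ => ?_
  change (if ¬ x.2 < x.1 then g x.2 x.1 else 1) = _
  rcases lt_trichotomy x.1 x.2 with h | h | h
  · rw [if_pos h, if_pos h.not_gt]
  · simp [h, hg]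
  · rw [if_neg h.not_gt, if_neg (not_not.2 h)]

/-- The exponent of `p` in `T_x T_y`, raised by one if `x, y ∈ T`. -/
def pairExponent (α : Fin 6 → ℝ) (T : Finset (Fin 6)) (x y : Fin 6) : ℝ :=
  (if x ∈ T ∧ y ∈ T then 1 else 0) + α x + α y

section Constant

variable {q : ℂ} {t : Fin 6 → ℂ} {α : Fin 6 → ℝ} {ζ : ℝ} {a b c : Fin 6}

/-- The sum of two exponents in `T` is `ζ` minus the third one, which lies between `ζ` and `-ζ`. -/
lemma add_le_of_mem (habc : α a + α b + α c = ζ)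
    (hin : ∀ r ∈ ({a, b, c} : Finset (Fin 6)), ζ ≤ α r ∧ α r ≤ -ζ) {x y : Fin 6} (hxy : x ≠ y)
    (hx : x ∈ ({a, b, c} : Finset (Fin 6))) (hy : y ∈ ({a, b, c} : Finset (Fin 6))) :
    2 * ζ ≤ α x + α y ∧ α x + α y ≤ 0 := by
  have ha := hin a (by simp)
  have hb := hin b (by simp)
  have hc := hin c (by simp)
  simp only [Finset.mem_insert, Finset.mem_singleton] at hx hy
  rcases hx with rfl | rfl | rfl <;> rcases hy with rfl | rfl | rfl <;>
    first | exact absurd rfl hxy | constructor <;> linarith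

/-- The three exponents outside `T` add up to `1 - ζ` and each is at least `-ζ`; leaving out the
third gives the upper bound. -/
lemma add_le_of_notMem (hab : a ≠ b) (hac : a ≠ c) (hbc : b ≠ c) (hα : ∑ r, α r = 1)
    (habc : α a + α b + α c = ζ)
    (hout : ∀ r ∉ ({a, b, c} : Finset (Fin 6)), -ζ ≤ α r ∧ α r ≤ 1 + ζ) {x y : Fin 6} (hxy : x ≠ y)
    (hx : x ∉ ({a, b, c} : Finset (Fin 6))) (hy : y ∉ ({a, b, c} : Finset (Fin 6))) :
    -2 * ζ ≤ α x + α y ∧ α x + α y ≤ 1 := by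
  set T : Finset (Fin 6) := {a, b, c} with hT
  have hsum : ∑ r ∈ T, α r = ζ := by
    rw [hT, Finset.sum_insert (by simp [hab, hac]), Finset.sum_insert (by simp [hbc]),
      Finset.sum_singleton, ← habc, add_assoc]
  have hcard : T.card = 3 := Finset.card_eq_three.2 ⟨a, b, c, hab, hac, hbc, rfl⟩
  have hx' : x ∈ Tᶜ := Finset.mem_compl.2 hx
  have hy' : y ∈ Tᶜ.erase x := Finset.mem_erase.2 ⟨hxy.symm, Finset.mem_compl.2 hy⟩
  have h1 := Finset.sum_add_sum_compl T α
  rw [← Finset.add_sum_erase _ α hx', ← Finset.add_sum_erase _ α hy'] at h1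
  have h2 := Finset.card_nsmul_le_sum ((Tᶜ.erase x).erase y) α (-ζ) fun r hr =>
    (hout r (Finset.mem_compl.1 (Finset.mem_of_mem_erase (Finset.mem_of_mem_erase hr)))).1
  rw [Finset.card_erase_of_mem hy', Finset.card_erase_of_mem hx', Finset.card_compl, hcard,
    Fintype.card_fin] at h2
  norm_num at h2
  constructor <;> linarith [(hout x hx).1, (hout y hy).1]

lemma pairExponent_mem_Icc (hab : a ≠ b) (hac : a ≠ c) (hbc : b ≠ c) (hα : ∑ r, α r = 1)
    (habc : α a + α b + α c = ζ) (hζ : -1 / 2 ≤ ζ) (hζ0 : ζ < 0)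
    (hin : ∀ r ∈ ({a, b, c} : Finset (Fin 6)), ζ ≤ α r ∧ α r ≤ -ζ)
    (hout : ∀ r ∉ ({a, b, c} : Finset (Fin 6)), -ζ ≤ α r ∧ α r ≤ 1 + ζ) {x y : Fin 6}
    (hxy : x ≠ y) :
    0 ≤ pairExponent α {a, b, c} x y ∧ pairExponent α {a, b, c} x y ≤ 1 := by
  rw [pairExponent]
  by_cases hx : x ∈ ({a, b, c} : Finset (Fin 6)) <;> by_cases hy : y ∈ ({a, b, c} : Finset (Fin 6))
  · have := add_le_of_mem habc hin hxy hx hy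
    rw [if_pos ⟨hx, hy⟩]
    constructor <;> linarith [this.1, this.2]
  · rw [if_neg fun h => hy h.2]
    constructor <;> linarith [(hin x hx).1, (hin x hx).2, (hout y hy).1, (hout y hy).2]
  · rw [if_neg fun h => hx h.1]
    constructor <;> linarith [(hin y hy).1, (hin y hy).2, (hout x hx).1, (hout x hx).2]
  · have := add_le_of_notMem hab hac hbc hα habc hout hxy hx hy
    rw [if_neg fun h => hx h.1]
    constructor <;> linarith [this.1, this.2]

lemma gammaLimit_mul_ne_zero (hq0 : q ≠ 0) (hq1 : ‖q‖ < 1) (ht : ∀ r, t r ≠ 0)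
    (hgen : ∀ (r r' : Fin 6) (k : ℤ), t r * t r' ≠ q ^ k) (x y : Fin 6) :
    qPoch (t x * t y) q ≠ 0 ∧ ∀ γ, gammaLimit q γ (t x * t y) ≠ 0 := by
  have hxy := mul_ne_zero (ht x) (ht y)
  have h1 : qPoch (t x * t y) q ≠ 0 := qPoch_ne_zero hq1 fun j hj => hgen x y (-j) <| by
    rw [zpow_neg, zpow_natCast]
    exact eq_inv_of_mul_eq_one_left hj
  have h2 : qPoch (q / (t x * t y)) q ≠ 0 := qPoch_ne_zero hq1 fun j hj => hgen x y (j + 1) <| by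
    rw [zpow_add₀ hq0, zpow_natCast, zpow_one]
    have := ht x
    have := ht y
    field_simp at hj
    linear_combination -hj
  refine ⟨h1, fun γ => ?_⟩
  rw [gammaLimit]
  split_ifs <;> simp [h1, h2]

/-- Sort the pairs by membership in `T`. Within `T` the shifted exponent is `0` or `1` when the sum
is `-1` or `0`. Mixed pairs may reach both ends. Outside `T` the sum is at least `-2ζ > 0`, so only
the end `1` occurs. -/
lemma limitConst_eq (hab : a ≠ b) (hac : a ≠ c) (hbc : b ≠ c) (hα : ∑ r, α r = 1)
    (habc : α a + α b + α c = ζ) (hζ0 : ζ < 0)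
    (hin : ∀ r ∈ ({a, b, c} : Finset (Fin 6)), ζ ≤ α r ∧ α r ≤ -ζ)
    (hout : ∀ r ∉ ({a, b, c} : Finset (Fin 6)), -ζ ≤ α r ∧ α r ≤ 1 + ζ) :
    limitConst q t α {a, b, c} = qPoch q q / ∏ x : Fin 6 × Fin 6 with x.1 < x.2,
      gammaLimit q (pairExponent α {a, b, c} x.1 x.2) (t x.1 * t x.2) := by
  set T : Finset (Fin 6) := {a, b, c} with hT
  have key : ∀ x ∈ ({x | x.1 < x.2} : Finset (Fin 6 × Fin 6)),
      (gammaLimit q (pairExponent α T x.1 x.2) (t x.1 * t x.2))⁻¹ =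
      ((if x.1 ∈ T ∧ x.2 ∈ T ∧ α x.1 + α x.2 = -1 then qPoch (t x.1 * t x.2) q else 1) *
        ((if x.1 ∈ T ∧ x.2 ∉ T ∧ α x.1 + α x.2 = 0 then qPoch (t x.1 * t x.2) q else 1) *
        (if x.2 ∈ T ∧ x.1 ∉ T ∧ α x.2 + α x.1 = 0 then qPoch (t x.2 * t x.1) q else 1))) /
      ((if x.1 ∈ T ∧ x.2 ∈ T ∧ α x.1 + α x.2 = 0 then qPoch (q / (t x.1 * t x.2)) q else 1) *
        (if α x.1 + α x.2 = 1 then qPoch (q / (t x.1 * t x.2)) q else 1)) := by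
    rintro ⟨x, y⟩ hxy
    have hxy : x ≠ y := (Finset.mem_filter.1 hxy).2.ne
    rw [gammaLimit, pairExponent, inv_div]
    by_cases hx : x ∈ T <;> by_cases hy : y ∈ T
    · have := add_le_of_mem habc hin hxy hx hy
      have e0 : 1 + α x + α y = 0 ↔ α x + α y = -1 := by constructor <;> intro h <;> linarith
      have e1 : 1 + α x + α y = 1 ↔ α x + α y = 0 := by constructor <;> intro h <;> linarith
      have e2 : ¬ (α x + α y = 1) := fun h => by linarith
      simp only [hx, hy, true_and, if_true, e0, e1, e2, not_true_eq_false, false_and, if_false,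
        mul_one]
    · have e1 : ∀ k, 0 + α x + α y = k ↔ α x + α y = k := fun k => by rw [zero_add]
      simp only [hx, hy, true_and, and_false, e1, not_true_eq_false, not_false_eq_true, false_and,
        if_false, mul_one, one_mul]
    · have e1 : ∀ k, 0 + α x + α y = k ↔ α x + α y = k := fun k => by rw [zero_add]
      simp only [hx, hy, true_and, e1, not_true_eq_false, not_false_eq_true, false_and,
        if_false, one_mul, add_comm (α y), mul_comm (t y)]
    · have := add_le_of_notMem hab hac hbc hα habc hout hxy hx hy
      have e1 : 0 + α x + α y = 1 ↔ α x + α y = 1 := by rw [zero_add]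
      have e0 : ¬ (0 + α x + α y = 0) := fun h => by linarith
      simp only [hx, hy, e0, e1, false_and, if_false, mul_one, one_mul]
  have hmixed := prod_univ_eq_prod_lt (fun x y => if x ∈ T ∧ y ∉ T ∧ α x + α y = 0 then
    qPoch (t x * t y) q else 1) fun x => if_neg fun h => h.2.1 h.1
  rw [div_eq_mul_inv, ← Finset.prod_inv_distrib, Finset.prod_congr rfl key]
  simp only [Finset.prod_mul_distrib, Finset.prod_div_distrib] at hmixed ⊢
  rw [← hmixed, limitConst]
  simp only [← Finset.prod_filter, Finset.filter_filter]
  ring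

/-- The normalization of the bilinear form, multiplied by the theta functions that arise from
breaking the symmetry. -/
lemma prod_ellGamma_mul_theta (hq0 : q ≠ 0) (hq1 : ‖q‖ < 1) {mf mg : ℕ} (hab : a ≠ b)
    (hac : a ≠ c) (hbc : b ≠ c) {s : ℂ} (hs : s.re < 0)
    (hN : Nondegenerate q (Complex.exp s) fun r => tTilde q mf mg t r * ppow s (α r)) :
    (∏ x : Fin 6 × Fin 6 with x.1 < x.2,
      ellGamma (t x.1 * ppow s (α x.1) * (t x.2 * ppow s (α x.2))) (Complex.exp s) q) *
      (theta (t a * ppow s (α a) * (t b * ppow s (α b))) q *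
        theta (t a * ppow s (α a) * (t c * ppow s (α c))) q *
        theta (t b * ppow s (α b) * (t c * ppow s (α c))) q) =
    ∏ x : Fin 6 × Fin 6 with x.1 < x.2,
      ellGamma (ppow s (pairExponent α {a, b, c} x.1 x.2) * (t x.1 * t x.2)) (Complex.exp s) q := by
  rw [← prod_pairs hab hac hbc (fun x y => theta (t x * ppow s (α x) * (t y * ppow s (α y))) q)
    fun x y => by rw [mul_comm], ← Finset.filter_filter, Finset.prod_filter (p := fun x : Fin 6 × Fin 6 =>
      x.1 ∈ ({a, b, c} : Finset (Fin 6)) ∧ x.2 ∈ ({a, b, c} : Finset (Fin 6))),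
    ← Finset.prod_mul_distrib]
  refine Finset.prod_congr rfl fun x _ => ?_
  have e : ppow s (pairExponent α {a, b, c} x.1 x.2) * (t x.1 * t x.2) =
      (if x.1 ∈ ({a, b, c} : Finset (Fin 6)) ∧ x.2 ∈ ({a, b, c} : Finset (Fin 6)) then
        Complex.exp s else 1) * (t x.1 * ppow s (α x.1) * (t x.2 * ppow s (α x.2))) := by
    rw [pairExponent, ppow_add, ppow_add]
    split_ifs <;> simp only [ppow_one, ppow_zero] <;> ring
  rw [e]
  split_ifs with h
  · rw [ellGamma_mul_p (Complex.exp_ne_zero s) (norm_exp_lt_one hs) hq1, mul_comm]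
    -- Nondegeneracy concerns `t̃`; returning to `t` costs the powers of `q` given by the two pole
    -- orders, which are added to `j`.
    refine qPoch₂_ne_zero (norm_exp_lt_one hs) hq1 fun i j hij =>
      hN x.1 x.2 i (poleOrder mf mg x.1 + poleOrder mf mg x.2 + j) ?_
    rw [← hij]
    change _ * (t x.1 / q ^ poleOrder mf mg x.1 * _ * (t x.2 / q ^ poleOrder mf mg x.2 * _)) = _
    rw [pow_add, pow_add]
    field_simp
  · rw [mul_one, one_mul]

end Constant

/-! ### Assembling the limit -/

lemma exists_isLimitContour {q : ℂ} (hq0 : q ≠ 0) (hq1 : ‖q‖ < 1) {v : Fin 6 → ℂ}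
    (hv : ∀ r, v r ≠ 0) (hvv : ∀ r r' (k : ℕ), q ^ k * (v r * v r') ≠ 1) (α : Fin 6 → ℝ)
    (T : Finset (Fin 6)) (ζ : ℝ) : ∃ C, IsLimitContour q v α T ζ C := by
  have hlim : ∀ r, Tendsto (fun k : ℕ => v r * q ^ k) cofinite (𝓝 0) := fun r => by
    rw [Nat.cofinite_eq_atTop]
    simpa using (tendsto_pow_atTop_nhds_zero_of_norm_lt_one hq1).const_mul (v r)
  obtain ⟨C, h0, h1, h2⟩ := ContourCycle.exists_contains_excludes_of_tendsto
    (ρ := {r // r ∈ T ∧ α r = ζ})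
    (ρ' := {r // r ∉ T ∧ α r = -ζ ∨ ζ = -1 / 2 ∧ r ∈ T ∧ α r = -1 / 2})
    (a := fun r k => v r * q ^ k) (b := fun r k => v r * q ^ k) (fun r => hlim r)
    (fun r => hlim r) (fun r k => mul_ne_zero (hv r) (pow_ne_zero k hq0)) fun r r' k k' h =>
      hvv r r' (k + k') (by rw [← h, pow_add]; ring)
  exact ⟨C, h0, fun r hr hα k => h1 ⟨r, hr, hα⟩ k, fun r hr hα k => h2 ⟨r, Or.inl ⟨hr, hα⟩⟩ k,
    fun hζ r hr hα k => h2 ⟨r, Or.inr ⟨hζ, hr, hα⟩⟩ k⟩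

lemma pow_mul_tTilde_mul_tTilde_ne_one {q : ℂ} (hq0 : q ≠ 0) {t : Fin 6 → ℂ}
    (hgen : ∀ (r r' : Fin 6) (k : ℤ), t r * t r' ≠ q ^ k) (mf mg : ℕ) (r r' : Fin 6) (k : ℕ) :
    q ^ k * (tTilde q mf mg t r * tTilde q mf mg t r') ≠ 1 := by
  intro h
  refine hgen r r' (poleOrder mf mg r + poleOrder mf mg r' - k) ?_
  change q ^ k * (t r / q ^ poleOrder mf mg r * (t r' / q ^ poleOrder mf mg r')) = 1 at h
  rw [zpow_sub₀ hq0, zpow_add₀ hq0, zpow_natCast, zpow_natCast, zpow_natCast]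
  field_simp at h ⊢
  linear_combination h

end EllipticLimit

end

open EllipticLimit in
theorem mainTheorem8 (q : ℂ) (hq0 : q ≠ 0) (hq1 : ‖q‖ < 1)
    (t : Fin 6 → ℂ) (ht : ∏ r, t r = q)
    (hgen : ∀ (r r' : Fin 6) (k : ℤ), t r * t r' ≠ q ^ k)
    (a b c : Fin 6) (hab : a ≠ b) (hac : a ≠ c) (hbc : b ≠ c)
    (α : Fin 6 → ℝ) (ζ : ℝ) (hζ : -1 / 2 ≤ ζ) (hζ0 : ζ < 0)
    (hα : ∑ r, α r = 1) (habc : α a + α b + α c = ζ)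
    (hin : ∀ r ∈ ({a, b, c} : Finset (Fin 6)), ζ ≤ α r ∧ α r ≤ -ζ)
    (hout : ∀ r ∉ ({a, b, c} : Finset (Fin 6)), -ζ ≤ α r ∧ α r ≤ 1 + ζ)
    (mf mg : ℕ) (f g : ℂ → ℂ → ℂ) (Sf Sg : HahnSeries ℝ (RatFunc ℂ))
    (hf : EllipticLimit.InATilde q (t 4) (α 4) ζ mf f Sf)
    (hg : EllipticLimit.InATilde q (t 5) (α 5) ζ mg g Sg) :
    -- all but countably many values of `p` are nondegenerate
    {s : ℂ | ¬ EllipticLimit.Nondegenerate q (Complex.exp s)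
      (fun r => EllipticLimit.tTilde q mf mg t r * EllipticLimit.ppow s (α r))}.Countable ∧
    -- for these the contour of the elliptic bilinear form exists
    (∀ s : ℂ, s.re < 0 → EllipticLimit.Nondegenerate q (Complex.exp s)
        (fun r => EllipticLimit.tTilde q mf mg t r * EllipticLimit.ppow s (α r)) →
      ∃ C, EllipticLimit.IsEllipticContour q (Complex.exp s)
        (fun r => EllipticLimit.tTilde q mf mg t r * EllipticLimit.ppow s (α r)) C) ∧
    -- the contour of the limiting integral exists
    (∃ C, EllipticLimit.IsLimitContour q (EllipticLimit.tTilde q mf mg t) α {a, b, c} ζ C) ∧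
    -- and the limit holds for all such contours
    ∀ (C : ℂ → EllipticLimit.ContourCycle) (C' : EllipticLimit.ContourCycle),
      (∀ s : ℂ, s.re < 0 → EllipticLimit.Nondegenerate q (Complex.exp s)
          (fun r => EllipticLimit.tTilde q mf mg t r * EllipticLimit.ppow s (α r)) →
        EllipticLimit.IsEllipticContour q (Complex.exp s)
          (fun r => EllipticLimit.tTilde q mf mg t r * EllipticLimit.ppow s (α r)) (C s)) →
      EllipticLimit.IsLimitContour q (EllipticLimit.tTilde q mf mg t) α {a, b, c} ζ C' →
      Tendsto
        (fun s : ℂ => EllipticLimit.ppow s (-Sf.order - Sg.order) *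
          EllipticLimit.ellForm q (Complex.exp s) (fun r => t r * EllipticLimit.ppow s (α r))
            (C s) (f s) (g s))
        (EllipticLimit.pToZero ⊓ 𝓟 {s : ℂ | EllipticLimit.Nondegenerate q (Complex.exp s)
          (fun r => EllipticLimit.tTilde q mf mg t r * EllipticLimit.ppow s (α r))})
        (𝓝 (EllipticLimit.limitForm q t α {a, b, c} ζ C' Sf.leadingCoeff Sg.leadingCoeff)) := by
  have ht0 : ∀ r, t r ≠ 0 := fun r => Finset.prod_ne_zero_iff.1 (ht ▸ hq0) r (Finset.mem_univ r)
  have hv : ∀ r, tTilde q mf mg t r ≠ 0 := fun r => div_ne_zero (ht0 r) (pow_ne_zero _ hq0)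
  have hvv := pow_mul_tTilde_mul_tTilde_ne_one hq0 hgen mf mg
  refine ⟨countable_degenerate α hvv, fun s hs hN => exists_isEllipticContour
    (Complex.exp_ne_zero s) (norm_exp_lt_one hs) hq0 hq1
    (fun r => mul_ne_zero (hv r) (ppow_ne_zero s _)) hN,
    exists_isLimitContour hq0 hq1 hv hvv α _ ζ, fun C C' hC hC' => ?_⟩
  have hI := tendsto_integral_ellWeight hq0 hq1 ht0 hab hac hbc hζ hζ0 habc hin hout hf hg
    (N := {s | Nondegenerate q (Complex.exp s) fun r => tTilde q mf mg t r * ppow s (α r)})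
    (fun s hsN hs => hC s hs hsN) hC'
  have hG : Tendsto (fun s => ∏ x : Fin 6 × Fin 6 with x.1 < x.2,
      ellGamma (ppow s (pairExponent α {a, b, c} x.1 x.2) * (t x.1 * t x.2)) (Complex.exp s) q)
      pToZero (𝓝 (∏ x : Fin 6 × Fin 6 with x.1 < x.2,
        gammaLimit q (pairExponent α {a, b, c} x.1 x.2) (t x.1 * t x.2))) := by
    refine tendsto_finsetProd _ fun x hx => ?_
    have he := pairExponent_mem_Icc hab hac hbc hα habc hζ hζ0 hin hout
      (Finset.mem_filter.1 hx).2.ne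
    exact tendsto_ellGamma_ppow tendsto_id tendsto_const_nhds hq1 he.1 he.2
      (mul_ne_zero (ht0 _) (ht0 _)) fun _ => (gammaLimit_mul_ne_zero hq0 hq1 ht0 hgen _ _).1
  have hG0 : (∏ x : Fin 6 × Fin 6 with x.1 < x.2,
      gammaLimit q (pairExponent α {a, b, c} x.1 x.2) (t x.1 * t x.2)) ≠ 0 :=
    Finset.prod_ne_zero_iff.2 fun x _ => (gammaLimit_mul_ne_zero hq0 hq1 ht0 hgen _ _).2 _
  have hpp : Tendsto (fun s => qPoch (Complex.exp s) (Complex.exp s)) pToZero (𝓝 1) := by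
    have := tendsto_qPoch tendsto_exp_pToZero tendsto_exp_pToZero (by simp)
    rwa [qPoch_zero] at this
  -- The factor `2` in the denominator of the bilinear form cancels the `2` that comes from folding
  -- the integral under `z ↦ 1/z`.
  have hmain := (((hpp.const_mul (qPoch q q)).div (hG.const_mul 2)
    (mul_ne_zero two_ne_zero hG0)).mono_left inf_le_left).mul hI
  rw [limitForm, limitConst_eq hab hac hbc hα habc hζ0 hin hout]
  convert hmain.congr' ?_ using 2
  · field_simp
  · filter_upwards [(hG.eventually_ne hG0).filter_mono inf_le_left,
      eventually_re_neg.filter_mono inf_le_left, mem_inf_of_right (mem_principal_self _)]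
      with s hs0 hs hN
    have hκ := prod_ellGamma_mul_theta hq0 hq1 hab hac hbc hs hN
    simp only [Pi.div_apply]
    rw [← hκ] at hs0 ⊢
    have h1 := left_ne_zero_of_mul hs0
    have h2 := right_ne_zero_of_mul hs0
    rw [ellForm]
    change _ = ppow s (-Sf.order - Sg.order) * (_ * (C s).integral fun z => f s z * g s z *
      ellWeight q (Complex.exp s) (fun r => t r * ppow s (α r)) z * (2 * Real.pi * Complex.I * z)⁻¹)
    generalize (C s).integral _ = J
    -- The theta constants multiply both the integral and the normalizing gamma product, so they
    -- cancel. They are nonzero for small `p` because the shifted gamma product has a nonzero limit.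
    generalize theta _ q * theta _ q * theta _ q = κ at h2 ⊢
    field_simp
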